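/- Definitions. Graphs are finite, simple and undirected. A graph is $c$-closed if any two distinct non-adjacent vertices have at most $c-1$ common neighbours. A graph $H$ is $d$-degenerate if every induced subgraph of $H$ on a nonempty vertex set has a vertex whose degree in that subgraph is at most $d$; a graph has co-degeneracy at most $d$ if its complement is $d$-degenerate. A maximal subgraph of $G$ with co-degeneracy at most $d$ is given by an inclusion-maximal vertex set $S\subseteq V(G)$ such that the induced subgraph $G[S]$ has co-degeneracy at most $d$. Algorithms are programs for a unit-cost random access machine (addition, truncated subtraction, multiplication, indirect addressing, tests and loops, each elementary operation costing one step) that receive $n$ and the adjacency matrix of a graph on $n\ge 1$ vertices; the words of the machine have to hold only numbers bounded by a constant times the claimed running time. Statement. For every fixed integer $d\ge 1$ there are a constant $\gamma_d$ with $0<\gamma_d<2$, a constant $K_d$, and an algorithm such that, for every $n\ge1$, every $c\ge 0$ and every $c$-closed graph $G$ on $n$ vertices, the algorithm on input $G$ outputs each maximal subgraph of $G$ with co-degeneracy at most $d$ exactly once and halts after at most $K_d\cdot n^{9d+4}\cdot\gamma_d^{2dc}$ steps. (In particular, this is an FPT algorithm with respect to the parameter $c$.) -/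

import Mathlib

/-! ## Graph notions -/

/-- `G` is `c`-closed: any two distinct non-adjacent vertices have fewer than `c` common
neighbours (equivalently, two vertices with at least `c` common neighbours are adjacent). -/
def CClosed {V : Type*} (G : SimpleGraph V) (c : ℕ) : Prop :=
  ∀ u v : V, u ≠ v → ¬ G.Adj u v → (G.commonNeighbors u v).encard < c

/-- `G` is `d`-degenerate: every induced subgraph `G[S]` on a nonempty vertex set `S` has a vertex
whose degree in `G[S]` is at most `d`. -/
def IsDegenerate {V : Type*} (G : SimpleGraph V) (d : ℕ) : Prop :=
  ∀ S : Set V, S.Nonempty → ∃ v : S, ((G.induce S).neighborSet v).encard ≤ d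

/-- `G` has co-degeneracy at most `d`: its complement is `d`-degenerate. -/
def CodegeneracyLE {V : Type*} (G : SimpleGraph V) (d : ℕ) : Prop :=
  IsDegenerate Gᶜ d

/-- `S` induces a maximal subgraph of co-degeneracy at most `d`: `G[S]` has co-degeneracy at most
`d`, and no proper superset of `S` has this property. -/
def IsMaximalCodegenerate {n : ℕ} (G : SimpleGraph (Fin n)) (d : ℕ) (S : Finset (Fin n)) : Prop :=
  Maximal (fun T : Finset (Fin n) => CodegeneracyLE (G.induce (T : Set (Fin n))) d) S

/-! ## The machine model

A unit-cost random access machine with bounded words, programmed in a structured language.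
The memory consists of scalar registers and of arrays (each an unbounded sequence of words), both
numbered by `ℕ`; a program text mentions only finitely many of them, but it can access the entry of
an array at any computed index. There is a write-only output tape. -/

/-- Arithmetic expressions; `sub` is subtraction truncated at `0`. -/
inductive Expr where
  | lit (k : ℕ)
  | var (x : ℕ)
  | arr (a : ℕ) (i : Expr)
  | add (e f : Expr)
  | sub (e f : Expr)
  | mul (e f : Expr)

/-- Programs. A test `e` succeeds when the value of `e` is nonzero. -/
inductive Prog where
  | skip
  | assign (x : ℕ) (e : Expr)
  | store (a : ℕ) (i e : Expr)
  | emit (e : Expr)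
  | seq (p q : Prog)
  | ite (e : Expr) (p q : Prog)
  | loop (e : Expr) (p : Prog)

/-- A configuration of the memory together with the output produced so far. -/
structure Config where
  scalar : ℕ → ℕ
  array : ℕ → ℕ → ℕ
  output : List ℕ

/-- The value of an expression. -/
def Expr.eval (s : Config) : Expr → ℕ
  | .lit k => k
  | .var x => s.scalar x
  | .arr a i => s.array a (i.eval s)
  | .add e f => e.eval s + f.eval s
  | .sub e f => e.eval s - f.eval s
  | .mul e f => e.eval s * f.eval s

/-- The number of machine operations needed to evaluate an expression. -/
def Expr.cost : Expr → ℕ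
  | .lit _ => 1
  | .var _ => 1
  | .arr _ i => i.cost + 1
  | .add e f => e.cost + f.cost + 1
  | .sub e f => e.cost + f.cost + 1
  | .mul e f => e.cost + f.cost + 1

/-- All numbers that arise while the expression is evaluated are at most `W`, that is, they fit
into a machine word. -/
def Expr.Fits (W : ℕ) (s : Config) : Expr → Prop
  | .lit k => k ≤ W
  | .var x => s.scalar x ≤ W
  | .arr a i => i.Fits W s ∧ s.array a (i.eval s) ≤ W
  | .add e f => e.Fits W s ∧ f.Fits W s ∧ e.eval s + f.eval s ≤ W
  | .sub e f => e.Fits W s ∧ f.Fits W s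
  | .mul e f => e.Fits W s ∧ f.Fits W s ∧ e.eval s * f.eval s ≤ W

/-- `Exec W p s t s'`: on a machine whose words hold the numbers `0, …, W`, the program `p` started
in configuration `s` halts after exactly `t` steps in configuration `s'`. A run in which a number
exceeding `W` would arise is stuck, hence has no such derivation. -/
inductive Exec (W : ℕ) : Prog → Config → ℕ → Config → Prop where
  | skip (s : Config) : Exec W .skip s 1 s
  | assign (s : Config) (x : ℕ) (e : Expr) (he : e.Fits W s) :
      Exec W (.assign x e) s (e.cost + 1)
        { s with scalar := Function.update s.scalar x (e.eval s) }
  | store (s : Config) (a : ℕ) (i e : Expr) (hi : i.Fits W s) (he : e.Fits W s) :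
      Exec W (.store a i e) s (i.cost + e.cost + 1)
        { s with array :=
            Function.update s.array a (Function.update (s.array a) (i.eval s) (e.eval s)) }
  | emit (s : Config) (e : Expr) (he : e.Fits W s) :
      Exec W (.emit e) s (e.cost + 1) { s with output := s.output ++ [e.eval s] }
  | seq {p q : Prog} {s s' s'' : Config} {t t' : ℕ} (hp : Exec W p s t s')
      (hq : Exec W q s' t' s'') : Exec W (.seq p q) s (t + t') s''
  | ite_true {e : Expr} {p q : Prog} {s s' : Config} {t : ℕ} (he : e.Fits W s)
      (h : e.eval s ≠ 0) (hp : Exec W p s t s') : Exec W (.ite e p q) s (e.cost + 1 + t) s'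
  | ite_false {e : Expr} {p q : Prog} {s s' : Config} {t : ℕ} (he : e.Fits W s)
      (h : e.eval s = 0) (hq : Exec W q s t s') : Exec W (.ite e p q) s (e.cost + 1 + t) s'
  | loop_stop {e : Expr} {p : Prog} {s : Config} (he : e.Fits W s) (h : e.eval s = 0) :
      Exec W (.loop e p) s (e.cost + 1) s
  | loop_step {e : Expr} {p : Prog} {s s' s'' : Config} {t t' : ℕ} (he : e.Fits W s)
      (h : e.eval s ≠ 0) (hp : Exec W p s t s') (hl : Exec W (.loop e p) s' t' s'') :
      Exec W (.loop e p) s (e.cost + 1 + t + t') s''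

/-! ## Input and output conventions -/

open Classical in
/-- The initial configuration for a graph on `Fin n`: scalar `0` holds `n`, array `0` holds the
adjacency matrix row by row (row `u` occupies the indices `u * n, …, u * n + n - 1`), everything
else is `0`, and the output is empty. -/
noncomputable def inputConfig {n : ℕ} (G : SimpleGraph (Fin n)) : Config where
  scalar x := if x = 0 then n else 0
  array a i :=
    if a = 0 ∧ ∃ u v : Fin n, G.Adj u v ∧ i = (u : ℕ) * n + (v : ℕ) then 1 else 0
  output := []

/-- A vertex set as a word of `n` bits, its characteristic vector. -/
def charVector {n : ℕ} (S : Finset (Fin n)) : List ℕ :=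
  List.ofFn fun i : Fin n => if i ∈ S then 1 else 0

/-- The output word `out` enumerates the family `F` of vertex sets: it is the concatenation of the
characteristic vectors of the members of `F`, in some order, each of them exactly once. -/
def Enumerates {n : ℕ} (F : Finset (Fin n) → Prop) (out : List ℕ) : Prop :=
  ∃ L : List (Finset (Fin n)), L.Nodup ∧ (∀ S, S ∈ L ↔ F S) ∧ out = L.flatMap charVector

/-! The number of candidates is bounded by cutting a maximal set `S` into a tail `T` and a clique.
Among the nonempty `T ⊆ S` for which `S \ T` is a clique, each of whose vertices has at most `d`
non-neighbours in `T`, take one of least size. By maximality of `S`, the set `S \ T` is a maximal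
clique among the vertices that may precede `T` in an elimination ordering
(`MaxCoDeg.maxClique_heads`). Co-degeneracy gives `v ∈ T` with at most `d` other non-neighbours in
`T`. Unless `T = {v}`, minimality forbids moving `v` into the clique, so some `a ∈ S \ T` is not
adjacent to `v`. Every vertex of `T` is then a non-neighbour of `a` or of `v`, which leaves at most
`2 * d` of them, or a common neighbour of the non-adjacent pair `a`, `v`, and closure bounds the
number of these by `c` (`MaxCoDeg.exists_tail`). So `2 * d + 2` vertices and a subset of at most `c`
vertices determine `T`.

For a maximal clique `A` of a set `X`, let `k` be the largest vertex such that the part `B` of `A`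
below `k` is not a maximal clique of the part of `X` below `k`. Beyond `k` the clique arises
greedily. Some `u < k` in `X` is adjacent to all of `B` but not to `k`, and `B` is a maximal clique
among the common neighbours of `k` and `u` in `X` below `k`. If no such `k` exists, `A` is the
greedy clique (`MaxClique.exists_seed`). A set of `r` vertices has at most `fib (r + 2)` maximal
cliques: a vertex adjacent to all others is forced, while choosing any other vertex discards at
least two vertices and rejecting it discards one (`MaxClique.exists_code`).

Altogether there are at most `n ^ (2 * d + 4) * 2 ^ c * fib (c + 2)` candidates. Since `fib (c + 2)
≤ 2 * (7/4) ^ c` and `7/2 < (19/10) ^ 2`, the base `19/10` suffices already for `d = 1`. The program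
decodes every candidate, tests its maximality by peeling, and uses a trie to output each set only
once. A program logic that records time bounds, word bounds and the registers left untouched carries
the verification. -/

open Function

/-! ## Program logic -/

/-- The scalars a program may write. -/
def Prog.scalars : Prog → List ℕ
  | .skip => []
  | .assign x _ => [x]
  | .store _ _ _ => []
  | .emit _ => []
  | .seq p q => p.scalars ++ q.scalars
  | .ite _ p q => p.scalars ++ q.scalars
  | .loop _ p => p.scalars

/-- The arrays a program may write. -/
def Prog.arrays : Prog → List ℕ
  | .skip => []
  | .assign _ _ => []
  | .store a _ _ => [a]
  | .emit _ => []
  | .seq p q => p.arrays ++ q.arrays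
  | .ite _ p q => p.arrays ++ q.arrays
  | .loop _ p => p.arrays

/-- Whether a program contains an output instruction. -/
def Prog.emits : Prog → Bool
  | .skip => false
  | .assign _ _ => false
  | .store _ _ _ => false
  | .emit _ => true
  | .seq p q => p.emits || q.emits
  | .ite _ p q => p.emits || q.emits
  | .loop _ p => p.emits

/-- `s'` differs from `s` only in places that `p` may write. -/
structure Frame (p : Prog) (s s' : Config) : Prop where
  scalar : ∀ x, x ∉ p.scalars → s'.scalar x = s.scalar x
  array : ∀ a, a ∉ p.arrays → s'.array a = s.array a
  output : p.emits = false → s'.output = s.output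

theorem Frame.refl (p : Prog) (s : Config) : Frame p s s :=
  ⟨fun _ _ => rfl, fun _ _ => rfl, fun _ => rfl⟩

/-- Specifications of subprograms thereby need to mention only what they write; everything else is
carried over by computing the lists of written registers. -/
theorem Exec.frame {W t : ℕ} {p : Prog} {s s' : Config} (h : Exec W p s t s') :
    Frame p s s' := by
  induction h with
  | skip s => exact Frame.refl _ _
  | assign s x e he =>
    refine ⟨fun y hy => ?_, fun _ _ => rfl, fun _ => rfl⟩
    simp only [Prog.scalars, List.mem_singleton] at hy
    exact update_of_ne hy _ _
  | store s a i e hi he =>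
    refine ⟨fun y hy => rfl, fun b hb => ?_, fun _ => rfl⟩
    simp only [Prog.arrays, List.mem_singleton] at hb
    exact update_of_ne hb _ _
  | emit s e he => exact ⟨fun _ _ => rfl, fun _ _ => rfl, fun h => by simp [Prog.emits] at h⟩
  | seq hp hq ihp ihq =>
    refine ⟨fun y hy => ?_, fun b hb => ?_, fun h => ?_⟩
    · simp only [Prog.scalars, List.mem_append, not_or] at hy
      rw [ihq.scalar y hy.2, ihp.scalar y hy.1]
    · simp only [Prog.arrays, List.mem_append, not_or] at hb
      rw [ihq.array b hb.2, ihp.array b hb.1]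
    · simp only [Prog.emits, Bool.or_eq_false_iff] at h
      rw [ihq.output h.2, ihp.output h.1]
  | ite_true he h hp ih =>
    refine ⟨fun y hy => ?_, fun b hb => ?_, fun h => ?_⟩
    · simp only [Prog.scalars, List.mem_append, not_or] at hy
      exact ih.scalar y hy.1
    · simp only [Prog.arrays, List.mem_append, not_or] at hb
      exact ih.array b hb.1
    · simp only [Prog.emits, Bool.or_eq_false_iff] at h
      exact ih.output h.1
  | ite_false he h hp ih =>
    refine ⟨fun y hy => ?_, fun b hb => ?_, fun h => ?_⟩
    · simp only [Prog.scalars, List.mem_append, not_or] at hy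
      exact ih.scalar y hy.2
    · simp only [Prog.arrays, List.mem_append, not_or] at hb
      exact ih.array b hb.2
    · simp only [Prog.emits, Bool.or_eq_false_iff] at h
      exact ih.output h.2
  | loop_stop he h => exact Frame.refl _ _
  | loop_step he h hp hl ihp ihl =>
    refine ⟨fun y hy => ?_, fun b hb => ?_, fun h => ?_⟩
    · rw [ihl.scalar y hy, ihp.scalar y hy]
    · rw [ihl.array b hb, ihp.array b hb]
    · rw [ihl.output h, ihp.output h]

/-- Started in `s`, the program `p` halts within `t` steps in a configuration satisfying `Q`. -/
def Runs (W t : ℕ) (p : Prog) (s : Config) (Q : Config → Prop) : Prop :=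
  ∃ t' s', t' ≤ t ∧ Exec W p s t' s' ∧ Q s'

/-- The frame is handed to the new postcondition, so facts about untouched registers can be added
afterwards. -/
theorem Runs.mono {W t t₂ : ℕ} {p : Prog} {s : Config} {Q R : Config → Prop}
    (h : Runs W t p s Q) (ht : t ≤ t₂) (hQ : ∀ s', Q s' → Frame p s s' → R s') :
    Runs W t₂ p s R := by
  obtain ⟨t', s', h1, h2, h3⟩ := h
  exact ⟨t', s', h1.trans ht, h2, hQ s' h3 h2.frame⟩

theorem Runs.le {W t t₂ : ℕ} {p : Prog} {s : Config} {Q : Config → Prop}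
    (h : Runs W t p s Q) (ht : t ≤ t₂) : Runs W t₂ p s Q :=
  h.mono ht fun _ h _ => h

theorem Runs.seq {W t₁ t₂ : ℕ} {p q : Prog} {s : Config} {Q R : Config → Prop}
    (h₁ : Runs W t₁ p s Q) (h₂ : ∀ s', Q s' → Frame p s s' → Runs W t₂ q s' R) :
    Runs W (t₁ + t₂) (.seq p q) s R := by
  obtain ⟨a, s', ha, hs, hQ⟩ := h₁
  obtain ⟨b, s'', hb, hs', hR⟩ := h₂ s' hQ hs.frame
  exact ⟨a + b, s'', by omega, .seq hs hs', hR⟩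

theorem Runs.skip {W : ℕ} {s : Config} {Q : Config → Prop} (h : Q s) : Runs W 1 .skip s Q :=
  ⟨1, s, le_rfl, .skip s, h⟩

theorem Runs.assign {W x : ℕ} {e : Expr} {s : Config} {Q : Config → Prop} (he : e.Fits W s)
    (h : Q { s with scalar := update s.scalar x (e.eval s) }) :
    Runs W (e.cost + 1) (.assign x e) s Q :=
  ⟨_, _, le_rfl, .assign s x e he, h⟩

theorem Runs.store {W a : ℕ} {i e : Expr} {s : Config} {Q : Config → Prop} (hi : i.Fits W s)
    (he : e.Fits W s)
    (h : Q { s with array := update s.array a (update (s.array a) (i.eval s) (e.eval s)) }) :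
    Runs W (i.cost + e.cost + 1) (.store a i e) s Q :=
  ⟨_, _, le_rfl, .store s a i e hi he, h⟩

theorem Runs.emit {W : ℕ} {e : Expr} {s : Config} {Q : Config → Prop} (he : e.Fits W s)
    (h : Q { s with output := s.output ++ [e.eval s] }) :
    Runs W (e.cost + 1) (.emit e) s Q :=
  ⟨_, _, le_rfl, .emit s e he, h⟩

/-- Both branches are charged. This loses only a constant factor and avoids maxima in the cost
arithmetic. -/
theorem Runs.ite {W t₁ t₂ : ℕ} {e : Expr} {p q : Prog} {s : Config} {Q : Config → Prop}
    (he : e.Fits W s) (h₁ : e.eval s ≠ 0 → Runs W t₁ p s Q)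
    (h₂ : e.eval s = 0 → Runs W t₂ q s Q) :
    Runs W (e.cost + 1 + (t₁ + t₂)) (.ite e p q) s Q := by
  by_cases h : e.eval s = 0
  · obtain ⟨t, s', ht, hs, hQ⟩ := h₂ h
    exact ⟨_, s', by omega, .ite_false he h hs, hQ⟩
  · obtain ⟨t, s', ht, hs, hQ⟩ := h₁ h
    exact ⟨_, s', by omega, .ite_true he h hs, hQ⟩

/-- Repeat `body` with the scalar `x` running from `0` to the value of the scalar `b`. -/
def Prog.for (x b : ℕ) (body : Prog) : Prog :=
  .seq (.assign x (.lit 0))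
    (.loop (.sub (.var b) (.var x)) (.seq body (.assign x (.add (.var x) (.lit 1)))))

theorem Frame.trans {p : Prog} {s s' s'' : Config} (h : Frame p s s') (h' : Frame p s' s'') :
    Frame p s s'' :=
  ⟨fun x hx => (h'.scalar x hx).trans (h.scalar x hx),
    fun x hx => (h'.array x hx).trans (h.array x hx),
    fun hx => (h'.output hx).trans (h.output hx)⟩

theorem Prog.mem_scalars_for {x b y : ℕ} {body : Prog} :
    y ∈ (Prog.for x b body).scalars ↔ y = x ∨ y ∈ body.scalars := by
  simp only [Prog.for, Prog.scalars, List.mem_append, List.mem_singleton]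
  tauto

theorem Frame.for_body {x b : ℕ} {body : Prog} {s s' : Config} (h : Frame body s s') :
    Frame (Prog.for x b body) s s' := by
  refine ⟨fun y hy => ?_, fun a ha => ?_, fun ho => ?_⟩
  · rw [Prog.mem_scalars_for, not_or] at hy
    exact h.scalar y hy.2
  · exact h.array a fun h' => ha (by simp [Prog.for, Prog.arrays, h'])
  · exact h.output (by simpa [Prog.for, Prog.emits] using ho)

theorem Frame.for_update {x b v : ℕ} {body : Prog} {s : Config} :
    Frame (Prog.for x b body) s { s with scalar := update s.scalar x v } := by
  refine ⟨fun y hy => ?_, fun a ha => rfl, fun ho => rfl⟩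
  rw [Prog.mem_scalars_for, not_or] at hy
  exact update_of_ne hy.1 _ _

/-- Each round costs 4 for the test and 4 for the increment besides the body; the initialisation and
the last test cost 2 and 4. The invariant is taken after the counter has been set, and every round
may use that the state differs from the initial one only in places the loop writes. -/
theorem Runs.for {W x b N tb : ℕ} {body : Prog} {s : Config} (I : ℕ → Config → Prop)
    (hN : s.scalar b = N) (hW : N + 1 ≤ W) (hxb : x ≠ b) (hx : x ∉ body.scalars)
    (hb : b ∉ body.scalars) (h0 : I 0 { s with scalar := update s.scalar x 0 })
    (hstep : ∀ i < N, ∀ s', s'.scalar x = i → I i s' → Frame (Prog.for x b body) s s' →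
      Runs W tb body s' fun s'' => I (i + 1) { s'' with scalar := update s''.scalar x (i + 1) }) :
    Runs W (N * (tb + 8) + 6) (Prog.for x b body) s (I N) := by
  -- Induction on the number `k` of rounds still to come, with the counter `i` running upwards.
  have key : ∀ k i : ℕ, i + k = N → ∀ s', s'.scalar x = i → I i s' →
      Frame (Prog.for x b body) s s' →
      Runs W (k * (tb + 8) + 4)
        (.loop (.sub (.var b) (.var x)) (.seq body (.assign x (.add (.var x) (.lit 1))))) s'
        (I N) := by
    intro k
    induction k with
    | zero =>
      intro i hi s' hs' hI hF
      have hbN : s'.scalar b = N := by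
        rw [hF.scalar b (by rw [Prog.mem_scalars_for]; tauto), hN]
      refine ⟨_, s', ?_, Exec.loop_stop ?_ ?_, ?_⟩
      · simp [Expr.cost]
      · simp only [Expr.Fits]; omega
      · simp only [Expr.eval]; omega
      · rwa [← hi]
    | succ k ih =>
      intro i hi s' hs' hI hF
      have hbN : s'.scalar b = N := by
        rw [hF.scalar b (by rw [Prog.mem_scalars_for]; tauto), hN]
      obtain ⟨t₁, s₁, ht₁, he₁, hI₁⟩ := hstep i (by omega) s' hs' hI hF
      have hx₁ : s₁.scalar x = i := by rw [he₁.frame.scalar x hx, hs']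
      have hfit : (Expr.add (.var x) (.lit 1)).Fits W s₁ := by
        simp only [Expr.Fits, Expr.eval]; omega
      have hex := Exec.assign s₁ x _ hfit
      have hev : (Expr.add (.var x) (.lit 1)).eval s₁ = i + 1 := by
        simp only [Expr.eval]; omega
      rw [hev] at hex
      obtain ⟨t₂, s₂, ht₂, he₂, hI₂⟩ := ih (i + 1) (by omega) _ (by simp) hI₁
        ((hF.trans he₁.frame.for_body).trans Frame.for_update)
      refine ⟨_, s₂, ?_, .loop_step ?_ ?_ (.seq he₁ hex) he₂, hI₂⟩
      · simp only [Expr.cost]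
        rw [Nat.succ_mul]; omega
      · simp only [Expr.Fits]; omega
      · simp only [Expr.eval]; omega
  have h1 : Runs W 2 (.assign x (.lit 0)) s
      fun s' => s' = { s with scalar := update s.scalar x 0 } :=
    Runs.assign (e := .lit 0) (Nat.zero_le W) rfl
  refine (Runs.seq h1 fun s' hs' _ => key N 0 (by omega) s' ?_ ?_ ?_).le (by omega)
  · simp [hs']
  · rwa [hs']
  · rw [hs']; exact Frame.for_update

/-! ## Combinatorics of sets of small co-degeneracy -/

section Combinatorics
open Classical

variable {H : SimpleGraph ℕ} {d n : ℕ}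

/-- The members of `Q` not adjacent to `v`, including `v` itself if it belongs to `Q`. -/
noncomputable def nonNbrs (H : SimpleGraph ℕ) (Q : Finset ℕ) (v : ℕ) : Finset ℕ :=
  Q.filter fun w => ¬ H.Adj v w

/-- The complement of the induced graph on `S` is `d`-degenerate. -/
def CoDeg (H : SimpleGraph ℕ) (d : ℕ) (S : Finset ℕ) : Prop :=
  ∀ Q ⊆ S, Q.Nonempty → ∃ v ∈ Q, (nonNbrs H Q v).card ≤ d + 1

/-- `S` is an inclusion-maximal subset of `{0, …, n - 1}` of co-degeneracy at most `d`. -/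
def MaxCoDeg (H : SimpleGraph ℕ) (d n : ℕ) (S : Finset ℕ) : Prop :=
  S ⊆ Finset.range n ∧ CoDeg H d S ∧ ∀ v < n, v ∉ S → ¬ CoDeg H d (insert v S)

/-- `A` is an inclusion-maximal clique in `X`. -/
def MaxClique (H : SimpleGraph ℕ) (X A : Finset ℕ) : Prop :=
  A ⊆ X ∧ (∀ a ∈ A, ∀ b ∈ A, a ≠ b → H.Adj a b) ∧ ∀ x ∈ X, ¬ ∀ a ∈ A, H.Adj x a

/-! ### Heredity and elimination orderings. -/

theorem nonNbrs_mono {Q R : Finset ℕ} (h : Q ⊆ R) (v : ℕ) : nonNbrs H Q v ⊆ nonNbrs H R v :=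
  Finset.filter_subset_filter _ h

theorem CoDeg.mono {S S' : Finset ℕ} (h : CoDeg H d S) (hs : S' ⊆ S) : CoDeg H d S' :=
  fun Q hQ hne => h Q (hQ.trans hs) hne

/-- Vertices of `A` are eliminated first: a set meeting `A` has a witness in `A`, and any other set
lies in `T`. -/
theorem CoDeg.union {A T : Finset ℕ} (hT : CoDeg H d T)
    (hA : ∀ a ∈ A, (nonNbrs H (A ∪ T) a).card ≤ d + 1) : CoDeg H d (A ∪ T) := by
  intro Q hQ hne
  by_cases h : ∃ a ∈ Q, a ∈ A
  · obtain ⟨a, haQ, haA⟩ := h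
    exact ⟨a, haQ, (Finset.card_le_card (nonNbrs_mono hQ a)).trans (hA a haA)⟩
  · push Not at h
    refine hT Q (fun x hx => ?_) hne
    have := Finset.mem_union.1 (hQ hx)
    exact this.resolve_left (h x hx)

theorem CoDeg.of_erase {S : Finset ℕ} {v : ℕ} (hv : (nonNbrs H S v).card ≤ d + 1)
    (h : CoDeg H d (S.erase v)) : CoDeg H d S := by
  by_cases hvS : v ∈ S
  · have he : {v} ∪ S.erase v = S := by
      rw [← Finset.insert_eq, Finset.insert_erase hvS]
    rw [← he]
    refine h.union fun a ha => ?_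
    rw [he, Finset.mem_singleton.1 ha]
    exact hv
  · rwa [Finset.erase_eq_of_notMem hvS] at h

theorem CoDeg.empty : CoDeg H d ∅ := by
  intro Q hQ hne
  rw [Finset.subset_empty.1 hQ] at hne
  exact absurd hne (by simp)

/-- The vertices that can be put in front of `T` in an elimination ordering. -/
noncomputable def heads (H : SimpleGraph ℕ) (d n : ℕ) (T : Finset ℕ) : Finset ℕ :=
  (Finset.range n).filter fun x => x ∉ T ∧ (nonNbrs H T x).card ≤ d

/-- The common neighbours of `p` and `q` if these are distinct and not adjacent. -/
noncomputable def common (H : SimpleGraph ℕ) (n p q : ℕ) : Finset ℕ :=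
  (Finset.range n).filter fun v => (p ≠ q ∧ ¬ H.Adj p q) ∧ H.Adj p v ∧ H.Adj q v

/-! ### Cutting a maximal set into a tail and a clique. -/

theorem nonNbrs_clique_union {A T : Finset ℕ} (hA : ∀ a ∈ A, ∀ b ∈ A, a ≠ b → H.Adj a b)
    {a : ℕ} (ha : a ∈ A) (hd : (nonNbrs H T a).card ≤ d) :
    (nonNbrs H (A ∪ T) a).card ≤ d + 1 := by
  have : nonNbrs H (A ∪ T) a ⊆ insert a (nonNbrs H T a) := by
    intro x hx
    simp only [nonNbrs, Finset.mem_filter, Finset.mem_union, Finset.mem_insert] at hx ⊢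
    by_cases hxa : x = a
    · exact Or.inl hxa
    · rcases hx.1 with h | h
      · exact absurd (hA a ha x h (Ne.symm hxa)) hx.2
      · exact Or.inr ⟨h, hx.2⟩
  exact (Finset.card_le_card this).trans ((Finset.card_insert_le _ _).trans (by omega))

/-- A head `x` adjacent to the whole clique could be put in front of `T` together with it. Then
`insert x S` would still have co-degeneracy at most `d`, contradicting maximality. -/
theorem MaxCoDeg.maxClique_heads {S T : Finset ℕ} (hS : MaxCoDeg H d n S) (hTS : T ⊆ S)
    (hcl : ∀ a ∈ S \ T, ∀ b ∈ S \ T, a ≠ b → H.Adj a b)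
    (hd : ∀ a ∈ S \ T, (nonNbrs H T a).card ≤ d) : MaxClique H (heads H d n T) (S \ T) := by
  refine ⟨fun a ha => ?_, hcl, fun x hx hadj => ?_⟩
  · exact Finset.mem_filter.2 ⟨hS.1 (Finset.mem_sdiff.1 ha).1, (Finset.mem_sdiff.1 ha).2, hd a ha⟩
  · obtain ⟨hxn, hxT, hxd⟩ := Finset.mem_filter.1 hx
    have hxA : x ∉ S \ T := fun h => H.irrefl (hadj x h)
    have hxS : x ∉ S := fun h => hxA (Finset.mem_sdiff.2 ⟨h, hxT⟩)
    refine hS.2.2 x (Finset.mem_range.1 hxn) hxS ?_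
    have he : insert x S = insert x (S \ T) ∪ T := by
      rw [Finset.insert_union, Finset.sdiff_union_of_subset hTS]
    have hcl' : ∀ a ∈ insert x (S \ T), ∀ b ∈ insert x (S \ T), a ≠ b → H.Adj a b := by
      intro a ha b hb hab
      rcases Finset.mem_insert.1 ha with rfl | ha' <;>
        rcases Finset.mem_insert.1 hb with rfl | hb'
      · exact absurd rfl hab
      · exact hadj b hb'
      · exact (hadj a ha').symm
      · exact hcl a ha' b hb' hab
    rw [he]
    refine (hS.2.1.mono hTS).union fun a ha => nonNbrs_clique_union hcl' ha ?_
    rcases Finset.mem_insert.1 ha with rfl | ha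
    · exact hxd
    · exact hd a ha

theorem MaxCoDeg.nonempty {S : Finset ℕ} (hS : MaxCoDeg H d n S) (hn : 1 ≤ n) : S.Nonempty := by
  by_contra h
  rw [Finset.not_nonempty_iff_eq_empty] at h
  subst h
  refine hS.2.2 0 hn (by simp) (CoDeg.of_erase (v := 0) ?_ ?_)
  · exact (Finset.card_le_card (Finset.filter_subset _ _)).trans (by simp)
  · simpa using CoDeg.empty

/-- The tail consists of few exceptional vertices `E` and a part `U` of the common neighbourhood of
a non-adjacent pair. In a closed graph this leaves few possibilities for it. -/
theorem MaxCoDeg.exists_tail {S : Finset ℕ} (hS : MaxCoDeg H d n S) (hn : 1 ≤ n) (hd : 1 ≤ d) :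
    ∃ T : Finset ℕ, T.Nonempty ∧ T ⊆ S ∧ MaxClique H (heads H d n T) (S \ T) ∧
      ∃ p < n, ∃ q < n, ∃ E U : Finset ℕ, T = E ∪ U ∧ E.Nonempty ∧ E.card ≤ 2 * d ∧
        U ⊆ common H n p q := by
  -- The whole of `S` is an admissible tail, so one of least size exists.
  obtain ⟨T, hT, hmin⟩ := Finset.exists_min_image
    (S.powerset.filter fun T => T.Nonempty ∧ (∀ a ∈ S \ T, ∀ b ∈ S \ T, a ≠ b → H.Adj a b) ∧
      ∀ a ∈ S \ T, (nonNbrs H T a).card ≤ d) Finset.card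
    ⟨S, by simp +contextual [hS.nonempty hn]⟩
  simp only [Finset.mem_filter, Finset.mem_powerset] at hT hmin
  obtain ⟨hTS, hTne, hcl, hdeg⟩ := hT
  refine ⟨T, hTne, hTS, hS.maxClique_heads hTS hcl hdeg, ?_⟩
  obtain ⟨v, hvT, hv⟩ := hS.2.1 T hTS hTne
  have hvn : v < n := Finset.mem_range.1 (hS.1 (hTS hvT))
  by_cases h1 : T = {v}
  -- With `p = q` the set `common` is empty by definition, and `1 ≤ 2 * d`.
  · exact ⟨v, hvn, v, hvn, {v}, ∅, by simpa using h1, by simp, by simp; omega, by simp⟩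
  have hne : (T.erase v).Nonempty := by
    by_contra h
    rw [Finset.not_nonempty_iff_eq_empty, Finset.erase_eq_empty_iff] at h
    rcases h with h | h
    · exact hTne.ne_empty h
    · exact h1 h
  -- If `v` were adjacent to the whole clique, it could join it, and `T.erase v` would be a smaller
  -- admissible tail.
  obtain ⟨a, ha, hav⟩ : ∃ a ∈ S \ T, ¬ H.Adj a v := by
    by_contra hcon
    push Not at hcon
    have hsub : ∀ a ∈ S \ T.erase v, a = v ∨ a ∈ S \ T := by
      intro a ha
      simp only [Finset.mem_sdiff, Finset.mem_erase] at ha ⊢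
      tauto
    have := hmin (T.erase v) ⟨(Finset.erase_subset _ _).trans hTS, hne, ?_, ?_⟩
    · have := Finset.card_erase_lt_of_mem hvT
      omega
    · intro a ha b hb hab
      rcases hsub a ha with rfl | ha' <;> rcases hsub b hb with rfl | hb'
      · exact absurd rfl hab
      · exact (hcon b hb').symm
      · exact hcon a ha'
      · exact hcl a ha' b hb' hab
    · intro a ha
      rcases hsub a ha with rfl | ha'
      -- The vertex moved out of the tail counts itself among its at most `d + 1` non-neighbours, so
      -- at most `d` remain in the new tail.
      · have : nonNbrs H (T.erase a) a ⊆ (nonNbrs H T a).erase a := by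
          intro x hx
          simp only [nonNbrs, Finset.mem_filter, Finset.mem_erase] at hx ⊢
          tauto
        refine (Finset.card_le_card this).trans ?_
        rw [Finset.card_erase_of_mem (by simp [nonNbrs, hvT])]
        omega
      · exact (Finset.card_le_card (nonNbrs_mono (Finset.erase_subset _ _) a)).trans (hdeg a ha')
  obtain ⟨haS, haT⟩ := Finset.mem_sdiff.1 ha
  -- `E` collects the non-neighbours of `a` and those of `v` other than `v`. The vertex `v` is still
  -- in `E`, being a non-neighbour of `a`, so at most `d + d` vertices suffice.
  refine ⟨a, Finset.mem_range.1 (hS.1 haS), v, hvn,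
    nonNbrs H T a ∪ (nonNbrs H T v).erase v, common H n a v ∩ T, ?_, ⟨v, ?_⟩, ?_,
    Finset.inter_subset_left⟩
  · ext x
    have hxn : x ∈ T → x < n := fun hx => Finset.mem_range.1 (hS.1 (hTS hx))
    have hne : a ≠ v := fun h => haT (h ▸ hvT)
    simp only [nonNbrs, common, Finset.mem_union, Finset.mem_filter, Finset.mem_erase,
      Finset.mem_inter, Finset.mem_range]
    by_cases hxv : x = v
    · subst hxv; tauto
    · tauto
  · simp [nonNbrs, hvT, hav]
  · refine (Finset.card_union_le _ _).trans ?_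
    rw [Finset.card_erase_of_mem (by simp [nonNbrs, hvT])]
    have := hdeg a ha
    omega

/-- Apply `f v`, `f (v + 1)`, …, `f (v + k - 1)` in this order. -/
def iter {α : Type*} (f : ℕ → α → α) (v : ℕ) : ℕ → α → α
  | 0, a => a
  | k + 1, a => f (v + k) (iter f v k a)

theorem iter_succ' {α : Type*} (f : ℕ → α → α) (v k : ℕ) (a : α) :
    iter f v (k + 1) a = iter f (v + 1) k (f v a) := by
  induction k with
  | zero => rfl
  | succ k ih =>
    rw [iter, ih, iter]
    congr 1
    omega

/-- One step of the greedy extension of a clique within `X`. -/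
noncomputable def greedyStep (H : SimpleGraph ℕ) (X : Finset ℕ) (v : ℕ) (C : Finset ℕ) :
    Finset ℕ :=
  if v ∈ X ∧ nonNbrs H C v = ∅ then insert v C else C

/-! ### Greedy completion and numerical codes of maximal cliques. -/

theorem nonNbrs_eq_empty {C : Finset ℕ} {v : ℕ} :
    nonNbrs H C v = ∅ ↔ ∀ w ∈ C, H.Adj v w := by
  simp [nonNbrs, Finset.filter_eq_empty_iff]

/-- The part of `X` below `k` adjacent to both `k` and `u`, which are distinct, non-adjacent. -/
noncomputable def commonBelow (H : SimpleGraph ℕ) (n : ℕ) (X : Finset ℕ) (k u : ℕ) : Finset ℕ :=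
  (common H n k u).filter fun v => v ∈ X ∧ v < k

theorem iter_greedy_eq_self {X A : Finset ℕ} {m : ℕ}
    (h : ∀ x ∈ X, x < m → ¬ ∀ a ∈ A, H.Adj x a) : iter (greedyStep H X) 0 m A = A := by
  induction m with
  | zero => rfl
  | succ m ih =>
    rw [iter, ih fun x hx hxm => h x hx (by omega), greedyStep, if_neg]
    rintro ⟨h1, h2⟩
    rw [Nat.zero_add] at h1 h2
    exact h m h1 (by omega) (nonNbrs_eq_empty.1 h2)

/-- Induction on the initial segment of `X`. The greedy pass reproduces `A` as long as its trace on
the shorter segment is maximal there; the topmost failure produces the vertices `k` and `u`. -/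
theorem MaxClique.exists_seed {X : Finset ℕ} (hX : X ⊆ Finset.range n) (m : ℕ) :
    ∀ A, MaxClique H (X.filter (· < m)) A → ∃ C,
      (C = ∅ ∨ ∃ k < n, ∃ u < n, k ∈ X ∧ ∃ B, MaxClique H (commonBelow H n X k u) B ∧
        C = insert k B) ∧ iter (greedyStep H X) 0 m C = A := by
  induction m with
  | zero =>
    intro A hA
    refine ⟨∅, Or.inl rfl, ?_⟩
    have : A ⊆ ∅ := by simpa using hA.1
    rw [Finset.subset_empty.1 this]
    rfl
  | succ m ih =>
    intro A hA
    obtain ⟨hAX, hcl, hmax⟩ := hA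
    have hAX' : ∀ a ∈ A, a ∈ X ∧ a < m + 1 := fun a ha => Finset.mem_filter.1 (hAX ha)
    by_cases hm : MaxClique H (X.filter (· < m)) (A.filter (· < m))
    · obtain ⟨C, hC, hit⟩ := ih _ hm
      refine ⟨C, hC, ?_⟩
      rw [iter, hit, greedyStep, Nat.zero_add]
      simp only [nonNbrs_eq_empty]
      have hsplit : ∀ a ∈ A, a ≠ m → a ∈ A.filter (· < m) := fun a ha ham =>
        Finset.mem_filter.2 ⟨ha, by have := (hAX' a ha).2; omega⟩
      by_cases hmA : m ∈ A
      · rw [if_pos]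
        · ext x
          simp only [Finset.mem_insert, Finset.mem_filter]
          constructor
          · rintro (rfl | h)
            exacts [hmA, h.1]
          · intro hx
            have := (hAX' x hx).2
            by_cases hxm : x = m
            · exact Or.inl hxm
            · exact Or.inr ⟨hx, by omega⟩
        · exact ⟨(hAX' m hmA).1, fun w hw => hcl m hmA w (Finset.mem_filter.1 hw).1
            (Finset.mem_filter.1 hw).2.ne'⟩
      · have hfil : A.filter (· < m) = A := Finset.filter_true_of_mem fun a ha => by
          have := (hAX' a ha).2
          have : a ≠ m := fun h => hmA (h ▸ ha)
          omega
        rw [hfil, if_neg]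
        rintro ⟨h1, h2⟩
        exact hmax m (Finset.mem_filter.2 ⟨h1, by omega⟩) h2
    -- If `m` were not in `A`, the trace would be `A` itself, which is maximal in the smaller set as
    -- well.
    · have hmA : m ∈ A := by
        by_contra hmA
        have hfil : A.filter (· < m) = A := Finset.filter_true_of_mem fun a ha => by
          have := (hAX' a ha).2
          have : a ≠ m := fun h => hmA (h ▸ ha)
          omega
        apply hm
        rw [hfil]
        refine ⟨fun a ha => ?_, hcl, fun x hx => hmax x ?_⟩
        · rw [← hfil] at ha
          exact Finset.mem_filter.2 ⟨(hAX' a (Finset.mem_filter.1 ha).1).1,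
            (Finset.mem_filter.1 ha).2⟩
        · rw [Finset.mem_filter] at hx ⊢
          exact ⟨hx.1, by omega⟩
      set B := A.filter (· < m) with hB
      have hins : insert m B = A := by
        ext x
        simp only [hB, Finset.mem_insert, Finset.mem_filter]
        constructor
        · rintro (rfl | h)
          exacts [hmA, h.1]
        · intro hx
          have := (hAX' x hx).2
          by_cases hxm : x = m
          · exact Or.inl hxm
          · exact Or.inr ⟨hx, by omega⟩
      have hBA : ∀ b ∈ B, b ∈ A ∧ b < m := fun b hb => Finset.mem_filter.1 hb
      obtain ⟨u, huX, hum, hu⟩ : ∃ u ∈ X, u < m ∧ ∀ a ∈ B, H.Adj u a := by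
        by_contra hcon
        push Not at hcon
        refine hm ⟨fun b hb => ?_, fun a ha b hb => hcl a (hBA a ha).1 b (hBA b hb).1,
          fun x hx h => ?_⟩
        · exact Finset.mem_filter.2 ⟨(hAX' b (hBA b hb).1).1, (hBA b hb).2⟩
        · obtain ⟨a, ha, hna⟩ := hcon x (Finset.mem_filter.1 hx).1 (Finset.mem_filter.1 hx).2
          exact hna (h a ha)
      have hmu : ¬ H.Adj m u := by
        intro h
        refine hmax u (Finset.mem_filter.2 ⟨huX, by omega⟩) fun a ha => ?_
        rw [← hins, Finset.mem_insert] at ha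
        rcases ha with rfl | ha
        · exact h.symm
        · exact hu a ha
      have hmX := (hAX' m hmA).1
      -- The seed is all of `A = insert m B`; being maximal below `m + 1`, it is not changed by the
      -- greedy pass so far.
      refine ⟨A, Or.inr ⟨m, Finset.mem_range.1 (hX hmX), u, Finset.mem_range.1 (hX huX), hmX, B,
        ⟨fun b hb => ?_, fun a ha b hb => hcl a (hBA a ha).1 b (hBA b hb).1, fun x hx h => ?_⟩,
        hins.symm⟩, iter_greedy_eq_self fun x hx hxm => hmax x (Finset.mem_filter.2 ⟨hx, hxm⟩)⟩
      · have hbX := (hAX' b (hBA b hb).1).1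
        simp only [commonBelow, common, Finset.mem_filter]
        exact ⟨⟨hX hbX, ⟨by omega, hmu⟩, hcl m hmA b (hBA b hb).1 (hBA b hb).2.ne', hu b hb⟩,
          hbX, (hBA b hb).2⟩
      -- A vertex extending `B` inside the common neighbourhood is adjacent to `m` too, so it would
      -- extend `A`.
      · simp only [commonBelow, common, Finset.mem_filter] at hx
        refine hmax x (Finset.mem_filter.2 ⟨hx.2.1, by omega⟩) fun a ha => ?_
        rw [← hins, Finset.mem_insert] at ha
        rcases ha with rfl | ha
        · exact hx.1.2.2.1.symm
        · exact h a ha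

/-- The state of the decoding of a number into a clique: undecided vertices, rest of the number,
vertices chosen. -/
noncomputable def cliqueStep (H : SimpleGraph ℕ) (v : ℕ) (st : Finset ℕ × ℕ × Finset ℕ) :
    Finset ℕ × ℕ × Finset ℕ :=
  if v ∈ st.1 then
    if (nonNbrs H st.1 v).card ≤ 1 then (st.1.filter (H.Adj v), st.2.1, insert v st.2.2)
    else if Nat.fib (st.1.card + 1) ≤ st.2.1 then
      (st.1.filter (H.Adj v), st.2.1 - Nat.fib (st.1.card + 1), insert v st.2.2)
    else (st.1.erase v, st.2.1, st.2.2)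
  else st

/-- The codes below `fib (r + 2) = fib (r + 1) + fib r` are split into a lower block of length `fib
(r + 1)` for rejecting `v` and an upper block of length `fib r` for choosing it. A choice removes
`v` and at least one further non-neighbour; if there is no further one, maximality forces the choice
and no code is spent. -/
theorem MaxClique.exists_code (k : ℕ) : ∀ (v : ℕ) (R C B : Finset ℕ), R ⊆ Finset.Ico v (v + k) →
    MaxClique H R B → ∃ y < Nat.fib (R.card + 2),
      (iter (cliqueStep H) v k (R, y, C)).2.2 = B ∪ C := by
  induction k with
  | zero =>
    intro v R C B hR hB
    have hR' : R = ∅ := by simpa using hR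
    have hB' : B = ∅ := by simpa [hR'] using hB.1
    exact ⟨0, by simp [hR'], by simp [iter, hB']⟩
  | succ k ih =>
    intro v R C B hR hB
    obtain ⟨hBR, hcl, hmax⟩ := hB
    have hmono : ∀ {a b : ℕ}, a ≤ b → Nat.fib a ≤ Nat.fib b := fun h => Nat.fib_mono h
    have hdrop : ∀ R' ⊆ R, v ∉ R' → R' ⊆ Finset.Ico (v + 1) (v + 1 + k) := by
      intro R' hR' hv x hx
      have := Finset.mem_Ico.1 (hR (hR' hx))
      have : x ≠ v := fun h => hv (h ▸ hx)
      rw [Finset.mem_Ico]; omega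
    by_cases hvR : v ∈ R
    swap
    · obtain ⟨y, hy, hit⟩ := ih (v + 1) R C B (hdrop R subset_rfl hvR) ⟨hBR, hcl, hmax⟩
      refine ⟨y, hy, ?_⟩
      rw [iter_succ', cliqueStep, if_neg hvR, hit]
    have hinc : v ∈ B → MaxClique H (R.filter (H.Adj v)) (B.erase v) := by
      intro hvB
      refine ⟨fun b hb => ?_, fun a ha b hb => hcl a (Finset.mem_of_mem_erase ha) b
        (Finset.mem_of_mem_erase hb), fun x hx h => ?_⟩
      · rw [Finset.mem_erase] at hb
        exact Finset.mem_filter.2 ⟨hBR hb.2, hcl v hvB b hb.2 hb.1.symm⟩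
      · rw [Finset.mem_filter] at hx
        refine hmax x hx.1 fun a ha => ?_
        by_cases hav : a = v
        · rw [hav]; exact hx.2.symm
        · exact h a (Finset.mem_erase.2 ⟨hav, ha⟩)
    have hvf : v ∉ R.filter (H.Adj v) := by simp
    have hcard : (R.filter (H.Adj v)).card + (nonNbrs H R v).card = R.card :=
      Finset.card_filter_add_card_filter_not _
    have hunion : v ∈ B → B.erase v ∪ insert v C = B ∪ C := by
      intro hvB
      rw [Finset.union_insert, ← Finset.insert_union, Finset.insert_erase hvB]
    have hvnn : v ∈ nonNbrs H R v := by simp [nonNbrs, hvR]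
    have hpos : 0 < (nonNbrs H R v).card := Finset.card_pos.2 ⟨v, hvnn⟩
    by_cases h1 : (nonNbrs H R v).card ≤ 1
    · have hvB : v ∈ B := by
        -- A maximal clique avoiding `v` must contain a non-neighbour of `v`, but `v` itself is the
        -- only one.
        by_contra hvB
        refine hmax v hvR fun a ha => ?_
        by_contra hna
        have ha' : a ∈ nonNbrs H R v := by simp [nonNbrs, hBR ha, hna]
        exact hvB ((Finset.card_le_one.1 h1 a ha' v hvnn) ▸ ha)
      obtain ⟨y, hy, hit⟩ := ih (v + 1) _ (insert v C) _ (hdrop _ (Finset.filter_subset _ _) hvf)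
        (hinc hvB)
      refine ⟨y, hy.trans_le (hmono (by omega)), ?_⟩
      rw [iter_succ', cliqueStep, if_pos hvR, if_pos h1, hit, hunion hvB]
    · have hfib : Nat.fib (R.card + 2) = Nat.fib R.card + Nat.fib (R.card + 1) := Nat.fib_add_two
      by_cases hvB : v ∈ B
      · obtain ⟨y, hy, hit⟩ := ih (v + 1) _ (insert v C) _
          (hdrop _ (Finset.filter_subset _ _) hvf) (hinc hvB)
        -- At least two vertices leave `R`, so the remaining code lies below `fib R.card`.
        have hy' : y < Nat.fib R.card := hy.trans_le (hmono (by omega))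
        refine ⟨y + Nat.fib (R.card + 1), by omega, ?_⟩
        rw [iter_succ', cliqueStep, if_pos hvR, if_neg h1, if_pos (by simp)]
        simp only [Nat.add_sub_cancel]
        rw [hit, hunion hvB]
      · have hvB' : MaxClique H (R.erase v) B :=
          ⟨fun b hb => Finset.mem_erase.2 ⟨fun h => hvB (h ▸ hb), hBR hb⟩, hcl,
            fun x hx => hmax x (Finset.mem_of_mem_erase hx)⟩
        obtain ⟨y, hy, hit⟩ := ih (v + 1) _ C _
          (hdrop _ (Finset.erase_subset _ _) (by simp)) hvB'
        have hRc : 0 < R.card := Finset.card_pos.2 ⟨v, hvR⟩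
        rw [Finset.card_erase_of_mem hvR,
          show R.card - 1 + 2 = R.card + 1 by omega] at hy
        refine ⟨y, by omega, ?_⟩
        rw [iter_succ', cliqueStep, if_pos hvR, if_neg h1, if_neg (by simpa using hy), hit]

/-- The state of the decoding of a number into a subset of `Z`: number of members of `Z` left,
rest of the number, vertices chosen. -/
noncomputable def subsetStep (Z : Finset ℕ) (v : ℕ) (st : ℕ × ℕ × Finset ℕ) :
    ℕ × ℕ × Finset ℕ :=
  if v ∈ Z then
    if 2 ^ (st.1 - 1) ≤ st.2.1 then (st.1 - 1, st.2.1 - 2 ^ (st.1 - 1), insert v st.2.2)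
    else (st.1 - 1, st.2.1, st.2.2)
  else st

/-- Binary coding with the most significant bit first: only members of `Z` consume a bit, so the
code length is the number of members still ahead. -/
theorem exists_subset_code (Z : Finset ℕ) (k : ℕ) : ∀ (v : ℕ) (T U : Finset ℕ), U ⊆ Z →
    U ⊆ Finset.Ico v (v + k) →
    ∃ x < 2 ^ (Z.filter (· ∈ Finset.Ico v (v + k))).card,
      (iter (subsetStep Z) v k ((Z.filter (· ∈ Finset.Ico v (v + k))).card, x, T)).2.2 =
        U ∪ T := by
  induction k with
  | zero =>
    intro v T U hU hUv
    have hU' : U = ∅ := by simpa using hUv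
    exact ⟨0, by simp, by simp [iter, hU']⟩
  | succ k ih =>
    intro v T U hU hUv
    have hsub : ∀ U' ⊆ U, v ∉ U' → U' ⊆ Finset.Ico (v + 1) (v + 1 + k) := by
      intro U' hU' hv x hx
      have := Finset.mem_Ico.1 (hUv (hU' hx))
      have : x ≠ v := fun h => hv (h ▸ hx)
      rw [Finset.mem_Ico]; omega
    set c := (Z.filter (· ∈ Finset.Ico (v + 1) (v + 1 + k))).card with hc
    by_cases hvZ : v ∈ Z
    · have hcard : (Z.filter (· ∈ Finset.Ico v (v + (k + 1)))).card = c + 1 := by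
        rw [hc, ← Finset.card_insert_of_notMem (a := v) (by simp)]
        congr 1
        ext x
        simp only [Finset.mem_insert, Finset.mem_filter, Finset.mem_Ico]
        constructor
        · rintro ⟨h1, h2⟩
          by_cases hx : x = v
          · exact Or.inl hx
          · exact Or.inr ⟨h1, by omega⟩
        · rintro (rfl | h)
          · exact ⟨hvZ, by omega⟩
          · exact ⟨h.1, by omega⟩
      rw [hcard]
      by_cases hvU : v ∈ U
      · obtain ⟨x, hx, hit⟩ := ih (v + 1) (insert v T) (U.erase v)
          ((Finset.erase_subset _ _).trans hU) (hsub _ (Finset.erase_subset _ _) (by simp))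
        rw [← hc] at hx hit
        refine ⟨x + 2 ^ c, by rw [pow_succ]; omega, ?_⟩
        rw [iter_succ', subsetStep, if_pos hvZ, if_pos (by simp)]
        simp only [Nat.add_sub_cancel]
        rw [hit, Finset.union_insert, ← Finset.insert_union, Finset.insert_erase hvU]
      · obtain ⟨x, hx, hit⟩ := ih (v + 1) T U hU (hsub _ subset_rfl hvU)
        rw [← hc] at hx hit
        refine ⟨x, by rw [pow_succ]; omega, ?_⟩
        rw [iter_succ', subsetStep, if_pos hvZ, if_neg (by simpa using hx)]
        simp only [Nat.add_sub_cancel]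
        rw [hit]
    · have hcard : (Z.filter (· ∈ Finset.Ico v (v + (k + 1)))).card = c := by
        rw [hc]
        congr 1
        ext x
        simp only [Finset.mem_filter, Finset.mem_Ico]
        refine and_congr_right fun hx => ?_
        have : x ≠ v := fun h => hvZ (h ▸ hx)
        omega
      rw [hcard]
      obtain ⟨x, hx, hit⟩ := ih (v + 1) T U hU (hsub _ subset_rfl fun h => hvZ (hU h))
      refine ⟨x, hx, ?_⟩
      rw [iter_succ', subsetStep, if_neg hvZ, hit]

end Combinatorics

/-! ## Basic subroutines -/

section Subroutines
open Classical

variable {H : SimpleGraph ℕ} {d n W : ℕ} {s : Config}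

/-- The truth value of a proposition as a number. -/
noncomputable def tv (P : Prop) : ℕ := if P then 1 else 0

theorem tv_pos {P : Prop} (h : P) : tv P = 1 := if_pos h

theorem tv_neg {P : Prop} (h : ¬ P) : tv P = 0 := if_neg h

theorem tv_le_one (P : Prop) : tv P ≤ 1 := by
  unfold tv; split_ifs <;> omega

theorem tv_eq_zero {P : Prop} : tv P = 0 ↔ ¬ P := by
  by_cases h : P <;> simp [tv, h]

/-- The scalar `0` holds `n` and the array `0` the adjacency matrix of `H` on `{0, …, n - 1}`. -/
structure Input (H : SimpleGraph ℕ) (n : ℕ) (s : Config) : Prop where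
  size : s.scalar 0 = n
  adj : ∀ u < n, ∀ v < n, s.array 0 (u * n + v) = tv (H.Adj u v)

theorem Input.frame {p : Prog} {s' : Config} (h : Input H n s) (hF : Frame p s s')
    (h0 : 0 ∉ p.scalars) (h0' : 0 ∉ p.arrays) : Input H n s' :=
  ⟨by rw [hF.scalar 0 h0, h.size], by rw [hF.array 0 h0']; exact h.adj⟩

/-- The first `n` entries of `f` are the characteristic vector of `X`. -/
def IsChar (n : ℕ) (f : ℕ → ℕ) (X : Finset ℕ) : Prop :=
  ∀ v < n, f v = tv (v ∈ X)

/-- The expression `e` computes the truth value of `P`. -/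
def Ind (W : ℕ) (s : Config) (e : Expr) (P : Prop) : Prop :=
  e.Fits W s ∧ e.eval s = tv P

/-- Negation of truth values. -/
def Expr.not (e : Expr) : Expr := .sub (.lit 1) e

/-- Adjacency of the vertices held by the scalars `x` and `y`. -/
def Expr.adj (x y : ℕ) : Expr := .arr 0 (.add (.mul (.var x) (.var 0)) (.var y))

/-- The entry of the array `a` at the index held by the scalar `x`. -/
def Expr.get (a x : ℕ) : Expr := .arr a (.var x)

theorem Ind.congr {e : Expr} {P Q : Prop} (h : Ind W s e P) (hPQ : P ↔ Q) : Ind W s e Q := by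
  rwa [propext hPQ] at h

theorem Ind.eval_eq_zero {e : Expr} {P : Prop} (h : Ind W s e P) : e.eval s = 0 ↔ ¬ P := by
  rw [h.2, tv_eq_zero]

theorem Ind.eval_ne_zero {e : Expr} {P : Prop} (h : Ind W s e P) : e.eval s ≠ 0 ↔ P := by
  rw [Ne, h.eval_eq_zero, not_not]

theorem Ind.eval_le_one {e : Expr} {P : Prop} (h : Ind W s e P) : e.eval s ≤ 1 := by
  rw [h.2]; exact tv_le_one P

theorem Ind.and {e f : Expr} {P Q : Prop} (hW : 1 ≤ W) (h : Ind W s e P) (h' : Ind W s f Q) :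
    Ind W s (.mul e f) (P ∧ Q) := by
  have hev : (Expr.mul e f).eval s = tv (P ∧ Q) := by
    rw [Expr.eval, h.2, h'.2]
    by_cases hP : P <;> by_cases hQ : Q <;> simp [tv, hP, hQ]
  refine ⟨⟨h.1, h'.1, ?_⟩, hev⟩
  change (Expr.mul e f).eval s ≤ W
  rw [hev]; exact (tv_le_one _).trans hW

/-- Truncated subtraction from 1 tests any number for zero; negating twice gives the test for
nonzero. -/
theorem Ind.of_eval {e : Expr} {m : ℕ} (hW : 1 ≤ W) (h : e.Fits W s) (hm : e.eval s = m) :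
    Ind W s e.not (m = 0) := by
  refine ⟨⟨hW, h⟩, ?_⟩
  simp only [Expr.not, Expr.eval, hm, tv]
  split_ifs <;> omega

theorem Ind.not {e : Expr} {P : Prop} (hW : 1 ≤ W) (h : Ind W s e P) :
    Ind W s e.not (¬ P) :=
  (Ind.of_eval hW h.1 rfl).congr h.eval_eq_zero

theorem Ind.get {a x v : ℕ} {X : Finset ℕ} (hW : n + 1 ≤ W) (hx : s.scalar x = v) (hv : v < n)
    (hX : IsChar n (s.array a) X) : Ind W s (.get a x) (v ∈ X) := by
  have hev : (Expr.get a x).eval s = tv (v ∈ X) := by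
    rw [Expr.get, Expr.eval, Expr.eval, hx, hX v hv]
  refine ⟨⟨by simp only [Expr.Fits]; omega, ?_⟩, hev⟩
  change (Expr.get a x).eval s ≤ W
  rw [hev]; exact (tv_le_one _).trans (by omega)

theorem Ind.adj {x y u v : ℕ} (hW : n * n + 3 * n + 10 ≤ W) (h : Input H n s)
    (hx : s.scalar x = u) (hy : s.scalar y = v) (hu : u < n) (hv : v < n) :
    Ind W s (.adj x y) (H.Adj u v) := by
  have hev : (Expr.adj x y).eval s = tv (H.Adj u v) := by
    simp only [Expr.adj, Expr.eval, hx, hy, h.size, h.adj u hu v hv]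
  have h1 : u * n + n ≤ n * n := by nlinarith
  refine ⟨⟨?_, ?_⟩, hev⟩
  · simp only [Expr.Fits, Expr.eval, hx, hy, h.size]
    refine ⟨⟨?_, ?_, ?_⟩, ?_, ?_⟩ <;> omega
  · change (Expr.adj x y).eval s ≤ W
    rw [hev]; exact (tv_le_one _).trans (by omega)

theorem IsChar.congr {f : ℕ → ℕ} {X Y : Finset ℕ} (h : IsChar n f X)
    (hXY : ∀ v < n, (v ∈ X ↔ v ∈ Y)) : IsChar n f Y :=
  fun v hv => (h v hv).trans (by rw [propext (hXY v hv)])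

theorem IsChar.update {f : ℕ → ℕ} {X Y : Finset ℕ} {v x : ℕ} (h : IsChar n f X)
    (hx : x = tv (v ∈ Y)) (hY : ∀ w, w ≠ v → (w ∈ Y ↔ w ∈ X)) :
    IsChar n (update f v x) Y := by
  intro w hw
  by_cases hwv : w = v
  · rw [hwv, update_self, hx]
  · rw [update_of_ne hwv, h w hw, propext (hY w hwv)]

/-- A loop over the vertices raises the exponent by one; the overheads 8 and 6 of `Runs.for` add 14
to the constant. -/
theorem cost_loop_le {tb k j : ℕ} (hn : 1 ≤ n) (h : tb ≤ k * n ^ j) :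
    n * (tb + 8) + 6 ≤ (k + 14) * n ^ (j + 1) := by
  have h1 : n * (tb + 8) ≤ n * (k * n ^ j + 8 * n ^ j) := by
    have := Nat.one_le_pow j n hn
    gcongr
    omega
  have h2 := Nat.one_le_pow (j + 1) n hn
  calc n * (tb + 8) + 6 ≤ n * (k * n ^ j + 8 * n ^ j) + 6 * n ^ (j + 1) := by omega
    _ = _ := by ring

theorem cost_add_le {a b k l i j m : ℕ} (hn : 1 ≤ n) (ha : a ≤ k * n ^ i) (hb : b ≤ l * n ^ j)
    (hi : i ≤ m) (hj : j ≤ m) : a + b ≤ (k + l) * n ^ m := by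
  calc a + b ≤ k * n ^ m + l * n ^ m :=
        Nat.add_le_add (ha.trans (Nat.mul_le_mul le_rfl (Nat.pow_le_pow_right hn hi)))
          (hb.trans (Nat.mul_le_mul le_rfl (Nat.pow_le_pow_right hn hj)))
    _ = _ := by ring

/-- Count in the scalar `r` the indices below `n` for which `e` holds. -/
def Prog.count (r w : ℕ) (e : Expr) : Prog :=
  .seq (.assign r (.lit 0)) (.for w 0 (.assign r (.add (.var r) e)))

theorem Runs.count {r w : ℕ} {e : Expr} (P : ℕ → Prop) (hn : s.scalar 0 = n)
    (hW : n + 1 ≤ W) (hrw : r ≠ w) (hr : r ≠ 0) (hw : w ≠ 0)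
    (he : ∀ i < n, ∀ s' : Config, s'.array = s.array →
      (∀ x, x ≠ r → x ≠ w → s'.scalar x = s.scalar x) → s'.scalar w = i → Ind W s' e (P i)) :
    Runs W (n * (e.cost + 3 + 8) + 8) (.count r w e) s
      fun s' => s'.scalar r = ((Finset.range n).filter P).card := by
  have h1 : Runs W 2 (.assign r (.lit 0)) s
      fun s' => s' = { s with scalar := update s.scalar r 0 } :=
    Runs.assign (e := .lit 0) (Nat.zero_le W) rfl
  refine (Runs.seq h1 fun s₁ hs₁ _ => (Runs.for (tb := e.cost + 3)
    (fun i s' => s'.scalar r = ((Finset.range i).filter P).card) (N := n)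
    ?_ hW hw ?_ ?_ ?_ ?_)).le (by omega)
  · rw [hs₁]; simp only [update_of_ne hr.symm, hn]
  · simpa [Prog.scalars] using hrw.symm
  · simpa [Prog.scalars] using hr.symm
  · simp [hs₁, update_of_ne hrw]
  · intro i hi s' hwi hri hF
    have hI := he i hi s' ?_ ?_ hwi
    · have hcard : ((Finset.range i).filter P).card ≤ i :=
        (Finset.card_filter_le _ _).trans (by simp)
      have h1 := hI.eval_le_one
      have := Runs.assign (W := W) (x := r) (e := .add (.var r) e) (s := s')
        (Q := fun s'' => s''.scalar r = ((Finset.range (i + 1)).filter P).card)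
        ⟨by simp only [Expr.Fits]; omega, hI.1, by simp only [Expr.eval]; omega⟩ ?_
      · refine this.mono (by simp only [Expr.cost]; omega) fun s'' h'' _ => ?_
        simpa [update_of_ne hrw] using h''
      · simp only [update_self, Expr.eval, hri, hI.2]
        rw [Finset.range_add_one, Finset.filter_insert]
        split_ifs with hP
        · rw [Finset.card_insert_of_notMem (by simp), tv_pos hP]
        · rw [tv_neg hP, add_zero]
    · funext a
      rw [hF.array a (by simp [Prog.for, Prog.arrays]), hs₁]
    · intro x hxr hxw
      rw [hF.scalar x (by simp [Prog.for, Prog.scalars, hxr, hxw]), hs₁]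
      simp [update_of_ne hxr]

/-- Store into the array `a`, at all indices below `n`, the value of `e`. -/
def Prog.set (a w : ℕ) (e : Expr) : Prog := .for w 0 (.store a (.var w) e)

/-- The entries from the current index onwards are known to be the old ones, so `e` may read the
very entry about to be overwritten. This allows a set to be filtered in place. -/
theorem Runs.set {a w : ℕ} {e : Expr} (P : ℕ → Prop) (hn : s.scalar 0 = n)
    (hW : n + 1 ≤ W) (hw : w ≠ 0)
    (he : ∀ i < n, ∀ s' : Config, (∀ b, b ≠ a → s'.array b = s.array b) →
      (∀ x, x ≠ w → s'.scalar x = s.scalar x) → (∀ j, i ≤ j → s'.array a j = s.array a j) →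
      s'.scalar w = i → Ind W s' e (P i)) :
    Runs W (n * (e.cost + 2 + 8) + 6) (.set a w e) s
      fun s' => IsChar n (s'.array a) ((Finset.range n).filter P) := by
  refine (Runs.for (tb := e.cost + 2)
    (fun i s' => (∀ v < i, s'.array a v = tv (P v)) ∧
      ∀ v, i ≤ v → s'.array a v = s.array a v) hn hW hw (by simp [Prog.scalars])
      (by simp [Prog.scalars]) ⟨by simp, by simp⟩ ?_).mono le_rfl ?_
  · intro i hi s' hwi ⟨h1, h2⟩ hF
    have hI := he i hi s' ?_ ?_ h2 hwi
    · refine (Runs.store (i := .var w) (by simp only [Expr.Fits]; omega) hI.1 ?_).le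
        (by simp only [Expr.cost]; omega)
      constructor
      · intro v hv
        simp only [update_self, Expr.eval, hwi]
        by_cases hvi : v = i
        · rw [hvi, update_self, hI.2]
        · rw [update_of_ne hvi, h1 v (by omega)]
      · intro v hv
        simp only [update_self, Expr.eval, hwi]
        rw [update_of_ne (by omega), h2 v (by omega)]
    · intro b hb
      exact hF.array b (by simp [Prog.for, Prog.arrays, hb])
    · intro x hx
      exact hF.scalar x (by simp [Prog.for, Prog.scalars, hx])
  · intro s' hs' _ v hv
    rw [hs'.1 v hv]
    simp [hv]

/-- Count the members of the set stored in the array `a`. -/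
def Prog.countSet (a r w : ℕ) : Prog := .count r w (.get a w)

theorem Runs.countSet {a r w : ℕ} {X : Finset ℕ} (h1 : 1 ≤ n) (hn : s.scalar 0 = n)
    (hW : n + 1 ≤ W) (hrw : r ≠ w) (hr : r ≠ 0) (hw : w ≠ 0) (hX : IsChar n (s.array a) X)
    (hXn : X ⊆ Finset.range n) :
    Runs W (21 * n ^ 1) (.countSet a r w) s fun s' => s'.scalar r = X.card := by
  refine (Runs.count (· ∈ X) hn hW hrw hr hw fun i hi s' ha _ hwi =>
    Ind.get hW hwi hi (by rwa [ha])).mono ?_ fun s' hs' _ => ?_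
  · simp only [Expr.get, Expr.cost, pow_one]; omega
  · rw [hs']
    congr 1
    ext x
    simpa using fun h => Finset.mem_range.1 (hXn h)

/-- Count the members of the set stored in the array `a` not adjacent to the vertex held by `v`. -/
def Prog.countNonNbrs (a v r w : ℕ) : Prog := .count r w (.mul (.get a w) (.not (.adj v w)))

theorem Runs.countNonNbrs {a v r w i : ℕ} {X : Finset ℕ} (h1 : 1 ≤ n)
    (hW : n * n + 3 * n + 10 ≤ W) (hs : Input H n s) (hrw : r ≠ w) (hr : r ≠ 0) (hw : w ≠ 0)
    (hvr : v ≠ r) (hvw : v ≠ w) (hv : s.scalar v = i) (hi : i < n) (hX : IsChar n (s.array a) X)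
    (hXn : X ⊆ Finset.range n) :
    Runs W (30 * n ^ 1) (.countNonNbrs a v r w) s
      fun s' => s'.scalar r = (nonNbrs H X i).card := by
  refine (Runs.count (fun w => w ∈ X ∧ ¬ H.Adj i w) hs.size (by omega) hrw hr hw
    fun j hj s' ha hsc hwj => ?_).mono ?_ fun s' hs' _ => ?_
  · have hs' : Input H n s' :=
      ⟨by rw [hsc 0 hr.symm hw.symm, hs.size], by rw [ha]; exact hs.adj⟩
    exact (Ind.get (by omega) hwj hj (by rwa [ha])).and (by omega)
      ((Ind.adj hW hs' (by rw [hsc v hvr hvw, hv]) hwj hi hj).not (by omega))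
  · simp only [Expr.get, Expr.not, Expr.adj, Expr.cost, pow_one]; omega
  · rw [hs']
    congr 1
    ext x
    simp only [nonNbrs, Finset.mem_filter]
    exact ⟨fun h => h.2, fun h => ⟨hXn h.1, h⟩⟩

theorem card_nonNbrs_le {X : Finset ℕ} (hX : X ⊆ Finset.range n) (v : ℕ) :
    (nonNbrs H X v).card ≤ n :=
  (Finset.card_le_card ((Finset.filter_subset _ _).trans hX)).trans (by simp)

theorem card_le_of_subset_range {X : Finset ℕ} (hX : X ⊆ Finset.range n) : X.card ≤ n :=
  (Finset.card_le_card hX).trans (by simp)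

/-! ### Testing co-degeneracy -/

/-- Delete `v` from `Q` if it has few non-neighbours in `Q`. -/
noncomputable def peelStep (H : SimpleGraph ℕ) (d v : ℕ) (Q : Finset ℕ) : Finset ℕ :=
  if (nonNbrs H Q v).card ≤ d + 1 then Q.erase v else Q

theorem peelStep_subset (v : ℕ) (Q : Finset ℕ) : peelStep H d v Q ⊆ Q := by
  unfold peelStep
  split_ifs
  exacts [Finset.erase_subset _ _, subset_rfl]

theorem iter_peelStep_subset (Q : Finset ℕ) (k : ℕ) : iter (peelStep H d) 0 k Q ⊆ Q := by
  induction k with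
  | zero => exact subset_rfl
  | succ k ih => exact (peelStep_subset _ _).trans ih

/-- Co-degeneracy is hereditary, and conversely a deleted vertex had few non-neighbours and can be
put back in front. -/
theorem coDeg_iter_peelStep (Q : Finset ℕ) (k : ℕ) :
    CoDeg H d (iter (peelStep H d) 0 k Q) ↔ CoDeg H d Q := by
  induction k with
  | zero => rfl
  | succ k ih =>
    rw [iter, ← ih]
    refine ⟨fun h => ?_, fun h => h.mono (peelStep_subset _ _)⟩
    unfold peelStep at h
    split_ifs at h with hc
    exacts [CoDeg.of_erase hc h, h]

/-- The witness `v` has few non-neighbours in `Q`, hence also in the smaller set present when the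
pass reaches it. It is deleted then at the latest. -/
theorem card_iter_peelStep {Q : Finset ℕ} (hQ : Q ⊆ Finset.range n) (hne : Q.Nonempty)
    (h : CoDeg H d Q) : (iter (peelStep H d) 0 n Q).card < Q.card := by
  obtain ⟨v, hv, hd⟩ := h Q subset_rfl hne
  have hnot : ∀ m, v < m → v ∉ iter (peelStep H d) 0 m Q := by
    intro m hm
    induction m with
    | zero => omega
    | succ m ih =>
      by_cases hvm : v = m
      · rw [iter, peelStep, ← hvm, Nat.zero_add, if_pos]
        · simp
        · exact (Finset.card_le_card (nonNbrs_mono (iter_peelStep_subset Q v) v)).trans hd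
      · exact fun h => ih (by omega) (peelStep_subset _ _ h)
  refine Finset.card_lt_card ⟨iter_peelStep_subset Q n, fun h => ?_⟩
  exact hnot n (Finset.mem_range.1 (hQ hv)) (h hv)

/-- The set left after `k` rounds of deletions. -/
noncomputable def peelRounds (H : SimpleGraph ℕ) (d n k : ℕ) (S : Finset ℕ) : Finset ℕ :=
  iter (fun _ => iter (peelStep H d) 0 n) 0 k S

theorem peelRounds_spec {S : Finset ℕ} (k : ℕ) : peelRounds H d n k S ⊆ S ∧
    (CoDeg H d (peelRounds H d n k S) ↔ CoDeg H d S) := by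
  induction k with
  | zero => exact ⟨subset_rfl, Iff.rfl⟩
  | succ k ih =>
    exact ⟨(iter_peelStep_subset _ _).trans ih.1, (coDeg_iter_peelStep _ _).trans ih.2⟩

/-- Every round on a nonempty set of small co-degeneracy deletes a vertex, so `n` rounds exhaust it.
Conversely, an empty remainder certifies co-degeneracy because rounds do not change it. -/
theorem peelRounds_eq_empty {S : Finset ℕ} (hS : S ⊆ Finset.range n) :
    peelRounds H d n n S = ∅ ↔ CoDeg H d S := by
  constructor
  · intro h
    rw [← (peelRounds_spec n).2, h]
    exact CoDeg.empty
  · intro h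
    have key : ∀ k, (peelRounds H d n k S).card ≤ n - k := by
      intro k
      induction k with
      | zero => exact card_le_of_subset_range hS
      | succ k ih =>
        by_cases hne : (peelRounds H d n k S).Nonempty
        · have := card_iter_peelStep ((peelRounds_spec k).1.trans hS) hne
            ((peelRounds_spec k).2.2 h)
          change (iter (peelStep H d) 0 n (peelRounds H d n k S)).card ≤ _
          omega
        · rw [Finset.not_nonempty_iff_eq_empty] at hne
          have := iter_peelStep_subset (H := H) (d := d) (peelRounds H d n k S) n
          rw [hne, Finset.subset_empty] at this
          change (iter (peelStep H d) 0 n (peelRounds H d n k S)).card ≤ _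
          rw [hne, this]; simp
    have := key n
    rw [← Finset.card_eq_zero]
    omega

/-- Set the scalar `26` to `0` if and only if the set in the array `10` has co-degeneracy at
most `d`. -/
def Prog.peel (d : ℕ) : Prog :=
  .seq (.set 11 22 (.get 10 22))
    (.seq (.for 29 0 (.for 22 0 (.seq (.countNonNbrs 11 22 24 23)
      (.store 11 (.var 22) (.mul (.get 11 22) (.not (.not (.sub (.var 24) (.lit (d + 1))))))))))
      (.countSet 11 26 22))

theorem Runs.peel {S : Finset ℕ} (h1 : 1 ≤ n) (hW : n * n + 3 * n + 10 ≤ W) (hdW : d + 1 ≤ W)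
    (hs : Input H n s) (hS : IsChar n (s.array 10) S) (hSn : S ⊆ Finset.range n) :
    Runs W (109 * n ^ 3) (.peel d) s
      fun s' => s'.scalar 26 ≤ n ∧ (s'.scalar 26 = 0 ↔ CoDeg H d S) := by
  have hset : Runs W (18 * n ^ 1) (.set 11 22 (.get 10 22)) s
      fun s' => IsChar n (s'.array 11) S := by
    refine (Runs.set (· ∈ S) hs.size (by omega) (by omega) fun i hi s' hb hx _ hwi => ?_).mono
      ?_ fun s' hs' _ => ?_
    · exact Ind.get (by omega) hwi hi (by rwa [hb 10 (by omega)])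
    · simp only [Expr.get, Expr.cost, pow_one]; omega
    · exact hs'.congr fun v hv => by simp [hv]
  refine (Runs.seq hset fun s₁ hs₁ hF₁ => ?_).le
    (cost_add_le (i := 1) (j := 3) (k := 18) (l := 91) h1 le_rfl le_rfl (by omega) (by omega))
  have hI₁ : Input H n s₁ := hs.frame hF₁ (of_decide_eq_true rfl) (of_decide_eq_true rfl)
  refine (Runs.seq (t₁ := 70 * n ^ 3) (Q := fun s' => IsChar n (s'.array 11) (peelRounds H d n n S))
    ?_ fun s₂ hs₂ hF₂ => ?_).le
    (cost_add_le (i := 3) (j := 1) (k := 70) (l := 21) h1 le_rfl le_rfl (by omega) (by omega))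
  swap
  · have hI₂ : Input H n s₂ := hI₁.frame hF₂ (of_decide_eq_true rfl) (of_decide_eq_true rfl)
    have hsub := (peelRounds_spec (H := H) (d := d) (n := n) (S := S) n).1.trans hSn
    refine (Runs.countSet h1 hI₂.size (by omega) (by omega) (by omega) (by omega) hs₂ hsub).mono
      le_rfl fun s₃ hs₃ _ => ?_
    rw [hs₃, Finset.card_eq_zero, peelRounds_eq_empty hSn]
    exact ⟨card_le_of_subset_range hsub, Iff.rfl⟩
  refine (Runs.for (tb := 56 * n ^ 2) (fun i s' => IsChar n (s'.array 11) (peelRounds H d n i S))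
    hI₁.size (by omega) (by omega) (of_decide_eq_true rfl) (of_decide_eq_true rfl) hs₁ fun i hi s₂ hi₂ hs₂ hF₂ => ?_).le
    (cost_loop_le h1 le_rfl)
  have hI₂ : Input H n s₂ := hI₁.frame hF₂ (of_decide_eq_true rfl) (of_decide_eq_true rfl)
  have hsub := (peelRounds_spec (H := H) (d := d) (n := n) (S := S) i).1.trans hSn
  refine (Runs.for (tb := 42 * n ^ 1)
    (fun j s' => IsChar n (s'.array 11) (iter (peelStep H d) 0 j (peelRounds H d n i S)))
    hI₂.size (by omega) (by omega) (of_decide_eq_true rfl) (of_decide_eq_true rfl) hs₂ fun j hj s₃ hj₃ hs₃ hF₃ => ?_).mono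
    (cost_loop_le h1 le_rfl) fun s₃ hs₃ _ => hs₃
  have hI₃ : Input H n s₃ := hI₂.frame hF₃ (of_decide_eq_true rfl) (of_decide_eq_true rfl)
  set Q := iter (peelStep H d) 0 j (peelRounds H d n i S) with hQ
  have hsub' : Q ⊆ Finset.range n := (iter_peelStep_subset _ _).trans hsub
  refine (Runs.seq (Runs.countNonNbrs h1 hW hI₃ (by omega) (by omega) (by omega) (by omega)
    (by omega) hj₃ hj hs₃ hsub') fun s₄ hs₄ hF₄ => ?_).le
    (cost_add_le (i := 1) (j := 1) (k := 30) (l := 12) h1 le_rfl le_rfl (by omega) (by omega))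
  have hj₄ : s₄.scalar 22 = j := by rw [hF₄.scalar 22 (of_decide_eq_true rfl), hj₃]
  have hR₄ : IsChar n (s₄.array 11) Q := by rw [hF₄.array 11 (of_decide_eq_true rfl)]; exact hs₃
  have hle := card_nonNbrs_le (H := H) hsub' j
  -- The new entry says that the vertex was present and that its count exceeds `d + 1`, which is
  -- membership after the peeling step.
  have hInd := (Ind.get (by omega) hj₄ hj hR₄).and (by omega)
    ((Ind.of_eval (W := W) (s := s₄) (e := .sub (.var 24) (.lit (d + 1)))
      (m := (nonNbrs H Q j).card - (d + 1)) (by omega)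
      ⟨by simp only [Expr.Fits]; omega, by simpa only [Expr.Fits] using hdW⟩
      (by simp only [Expr.eval, hs₄])).not (by omega))
  refine (Runs.store (i := .var 22) (by simp only [Expr.Fits]; omega) hInd.1 ?_).le ?_
  · change IsChar n (Function.update s₄.array 11 _ 11) (peelStep H d (0 + j) Q)
    rw [update_self, Nat.zero_add]
    simp only [Expr.eval] at hj₄ ⊢
    rw [hj₄]
    refine hR₄.update (hInd.2.trans ?_) ?_
    · congr 1
      rw [Nat.sub_eq_zero_iff_le]
      unfold peelStep
      split_ifs with h2 <;> simp [h2]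
    · intro w hw
      unfold peelStep
      split_ifs <;> simp [hw]
  · simp only [Expr.get, Expr.not, Expr.cost, pow_one]; omega

end Subroutines

/-! ## Reporting maximal sets -/

section Report
open Classical

variable {H : SimpleGraph ℕ} {d n W : ℕ} {s : Config}

/-- Set the scalar `27` to the truth value of the set in the array `10` being maximal. -/
def Prog.checkMax (d : ℕ) : Prog :=
  .seq (.peel d) (.seq (.assign 27 (.not (.var 26))) (.for 28 0 (.ite (.get 10 28) .skip
    (.seq (.store 10 (.var 28) (.lit 1)) (.seq (.peel d) (.seq (.store 10 (.var 28) (.lit 0))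
      (.assign 27 (.mul (.var 27) (.not (.not (.var 26)))))))))))

/-- Each vertex outside the set is inserted, tested and removed again. Single insertions are what
`MaxCoDeg` asks for, and the array ends up holding the original set. -/
theorem Runs.checkMax {S : Finset ℕ} (h1 : 1 ≤ n) (hW : n * n + 3 * n + 10 ≤ W) (hdW : d + 1 ≤ W)
    (hs : Input H n s) (hS : IsChar n (s.array 10) S) (hSn : S ⊆ Finset.range n) :
    Runs W (260 * n ^ 4) (.checkMax d) s
      fun s' => s'.scalar 27 = tv (MaxCoDeg H d n S) ∧ IsChar n (s'.array 10) S := by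
  refine (Runs.seq (Runs.peel h1 hW hdW hs hS hSn) fun s₁ hs₁ hF₁ => ?_).le
    (cost_add_le (i := 3) (j := 4) (k := 109) (l := 151) h1 le_rfl le_rfl (by omega) (by omega))
  have hI₁ : Input H n s₁ := hs.frame hF₁ (of_decide_eq_true rfl) (of_decide_eq_true rfl)
  have hS₁ : IsChar n (s₁.array 10) S := by
    rw [hF₁.array 10 (of_decide_eq_true rfl)]; exact hS
  have hInd := Ind.of_eval (W := W) (s := s₁) (e := .var 26) (by omega)
    (by simp only [Expr.Fits]; omega) rfl
  refine (Runs.seq (Runs.assign (Q := fun s' => s'.scalar 27 = tv (CoDeg H d S)) hInd.1 ?_)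
    fun s₂ hs₂ hF₂ => ?_).le
    (cost_add_le (i := 0) (j := 4) (k := 5) (l := 146) h1
      (by simp [Expr.not, Expr.cost]) le_rfl (by omega) (by omega))
  · simp only [update_self]
    rw [hInd.2]
    exact congrArg tv (propext hs₁.2)
  have hI₂ : Input H n s₂ := hI₁.frame hF₂ (of_decide_eq_true rfl) (of_decide_eq_true rfl)
  have hS₂ : IsChar n (s₂.array 10) S := by
    rw [hF₂.array 10 (of_decide_eq_true rfl)]; exact hS₁
  refine (Runs.for (tb := 132 * n ^ 3) (fun i s' => IsChar n (s'.array 10) S ∧ s'.scalar 27 =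
    tv (CoDeg H d S ∧ ∀ v < i, v ∉ S → ¬ CoDeg H d (insert v S)))
    hI₂.size (by omega) (by omega) (of_decide_eq_true rfl) (of_decide_eq_true rfl)
    ⟨hS₂, by simpa using hs₂⟩ fun i hi s₃ hi₃ ⟨hS₃, hv₃⟩ hF₃ => ?_).mono
    (cost_loop_le h1 le_rfl) fun s₃ hs₃ _ => ?_
  swap
  · refine ⟨hs₃.2.trans (congrArg tv (propext ?_)), hs₃.1⟩
    exact ⟨fun h => ⟨hSn, h⟩, fun h => h.2⟩
  have hI₃ : Input H n s₃ := hI₂.frame hF₃ (of_decide_eq_true rfl) (of_decide_eq_true rfl)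
  have hget : Ind W s₃ (.get 10 28) (i ∈ S) := Ind.get (by omega) hi₃ hi hS₃
  have hone : 1 ≤ n ^ 3 := Nat.one_le_pow _ _ h1
  refine (Runs.ite (t₁ := 1) (t₂ := 109 * n ^ 3 + 18) hget.1 (fun h => ?_) (fun h => ?_)).le ?_
  · rw [hget.eval_ne_zero] at h
    refine Runs.skip ⟨hS₃, ?_⟩
    simp (disch := decide) only [update_of_ne]
    rw [hv₃]
    refine congrArg tv (propext (and_congr_right fun _ => ⟨fun h' v hv hvS => ?_,
      fun h' v hv => h' v (by omega)⟩))
    have : v ≠ i := fun hvi => hvS (hvi ▸ h)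
    exact h' v (by omega) hvS
  · rw [hget.eval_eq_zero] at h
    refine (Runs.seq (t₁ := 3) (t₂ := 109 * n ^ 3 + 15)
      (Q := fun s' => IsChar n (s'.array 10) (insert i S))
      (Runs.store (i := .var 28) (e := .lit 1) (by simp only [Expr.Fits]; omega)
        (by simp only [Expr.Fits]; omega) ?_) fun s₄ hs₄ hF₄ => ?_).le (by omega)
    · simp only [update_self, Expr.eval, hi₃]
      exact hS₃.update (tv_pos (by simp)).symm (by simp +contextual)
    have hI₄ : Input H n s₄ := hI₃.frame hF₄ (of_decide_eq_true rfl) (of_decide_eq_true rfl)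
    refine (Runs.seq (t₂ := 15) (Runs.peel h1 hW hdW hI₄ hs₄ ?_) fun s₅ hs₅ hF₅ => ?_).le
      (by omega)
    · exact Finset.insert_subset (Finset.mem_range.2 hi) hSn
    have hi₅ : s₅.scalar 28 = i := by
      rw [hF₅.scalar 28 (of_decide_eq_true rfl), hF₄.scalar 28 (of_decide_eq_true rfl), hi₃]
    have hv₅ : s₅.scalar 27 = s₃.scalar 27 := by
      rw [hF₅.scalar 27 (of_decide_eq_true rfl), hF₄.scalar 27 (of_decide_eq_true rfl)]
    have hS₅ : IsChar n (s₅.array 10) (insert i S) := by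
      rw [hF₅.array 10 (of_decide_eq_true rfl)]; exact hs₄
    refine (Runs.seq (t₁ := 3) (t₂ := 12) (Q := fun s' => IsChar n (s'.array 10) S)
      (Runs.store (i := .var 28) (e := .lit 0) (by simp only [Expr.Fits]; omega)
        (by simp only [Expr.Fits]; omega) ?_) fun s₆ hs₆ hF₆ => ?_).le (by omega)
    · simp only [update_self, Expr.eval, hi₅]
      exact hS₅.update (tv_neg h).symm (by simp +contextual)
    have e26 : s₆.scalar 26 = s₅.scalar 26 := hF₆.scalar 26 (of_decide_eq_true rfl)
    have e27 : s₆.scalar 27 = s₃.scalar 27 := by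
      rw [hF₆.scalar 27 (of_decide_eq_true rfl), hv₅]
    have hA : Ind W s₆ (.var 27) (CoDeg H d S ∧ ∀ v < i, v ∉ S → ¬ CoDeg H d (insert v S)) := by
      have : s₆.scalar 27 = tv (CoDeg H d S ∧ ∀ v < i, v ∉ S → ¬ CoDeg H d (insert v S)) := by
        rw [e27, hv₃]
      refine ⟨?_, this⟩
      simp only [Expr.Fits, this]
      exact (tv_le_one _).trans (by omega)
    have hB := (Ind.of_eval (W := W) (s := s₆) (e := .var 26) (by omega)
      (by simp only [Expr.Fits]; omega) rfl).not (by omega)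
    have hAB := hA.and (by omega) hB
    refine (Runs.assign hAB.1 ⟨hs₆, ?_⟩).le (by simp [Expr.not, Expr.cost])
    simp (disch := decide) only [update_of_ne, update_self]
    rw [hAB.2]
    refine congrArg tv (propext ?_)
    rw [show (Expr.var 26).eval s₆ = 0 ↔ CoDeg H d (insert i S) by
      simp only [Expr.eval, e26, hs₅.2]]
    constructor
    · rintro ⟨⟨h1, h2⟩, h3⟩
      refine ⟨h1, fun v hv hvS => ?_⟩
      by_cases hvi : v = i
      · rwa [hvi]
      · exact h2 v (by omega) hvS
    · rintro ⟨h1, h2⟩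
      exact ⟨⟨h1, fun v hv => h2 v (by omega)⟩, h2 i (by omega) h⟩
  · simp only [Expr.get, Expr.cost]; omega

/-! ### A trie of bit strings -/

/-- The array `f` is a binary trie with nodes `0, …, c`; entry `2 * m + b` is the child of `m`
along the bit `b`, or `0` if there is none, and `lab m` is the string leading to the node `m`. -/
structure Trie (f : ℕ → ℕ) (c : ℕ) (lab : ℕ → List ℕ) : Prop where
  root : lab 0 = []
  inj : ∀ a ≤ c, ∀ b ≤ c, lab a = lab b → a = b
  child : ∀ m ≤ c, ∀ b < 2, f (2 * m + b) ≠ 0 →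
    f (2 * m + b) ≤ c ∧ lab (f (2 * m + b)) = lab m ++ [b]
  none : ∀ m ≤ c, ∀ b < 2, f (2 * m + b) = 0 → ∀ a ≤ c, lab a ≠ lab m ++ [b]
  fresh : ∀ i, 2 * c + 1 < i → f i = 0
  parent : ∀ a ≤ c, a ≠ 0 → ∃ m ≤ c, ∃ b < 2, lab a = lab m ++ [b]

/-- Node `c + 1` is allocated with the label of `m` prolonged by `b`. The free slot shows that no
node had this label before. -/
theorem Trie.extend {f : ℕ → ℕ} {c m b : ℕ} {lab : ℕ → List ℕ} (h : Trie f c lab) (hm : m ≤ c)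
    (hb : b < 2) (hf : f (2 * m + b) = 0) :
    Trie (update f (2 * m + b) (c + 1)) (c + 1) (update lab (c + 1) (lab m ++ [b])) := by
  have hlab : ∀ a ≤ c, update lab (c + 1) (lab m ++ [b]) a = lab a := fun a ha =>
    update_of_ne (by omega) _ _
  have hnew := h.none m hm b hb hf
  constructor
  · rw [hlab 0 (by omega), h.root]
  · intro a ha a' ha' hl
    by_cases h1 : a = c + 1 <;> by_cases h2 : a' = c + 1
    · omega
    · rw [h1, update_self, hlab a' (by omega)] at hl
      exact absurd hl.symm (hnew a' (by omega))
    · rw [h2, update_self, hlab a (by omega)] at hl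
      exact absurd hl (hnew a (by omega))
    · rw [hlab a (by omega), hlab a' (by omega)] at hl
      exact h.inj a (by omega) a' (by omega) hl
  · intro m' hm' b' hb' hne
    by_cases he : 2 * m' + b' = 2 * m + b
    · have hmm : m' = m := by omega
      have hbb : b' = b := by omega
      rw [he, update_self, update_self, hmm, hbb, hlab m hm]
      exact ⟨le_rfl, rfl⟩
    · rw [update_of_ne he] at hne ⊢
      -- The slots of the new node lie beyond `2 * c + 1` and are still zero, so a nonzero slot
      -- belongs to an old node.
      have hm'c : m' ≤ c := by
        by_contra hcon
        exact hne (h.fresh _ (by omega))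
      obtain ⟨h1, h2⟩ := h.child m' hm'c b' hb' hne
      rw [hlab _ h1, hlab _ hm'c]
      exact ⟨by omega, h2⟩
  · intro m' hm' b' hb' h0 a ha
    by_cases he : 2 * m' + b' = 2 * m + b
    · rw [he, update_self] at h0
      omega
    rw [update_of_ne he] at h0
    intro hl
    by_cases h1 : m' = c + 1
    · rw [h1, update_self] at hl
      by_cases h2 : a = c + 1
      · rw [h2, update_self] at hl
        simpa using congrArg List.length hl
      · rw [hlab a (by omega)] at hl
        have ha0 : a ≠ 0 := by
          rintro rfl
          rw [h.root] at hl
          simpa using congrArg List.length hl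
        -- An old node labelled by a prolongation of the new label would have a parent carrying the
        -- new label itself.
        obtain ⟨m₀, hm₀, b₀, -, hl₀⟩ := h.parent a (by omega) ha0
        rw [hl₀] at hl
        exact hnew m₀ hm₀ (List.append_inj' hl rfl).1
    · rw [hlab m' (by omega)] at hl
      by_cases h2 : a = c + 1
      · rw [h2, update_self] at hl
        obtain ⟨h3, h4⟩ := List.append_inj' hl rfl
        have := h.inj m hm m' (by omega) h3
        simp only [List.cons.injEq, and_true] at h4
        omega
      · rw [hlab a (by omega)] at hl
        exact h.none m' (by omega) b' hb' h0 a (by omega) hl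
  · intro i hi
    rw [update_of_ne (by omega), h.fresh i (by omega)]
  · intro a ha ha0
    by_cases h1 : a = c + 1
    · exact ⟨m, by omega, b, hb, by rw [h1, update_self, hlab m hm]⟩
    · obtain ⟨m₀, hm₀, b₀, hb₀, hl₀⟩ := h.parent a (by omega) ha0
      exact ⟨m₀, by omega, b₀, hb₀, by rw [hlab a (by omega), hlab m₀ hm₀, hl₀]⟩

/-- The first `n` bits of the characteristic vector of `S`. -/
noncomputable def word (n : ℕ) (S : Finset ℕ) : List ℕ := (List.range n).map fun v => tv (v ∈ S)

theorem word_succ (v : ℕ) (S : Finset ℕ) : word (v + 1) S = word v S ++ [tv (v ∈ S)] := by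
  simp [word, List.range_succ]

theorem length_word (v : ℕ) (S : Finset ℕ) : (word v S).length = v := by simp [word]

theorem word_injOn {S S' : Finset ℕ} (hS : S ⊆ Finset.range n) (hS' : S' ⊆ Finset.range n)
    (h : word n S = word n S') : S = S' := by
  have key : ∀ v < n, (v ∈ S ↔ v ∈ S') := by
    intro v hv
    have := List.map_inj_left.1 h v (List.mem_range.2 hv)
    rw [← not_iff_not, ← tv_eq_zero, ← tv_eq_zero, this]
  ext v
  by_cases hv : v < n
  · exact key v hv
  · exact ⟨fun h => absurd (Finset.mem_range.1 (hS h)) hv,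
      fun h => absurd (Finset.mem_range.1 (hS' h)) hv⟩

/-- One step of the insertion of the set in the array `10` into the trie in the array `12`. -/
def Prog.insertStep : Prog :=
  .seq (.assign 33 (.add (.mul (.lit 2) (.var 31)) (.get 10 22)))
    (.seq (.ite (.get 12 33) (.assign 32 (.lit 0))
        (.seq (.assign 30 (.add (.var 30) (.lit 1)))
          (.seq (.store 12 (.var 33) (.var 30)) (.assign 32 (.lit 1)))))
      (.assign 31 (.get 12 33)))

/-- The walk follows an existing edge or creates one. Either way the label of the current node grows
by one bit, and scalar `32` records whether that label is new. -/
theorem Runs.insertStep {S : Finset ℕ} {c m v : ℕ} {lab : ℕ → List ℕ} (hv : v < n)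
    (hnW : n + 1 ≤ W) (hcW : 2 * c + 2 ≤ W) (hS : IsChar n (s.array 10) S)
    (h22 : s.scalar 22 = v) (h30 : s.scalar 30 = c) (h31 : s.scalar 31 = m) (hm : m ≤ c)
    (hT : Trie (s.array 12) c lab) :
    Runs W 40 .insertStep s fun s' => ∃ lab', Trie (s'.array 12) (s'.scalar 30) lab' ∧
      s'.scalar 30 ≤ c + 1 ∧ s'.scalar 31 ≤ s'.scalar 30 ∧
      lab' (s'.scalar 31) = lab m ++ [tv (v ∈ S)] ∧
      (∀ w, (∃ a ≤ s'.scalar 30, lab' a = w) ↔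
        (∃ a ≤ c, lab a = w) ∨ w = lab m ++ [tv (v ∈ S)]) ∧
      s'.scalar 32 = tv (¬ ∃ a ≤ c, lab a = lab m ++ [tv (v ∈ S)]) := by
  set b := tv (v ∈ S) with hb
  have hb1 : b ≤ 1 := tv_le_one _
  have hget := Ind.get (by omega) h22 hv hS
  refine (Runs.seq (t₁ := 7) (t₂ := 30) (Q := fun s' => s'.scalar 33 = 2 * m + b)
    ((Runs.assign (e := .add (.mul (.lit 2) (.var 31)) (.get 10 22)) ?_ ?_).le
      (by simp [Expr.get, Expr.cost])) fun s₁ hs₁ hF₁ => ?_).le (by omega)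
  · have h2 := hget.2
    refine ⟨?_, hget.1, ?_⟩
    · simp only [Expr.Fits, Expr.eval, h31]; omega
    · rw [h2]; simp only [Expr.eval, h31]; omega
  · simp only [update_self]
    rw [Expr.eval, hget.2]; simp only [Expr.eval, h31]; rfl
  have hT₁ : Trie (s₁.array 12) c lab := by
    rw [hF₁.array 12 (of_decide_eq_true rfl)]; exact hT
  have h30' : s₁.scalar 30 = c := by rw [hF₁.scalar 30 (of_decide_eq_true rfl), h30]
  have hchild : s₁.array 12 (2 * m + b) ≤ c := by
    by_cases h0 : s₁.array 12 (2 * m + b) = 0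
    · omega
    · exact (hT₁.child m hm b (by omega) h0).1
  have hfit : (Expr.get 12 33).Fits W s₁ := by
    simp only [Expr.get, Expr.Fits, Expr.eval, hs₁]; omega
  have hev : (Expr.get 12 33).eval s₁ = s₁.array 12 (2 * m + b) := by
    simp only [Expr.get, Expr.eval, hs₁]
  refine (Runs.seq (t₁ := 20) (t₂ := 3) (Q := fun s' => s'.scalar 33 = 2 * m + b ∧
      s'.array 12 (2 * m + b) ≤ c + 1 ∧ ∃ lab', Trie (s'.array 12) (s'.scalar 30) lab' ∧
      s'.scalar 30 ≤ c + 1 ∧ s'.array 12 (2 * m + b) ≤ s'.scalar 30 ∧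
      lab' (s'.array 12 (2 * m + b)) = lab m ++ [b] ∧
      (∀ w, (∃ a ≤ s'.scalar 30, lab' a = w) ↔ (∃ a ≤ c, lab a = w) ∨ w = lab m ++ [b]) ∧
      s'.scalar 32 = tv (¬ ∃ a ≤ c, lab a = lab m ++ [b])) ?_ fun s₂ hs₂ hF₂ => ?_).le (by omega)
  swap
  · obtain ⟨h33, hle, hs₂⟩ := hs₂
    refine Runs.assign (e := .get 12 33) ?_ ?_
    · simp only [Expr.get, Expr.Fits, Expr.eval, h33]; omega
    · simpa [Expr.get, Expr.eval, h33] using hs₂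
  refine (Runs.ite (t₁ := 2) (t₂ := 10) hfit (fun h => ?_) (fun h => ?_)).le
    (by simp [Expr.get, Expr.cost])
  · rw [hev] at h
    obtain ⟨h1, h2⟩ := hT₁.child m hm b (by omega) h
    refine Runs.assign (e := .lit 0) (by simp only [Expr.Fits]; omega) ?_
    have hex : ∃ a ≤ c, lab a = lab m ++ [b] := ⟨_, h1, h2⟩
    simp (disch := decide) only [update_self, update_of_ne, Expr.eval, hs₁, h30']
    refine ⟨trivial, by omega, lab, hT₁, by omega, h1, h2, fun w => ?_, ?_⟩
    · refine ⟨Or.inl, ?_⟩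
      rintro (h | rfl)
      exacts [h, hex]
    · rw [tv_neg (not_not.2 hex)]
  · rw [hev] at h
    refine (Runs.seq (t₁ := 4) (t₂ := 5) (Q := fun s' => s'.scalar 30 = c + 1)
      (Runs.assign (e := .add (.var 30) (.lit 1)) ?_ ?_) fun s₂ hs₂ hF₂ => ?_).le (by omega)
    · simp only [Expr.Fits, Expr.eval]; omega
    · simp [Expr.eval, h30']
    have e33 : s₂.scalar 33 = 2 * m + b := by rw [hF₂.scalar 33 (of_decide_eq_true rfl), hs₁]
    have e12 : s₂.array 12 = s₁.array 12 := hF₂.array 12 (of_decide_eq_true rfl)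
    refine (Runs.seq (t₁ := 3) (t₂ := 2)
      (Q := fun s' => s'.array 12 = update (s₁.array 12) (2 * m + b) (c + 1))
      (Runs.store (i := .var 33) (e := .var 30) ?_ ?_ ?_) fun s₃ hs₃ hF₃ => ?_).le (by omega)
    · simp only [Expr.Fits]; omega
    · simp only [Expr.Fits]; omega
    · simp [Expr.eval, hs₂, e33, e12]
    have e33' : s₃.scalar 33 = 2 * m + b := by rw [hF₃.scalar 33 (of_decide_eq_true rfl), e33]
    have e30 : s₃.scalar 30 = c + 1 := by rw [hF₃.scalar 30 (of_decide_eq_true rfl), hs₂]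
    have hnone := hT₁.none m hm b (by omega) h
    refine Runs.assign (e := .lit 1) (by simp only [Expr.Fits]; omega) ?_
    simp (disch := decide) only [update_self, update_of_ne, Expr.eval, hs₃, e30, e33']
    refine ⟨trivial, le_rfl, _, hT₁.extend hm (by omega) h, le_rfl, le_rfl, by rw [update_self],
      fun w => ⟨?_, ?_⟩, ?_⟩
    · rintro ⟨a, ha, hl⟩
      by_cases hac : a = c + 1
      · rw [hac, update_self] at hl
        exact Or.inr hl.symm
      · rw [update_of_ne hac] at hl
        exact Or.inl ⟨a, by omega, hl⟩
    · rintro (⟨a, ha, hl⟩ | rfl)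
      · exact ⟨a, by omega, by rw [update_of_ne (by omega), hl]⟩
      · exact ⟨c + 1, le_rfl, update_self _ _ _⟩
    · rw [tv_pos]
      push Not
      exact hnone

/-- Insert the set in the array `10` into the trie in the array `12`; the scalar `32` tells whether
it is new. -/
def Prog.insertSet : Prog := .seq (.assign 31 (.lit 0)) (.for 22 0 .insertStep)

theorem Runs.insertSet {S : Finset ℕ} {c : ℕ} {lab : ℕ → List ℕ} (h1 : 1 ≤ n) (hn : s.scalar 0 = n)
    (hnW : n + 1 ≤ W) (hcW : 2 * (c + n) + 2 ≤ W) (hS : IsChar n (s.array 10) S)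
    (h30 : s.scalar 30 = c) (hT : Trie (s.array 12) c lab) :
    Runs W (56 * n ^ 1) .insertSet s fun s' => ∃ lab', Trie (s'.array 12) (s'.scalar 30) lab' ∧
      s'.scalar 30 ≤ c + n ∧
      (∀ w, w.length = n → ((∃ a ≤ s'.scalar 30, lab' a = w) ↔
        (∃ a ≤ c, lab a = w) ∨ w = word n S)) ∧
      s'.scalar 32 = tv (¬ ∃ a ≤ c, lab a = word n S) := by
  refine (Runs.seq (t₁ := 2) (t₂ := 54 * n ^ 1) (Q := fun s' => s'.scalar 31 = 0)
    (Runs.assign (e := .lit 0) (Nat.zero_le W) (by simp [Expr.eval])) fun s₁ hs₁ hF₁ => ?_).le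
    (by simp only [pow_one]; omega)
  have e10 : s₁.array 10 = s.array 10 := hF₁.array 10 (of_decide_eq_true rfl)
  -- Nodes created before the last step have labels shorter than `n`, so the stored words of length
  -- `n` change only at `i = n`. Scalar `32` is overwritten in every step, and only its final value
  -- matters.
  refine (Runs.for (N := n) (tb := 40) (fun i s' => ∃ lab', Trie (s'.array 12) (s'.scalar 30) lab' ∧
      s'.scalar 30 ≤ c + i ∧ s'.scalar 31 ≤ s'.scalar 30 ∧ lab' (s'.scalar 31) = word i S ∧
      (∀ w, w.length = n → ((∃ a ≤ s'.scalar 30, lab' a = w) ↔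
        (∃ a ≤ c, lab a = w) ∨ (i = n ∧ w = word n S))) ∧
      (i = n → s'.scalar 32 = tv (¬ ∃ a ≤ c, lab a = word n S)))
    ?_ hnW (by omega) (of_decide_eq_true rfl) (of_decide_eq_true rfl) ?_ ?_).mono
    (by simpa using cost_loop_le (k := 40) (j := 0) h1 (by simp)) ?_
  · rw [hF₁.scalar 0 (of_decide_eq_true rfl), hn]
  · have e30 : s₁.scalar 30 = c := by rw [hF₁.scalar 30 (of_decide_eq_true rfl), h30]
    have e12 : s₁.array 12 = s.array 12 := hF₁.array 12 (of_decide_eq_true rfl)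
    have h0n : ¬ 0 = n := by omega
    simp (disch := decide) only [update_of_ne, e30, e12,
      hs₁]
    exact ⟨lab, hT, le_rfl, Nat.zero_le _, by simp [hT.root, word], by simp [h0n], by simp [h0n]⟩
  · rintro i hi s₂ hi₂ ⟨lab', hT', hle, hle', hl', hw', -⟩ hF₂
    have hS₂ : IsChar n (s₂.array 10) S := by
      rw [hF₂.array 10 (of_decide_eq_true rfl), e10]; exact hS
    refine (Runs.insertStep hi hnW (by omega) hS₂ hi₂ rfl rfl hle' hT').mono le_rfl ?_
    rintro s₃ ⟨lab'', hT'', h30'', h31'', hl'', hw'', h32''⟩ -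
    rw [hl', ← word_succ] at hl'' hw'' h32''
    simp (disch := decide) only [update_of_ne]
    refine ⟨lab'', hT'', by omega, h31'', hl'', fun w hw => ?_, ?_⟩
    · rw [hw'', hw' w hw]
      have : ¬ i = n := by omega
      simp only [this, false_and, or_false]
      refine or_congr_right ⟨?_, ?_⟩
      · rintro rfl
        rw [length_word] at hw
        exact ⟨hw, by rw [hw]⟩
      · rintro ⟨rfl, h⟩
        exact h
    · intro hin
      rw [h32'', hin, hw' _ (length_word n S)]
      have : ¬ i = n := by omega
      simp only [this, false_and, or_false]
  · rintro s' ⟨lab', h₁, h₂, -, -, h₃, h₄⟩ -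
    exact ⟨lab', h₁, h₂, by simpa using h₃, h₄ rfl⟩

/-! ### Collecting the output -/

/-- The sets in `L` are maximal and distinct, they have been output, and the trie in the array
`12`, whose largest node is in the scalar `30`, contains exactly these sets, after at most `k`
insertions. -/
def Collected (H : SimpleGraph ℕ) (d n : ℕ) (s : Config) (L : List (Finset ℕ))
    (k : ℕ) : Prop :=
  s.output = L.flatMap (word n) ∧ L.Nodup ∧ (∀ S ∈ L, MaxCoDeg H d n S) ∧
    s.scalar 30 ≤ n * k ∧ ∃ lab, Trie (s.array 12) (s.scalar 30) lab ∧
      ∀ w, w.length = n → ((∃ a ≤ s.scalar 30, lab a = w) ↔ ∃ S ∈ L, word n S = w)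

theorem Collected.frame {p : Prog} {s' : Config} {L : List (Finset ℕ)}
    {k : ℕ}
    (h : Collected H d n s L k) (hF : Frame p s s') (h30 : 30 ∉ p.scalars) (h12 : 12 ∉ p.arrays)
    (ho : p.emits = false) : Collected H d n s' L k := by
  unfold Collected
  rw [hF.scalar 30 h30, hF.array 12 h12, hF.output ho]
  exact h

/-- The list `L` of collected sets has been extended by at most `m` further insertions, so that it
contains all maximal sets in `F`. -/
def Extends (H : SimpleGraph ℕ) (d n : ℕ) (L : List (Finset ℕ)) (k m : ℕ) (F : Finset ℕ → Prop)
    (s : Config) : Prop :=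
  ∃ L', Collected H d n s L' (k + m) ∧ L ⊆ L' ∧
    ∀ S, F S → MaxCoDeg H d n S → S ∈ L'

/-- If the set in the array `10` is maximal and new, output it. -/
def Prog.report (d : ℕ) : Prog :=
  .seq (.checkMax d) (.ite (.var 27)
    (.seq .insertSet (.ite (.var 32) (.for 22 0 (.emit (.get 10 22))) .skip)) .skip)

/-- Each insertion creates at most `n` nodes and each node owns two slots; the bound `hLW` makes the
slot indices after one more insertion fit into a word. -/
theorem Runs.report {S : Finset ℕ} {L : List (Finset ℕ)} {k : ℕ} (h1 : 1 ≤ n)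
    (hW : n * n + 3 * n + 10 ≤ W) (hdW : d + 1 ≤ W) (hLW : 2 * (n * (k + 1)) + 2 ≤ W)
    (hs : Input H n s) (hS : IsChar n (s.array 10) S) (hSn : S ⊆ Finset.range n)
    (hC : Collected H d n s L k) :
    Runs W (360 * n ^ 4) (.report d) s (Extends H d n L k 1 (· = S)) := by
  refine (Runs.seq (Runs.checkMax h1 hW hdW hs hS hSn) fun s₁ ⟨hs₁, hS₁⟩ hF₁ => ?_).le
    (cost_add_le (i := 4) (j := 1) (k := 260) (l := 100) h1 le_rfl le_rfl (by omega) (by omega))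
  have hI₁ : Input H n s₁ := hs.frame hF₁ (of_decide_eq_true rfl) (of_decide_eq_true rfl)
  have hC₁ : Collected H d n s₁ L k :=
    hC.frame hF₁ (of_decide_eq_true rfl) (of_decide_eq_true rfl) rfl
  have hle := tv_le_one (MaxCoDeg H d n S)
  refine (Runs.ite (t₁ := 97 * n ^ 1) (t₂ := 1) (by simp only [Expr.Fits]; omega)
    (fun h => ?_) (fun h => ?_)).le (by simp only [Expr.cost, pow_one]; omega)
  swap
  · simp only [Expr.eval, hs₁, tv_eq_zero] at h
    exact Runs.skip ⟨L, ⟨hC₁.1, hC₁.2.1, hC₁.2.2.1, hC₁.2.2.2.1.trans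
      (Nat.mul_le_mul le_rfl (by omega)), hC₁.2.2.2.2⟩, List.Subset.refl _, fun S' hS' hm => absurd (hS' ▸ hm) h⟩
  simp only [Expr.eval, hs₁, ne_eq, tv_eq_zero, not_not] at h
  obtain ⟨hout, hnd, hmax, hcnt, lab, hT, hlab⟩ := hC₁
  have hmul : n * (k + 1) = n * k + n := by ring
  refine (Runs.seq (t₂ := 41 * n ^ 1)
    (Runs.insertSet h1 hI₁.size (by omega) (by omega) hS₁ rfl hT) fun s₂ hs₂ hF₂ => ?_).le (by omega)
  obtain ⟨lab', hT', hcnt', hlab', h32⟩ := hs₂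
  have hI₂ : Input H n s₂ := hI₁.frame hF₂ (of_decide_eq_true rfl) (of_decide_eq_true rfl)
  have hS₂ : IsChar n (s₂.array 10) S := by
    rw [hF₂.array 10 (of_decide_eq_true rfl)]; exact hS₁
  have hout₂ : s₂.output = L.flatMap (word n) := by rw [hF₂.output rfl, hout]
  -- Collected sets lie below `n`, where the characteristic word determines the set.
  have hmem : (∃ a ≤ s₁.scalar 30, lab a = word n S) ↔ S ∈ L := by
    rw [hlab _ (length_word n S)]
    constructor
    · rintro ⟨S', hS', hw⟩
      rwa [← word_injOn (hmax S' hS').1 hSn hw]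
    · intro h
      exact ⟨S, h, rfl⟩
  rw [hmem] at h32
  have hle := tv_le_one (S ∉ L)
  refine (Runs.ite (t₁ := 25 * n ^ 1) (t₂ := 1) (by simp only [Expr.Fits]; omega)
    (fun h' => ?_) (fun h' => ?_)).le (by simp only [Expr.cost, pow_one]; omega)
  · simp only [Expr.eval, h32, ne_eq, tv_eq_zero, not_not] at h'
    refine (Runs.for (tb := 3) (fun i s' => s'.output = s₂.output ++ word i S)
      hI₂.size (by omega) (by omega) (of_decide_eq_true rfl) (of_decide_eq_true rfl)
      (by simp [word]) fun i hi s₃ hi₃ hs₃ hF₃ => ?_).mono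
      (by simp only [pow_one]; omega) fun s₃ hs₃ hF₃ => ?_
    · have hget : Ind W s₃ (.get 10 22) (i ∈ S) := Ind.get (by omega) hi₃ hi (by
        rw [hF₃.array 10 (of_decide_eq_true rfl)]; exact hS₂)
      refine Runs.emit hget.1 ?_
      change s₃.output ++ [_] = _
      rw [hs₃, hget.2, word_succ, List.append_assoc]
    · refine ⟨L ++ [S], ⟨?_, ?_, ?_, ?_, lab', ?_⟩, by simp, fun S' hS' _ => by simp [hS']⟩
      · rw [hs₃, hout₂]; simp
      · rw [List.nodup_append]
        refine ⟨hnd, by simp, fun a ha b hb => ?_⟩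
        rw [List.mem_singleton.1 hb]
        exact fun hab => h' (hab ▸ ha)
      · intro S' hS'
        rcases List.mem_append.1 hS' with h₁ | h₁
        · exact hmax S' h₁
        · rwa [List.mem_singleton.1 h₁]
      · rw [hF₃.scalar 30 (of_decide_eq_true rfl)]
        omega
      · rw [hF₃.scalar 30 (of_decide_eq_true rfl), hF₃.array 12 (of_decide_eq_true rfl)]
        refine ⟨hT', fun w hw => ?_⟩
        rw [hlab' w hw, hlab w hw]
        constructor
        · rintro (⟨S', hS', rfl⟩ | rfl)
          · exact ⟨S', by simp [hS'], rfl⟩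
          · exact ⟨S, by simp, rfl⟩
        · rintro ⟨S', hS', rfl⟩
          rcases List.mem_append.1 hS' with h₁ | h₁
          · exact Or.inl ⟨S', h₁, rfl⟩
          · rw [List.mem_singleton.1 h₁]; exact Or.inr rfl
  · simp only [Expr.eval, h32, tv_eq_zero, not_not] at h'
    refine Runs.skip ⟨L, ⟨hout₂, hnd, hmax, ?_, lab', hT', fun w hw => ?_⟩, List.Subset.refl _,
      fun S' hS' _ => hS' ▸ h'⟩
    · omega
    · rw [hlab' w hw, hlab w hw]
      constructor
      · rintro (h₁ | rfl)
        · exact h₁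
        · exact ⟨S, h', rfl⟩
      · exact Or.inl

end Report

/-! ## Trying one clique -/

section TryClique
open Classical

variable {H : SimpleGraph ℕ} {d n W : ℕ} {s : Config}

theorem Extends.mono {L : List (Finset ℕ)} {k m m' : ℕ} {F F' : Finset ℕ → Prop}
    (h : Extends H d n L k m F s) (hm : m ≤ m') (hF : ∀ S, F' S → MaxCoDeg H d n S → F S) :
    Extends H d n L k m' F' s := by
  obtain ⟨L', ⟨h1, h2, h3, h4, h5⟩, hL, hS⟩ := h
  exact ⟨L', ⟨h1, h2, h3, h4.trans (Nat.mul_le_mul le_rfl (by omega)), h5⟩, hL,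
    fun S hS' hmax => hS S (hF S hS' hmax) hmax⟩

/-- The body must work for every list collected so far, since this list is not known in advance.
Lists only grow, so the sets found in different rounds accumulate, at `M` insertions per round. -/
theorem Runs.forExtends {x b N M k tb : ℕ} {body : Prog} {L : List (Finset ℕ)}
    {F : ℕ → Finset ℕ → Prop} (hN : s.scalar b = N) (hW : N + 1 ≤ W) (hxb : x ≠ b)
    (hx : x ∉ body.scalars) (hb : b ∉ body.scalars) (hx30 : x ≠ 30) (hC : Collected H d n s L k)
    (hstep : ∀ i < N, ∀ s' L', s'.scalar x = i → Frame (Prog.for x b body) s s' →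
      Collected H d n s' L' (k + i * M) →
      Runs W tb body s' (Extends H d n L' (k + i * M) M (F i))) :
    Runs W (N * (tb + 8) + 6) (.for x b body) s
      (Extends H d n L k (N * M) fun S => ∃ i < N, F i S) := by
  have hupd : ∀ (s' : Config) (v : ℕ) (L' : List (Finset ℕ)) (k' : ℕ),
      Collected H d n s' L' k' →
      Collected H d n { s' with scalar := update s'.scalar x v } L' k' := by
    intro s' v L' k' h
    unfold Collected
    simp only [update_of_ne hx30.symm]
    exact h
  refine Runs.for (fun i s' => Extends H d n L k (i * M) (fun S => ∃ j < i, F j S) s')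
    hN hW hxb hx hb ⟨L, hupd _ _ _ _ (by simpa using hC), List.Subset.refl _, by simp⟩
    fun i hi s' hsi ⟨L', hC', hL', hF'⟩ hFr => ?_
  refine (hstep i hi s' L' hsi hFr hC').mono le_rfl ?_
  rintro s'' ⟨L'', hC'', hL'', hF''⟩ -
  refine ⟨L'', hupd _ _ _ _ ?_, fun _ h => hL'' (hL' h), ?_⟩
  · rwa [Nat.succ_mul, ← Nat.add_assoc]
  · rintro S ⟨j, hj, hS⟩ hmax
    by_cases hji : j = i
    · exact hF'' S (hji ▸ hS) hmax
    · exact hL'' (hF' S ⟨j, by omega, hS⟩ hmax)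

/-- Store the empty set in the array `a`. -/
def Prog.clear (a w : ℕ) : Prog := .set a w (.lit 0)

theorem Runs.clear {a w : ℕ} (h1 : 1 ≤ n) (hn : s.scalar 0 = n) (hW : n + 1 ≤ W) (hw : w ≠ 0) :
    Runs W (17 * n ^ 1) (.clear a w) s fun s' => IsChar n (s'.array a) ∅ := by
  refine (Runs.set (fun _ => False) hn hW hw fun i hi s' _ _ _ _ => ?_).mono ?_ fun s' hs' _ => ?_
  · exact ⟨Nat.zero_le W, (tv_neg id).symm⟩
  · simp only [Expr.cost, pow_one]; omega
  · simpa using hs'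

/-- Choose the vertex in the scalar `22` for the clique. -/
def Prog.choose : Prog :=
  .seq (.store 9 (.var 22) (.lit 1)) (.set 8 23 (.mul (.get 8 23) (.adj 22 23)))

theorem Runs.choose {R C : Finset ℕ} {v : ℕ} (h1 : 1 ≤ n) (hW : n * n + 3 * n + 10 ≤ W)
    (hs : Input H n s) (hv : s.scalar 22 = v) (hvn : v < n) (hR : IsChar n (s.array 8) R)
    (hC : IsChar n (s.array 9) C) :
    Runs W (28 * n ^ 1) .choose s fun s' =>
      IsChar n (s'.array 8) (R.filter (H.Adj v)) ∧ IsChar n (s'.array 9) (insert v C) := by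
  refine (Runs.seq (t₁ := 3) (t₂ := 25 * n ^ 1)
    (Q := fun s' => IsChar n (s'.array 9) (insert v C))
    (Runs.store (i := .var 22) (e := .lit 1) (by simp only [Expr.Fits]; omega)
      (by simp only [Expr.Fits]; omega) ?_) fun s₁ hs₁ hF₁ => ?_).le (by simp only [pow_one]; omega)
  · simp only [update_self, Expr.eval, hv]
    exact hC.update (tv_pos (by simp)).symm (by simp +contextual)
  have hI₁ : Input H n s₁ := hs.frame hF₁ (of_decide_eq_true rfl) (of_decide_eq_true rfl)
  have hR₁ : IsChar n (s₁.array 8) R := by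
    rw [hF₁.array 8 (of_decide_eq_true rfl)]; exact hR
  have hv₁ : s₁.scalar 22 = v := by rw [hF₁.scalar 22 (of_decide_eq_true rfl), hv]
  refine (Runs.set (fun w => w ∈ R ∧ H.Adj v w) hI₁.size (by omega) (by omega)
    fun i hi s₂ hb hx ha hi₂ => ?_).mono ?_ fun s₂ hs₂ hF₂ => ⟨?_, ?_⟩
  · have hI₂ : Input H n s₂ := ⟨by rw [hx 0 (by omega), hI₁.size], by
      rw [hb 0 (by omega)]; exact hI₁.adj⟩
    have hg : Ind W s₂ (.get 8 23) (i ∈ R) := by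
      refine ⟨⟨by simp only [Expr.Fits]; omega, ?_⟩, ?_⟩
      · simp only [Expr.eval, hi₂, ha i le_rfl, hR₁ i hi]
        exact (tv_le_one _).trans (by omega)
      · simp only [Expr.get, Expr.eval, hi₂, ha i le_rfl, hR₁ i hi]
    exact hg.and (by omega) (Ind.adj hW hI₂ (by rw [hx 22 (by omega), hv₁]) hi₂ hvn hi)
  · simp only [Expr.get, Expr.adj, Expr.cost, pow_one]; omega
  · exact hs₂.congr fun w hw => by simp [hw]
  · rw [hF₂.array 9 (of_decide_eq_true rfl)]; exact hs₁

/-- One step of the decoding of a clique. -/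
def Prog.cliqueStep : Prog :=
  .ite (.get 8 22)
    (.seq (.countSet 8 24 23) (.seq (.countNonNbrs 8 22 25 23)
      (.ite (.sub (.var 25) (.lit 1))
        (.ite (.sub (.add (.var 21) (.lit 1)) (.arr 7 (.add (.var 24) (.lit 1))))
          (.seq (.assign 21 (.sub (.var 21) (.arr 7 (.add (.var 24) (.lit 1))))) .choose)
          (.store 8 (.var 22) (.lit 0)))
        .choose)))
    .skip

theorem Runs.cliqueStep {st : Finset ℕ × ℕ × Finset ℕ} {v : ℕ} (h1 : 1 ≤ n)
    (hW : n * n + 3 * n + 10 ≤ W) (hs : Input H n s) (hv : s.scalar 22 = v) (hvn : v < n)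
    (hRn : st.1 ⊆ Finset.range n) (hR : IsChar n (s.array 8) st.1) (hy : s.scalar 21 = st.2.1)
    (hyW : st.2.1 + 1 ≤ W) (hC : IsChar n (s.array 9) st.2.2)
    (hfib : s.array 7 (st.1.card + 1) = Nat.fib (st.1.card + 1))
    (hfW : Nat.fib (st.1.card + 1) ≤ W) :
    Runs W (140 * n ^ 1) .cliqueStep s fun s' =>
      IsChar n (s'.array 8) (cliqueStep H v st).1 ∧ s'.scalar 21 = (cliqueStep H v st).2.1 ∧
        IsChar n (s'.array 9) (cliqueStep H v st).2.2 := by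
  obtain ⟨R, y, C⟩ := st
  simp only at hRn hR hy hyW hC hfib hfW
  have hget : Ind W s (.get 8 22) (v ∈ R) := Ind.get (by omega) hv hvn hR
  refine (Runs.ite (t₁ := 132 * n ^ 1) (t₂ := 1) hget.1 (fun h => ?_) (fun h => ?_)).le
    (by simp only [Expr.get, Expr.cost, pow_one]; omega)
  swap
  · rw [hget.eval_eq_zero] at h
    simp only [_root_.cliqueStep, if_neg h]
    exact Runs.skip ⟨hR, hy, hC⟩
  rw [hget.eval_ne_zero] at h
  simp only [_root_.cliqueStep, if_pos h]
  refine (Runs.seq (t₂ := 111 * n ^ 1) (Runs.countSet h1 hs.size (by omega) (by omega) (by omega)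
    (by omega) hR hRn) fun s₁ h24 hF₁ => ?_).le (by omega)
  have hI₁ : Input H n s₁ := hs.frame hF₁ (of_decide_eq_true rfl) (of_decide_eq_true rfl)
  have hR₁ : IsChar n (s₁.array 8) R := by
    rw [hF₁.array 8 (of_decide_eq_true rfl)]; exact hR
  have hv₁ : s₁.scalar 22 = v := by rw [hF₁.scalar 22 (of_decide_eq_true rfl), hv]
  refine (Runs.seq (t₂ := 81 * n ^ 1) (Runs.countNonNbrs h1 hW hI₁ (by omega) (by omega) (by omega)
    (by omega) (by omega) hv₁ hvn hR₁ hRn) fun s₂ h25 hF₂ => ?_).le (by omega)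
  have hI₂ : Input H n s₂ := hI₁.frame hF₂ (of_decide_eq_true rfl) (of_decide_eq_true rfl)
  have hR₂ : IsChar n (s₂.array 8) R := by
    rw [hF₂.array 8 (of_decide_eq_true rfl)]; exact hR₁
  have hv₂ : s₂.scalar 22 = v := by rw [hF₂.scalar 22 (of_decide_eq_true rfl), hv₁]
  have h24' : s₂.scalar 24 = R.card := by rw [hF₂.scalar 24 (of_decide_eq_true rfl), h24]
  have hy₂ : s₂.scalar 21 = y := by
    rw [hF₂.scalar 21 (of_decide_eq_true rfl), hF₁.scalar 21 (of_decide_eq_true rfl), hy]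
  have hC₂ : IsChar n (s₂.array 9) C := by
    rw [hF₂.array 9 (of_decide_eq_true rfl), hF₁.array 9 (of_decide_eq_true rfl)]; exact hC
  have hf₂ : s₂.array 7 (R.card + 1) = Nat.fib (R.card + 1) := by
    rw [hF₂.array 7 (of_decide_eq_true rfl), hF₁.array 7 (of_decide_eq_true rfl)]; exact hfib
  have hRc := card_le_of_subset_range hRn
  have hnn := card_nonNbrs_le (H := H) hRn v
  refine (Runs.ite (t₁ := 49 * n ^ 1) (t₂ := 28 * n ^ 1) ?_ (fun hb => ?_) (fun hb => ?_)).le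
    (by simp only [Expr.cost, pow_one]; omega)
  · simp only [Expr.Fits]; omega
  swap
  · simp only [Expr.eval, h25] at hb
    rw [if_pos (by omega)]
    refine (Runs.choose h1 hW hI₂ hv₂ hvn hR₂ hC₂).mono le_rfl fun s₃ hs₃ hF₃ => ⟨hs₃.1, ?_, hs₃.2⟩
    rw [hF₃.scalar 21 (of_decide_eq_true rfl), hy₂]
  simp only [Expr.eval, h25] at hb
  rw [if_neg (by omega)]
  have hfitf : (Expr.arr 7 (.add (.var 24) (.lit 1))).Fits W s₂ := by
    simp only [Expr.Fits, Expr.eval, h24', hf₂]; omega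
  refine (Runs.ite (t₁ := 36 * n ^ 1) (t₂ := 3) ?_ (fun hc => ?_) (fun hc => ?_)).le
    (by simp only [Expr.cost, pow_one]; omega)
  · exact ⟨by simp only [Expr.Fits, Expr.eval]; omega, hfitf⟩
  -- The truncated difference of `y + 1` and the Fibonacci number is nonzero exactly when the
  -- Fibonacci number is at most `y`.
  · simp only [Expr.eval, h24', hf₂, hy₂] at hc
    rw [if_pos (by omega)]
    refine (Runs.seq (t₁ := 7) (t₂ := 28 * n ^ 1)
      (Q := fun s' => s'.scalar 21 = y - Nat.fib (R.card + 1))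
      ((Runs.assign (e := .sub (.var 21) (.arr 7 (.add (.var 24) (.lit 1)))) ⟨?_, hfitf⟩ ?_).le
        (by simp [Expr.cost])) fun s₃ hs₃ hF₃ => ?_).le (by simp only [pow_one]; omega)
    · simp only [Expr.Fits]; omega
    · simp [Expr.eval, h24', hf₂, hy₂]
    have hI₃ : Input H n s₃ := hI₂.frame hF₃ (of_decide_eq_true rfl) (of_decide_eq_true rfl)
    refine (Runs.choose h1 hW hI₃ (by rw [hF₃.scalar 22 (of_decide_eq_true rfl), hv₂]) hvn
      (R := R) (C := C) ?_ ?_).mono le_rfl fun s₄ hs₄ hF₄ => ⟨hs₄.1, ?_, hs₄.2⟩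
    · rw [hF₃.array 8 (of_decide_eq_true rfl)]; exact hR₂
    · rw [hF₃.array 9 (of_decide_eq_true rfl)]; exact hC₂
    · rw [hF₄.scalar 21 (of_decide_eq_true rfl), hs₃]
  · simp only [Expr.eval, h24', hf₂, hy₂] at hc
    rw [if_neg (by omega)]
    refine Runs.store (i := .var 22) (e := .lit 0) (by simp only [Expr.Fits]; omega)
      (by simp only [Expr.Fits]; omega) ⟨?_, hy₂, ?_⟩
    · simp only [update_self, Expr.eval, hv₂]
      exact hR₂.update (tv_neg (by simp)).symm (by simp +contextual)
    · simpa (disch := decide) only [update_of_ne] using hC₂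

/-- During decoding the undecided set stays inside `Z` and the code never grows, so table lookups
stay in range and words do not overflow. -/
theorem iter_cliqueStep_bounds {Z : Finset ℕ} (hZ : Z ⊆ Finset.range n) (y i : ℕ) :
    (iter (cliqueStep H) 0 i (Z, y, ∅)).1 ⊆ Z ∧ (iter (cliqueStep H) 0 i (Z, y, ∅)).2.1 ≤ y ∧
      (iter (cliqueStep H) 0 i (Z, y, ∅)).2.2 ⊆ Finset.range n := by
  induction i with
  | zero => exact ⟨subset_rfl, le_rfl, by simp [iter]⟩
  | succ i ih =>
    rw [iter]
    generalize iter (cliqueStep H) 0 i (Z, y, ∅) = st at ih ⊢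
    obtain ⟨h1, h2, h3⟩ := ih
    unfold cliqueStep
    split_ifs with ha hb hc
    · exact ⟨(Finset.filter_subset _ _).trans h1, h2, Finset.insert_subset (hZ (h1 ha)) h3⟩
    · exact ⟨(Finset.filter_subset _ _).trans h1, (Nat.sub_le _ _).trans h2,
        Finset.insert_subset (hZ (h1 ha)) h3⟩
    · exact ⟨(Finset.erase_subset _ _).trans h1, h2, h3⟩
    · exact ⟨h1, h2, h3⟩

/-- Decode the number in the scalar `20` into a clique, in the array `9`, of the set in the
array `6`. -/
def Prog.decodeClique : Prog :=
  .seq (.set 8 22 (.get 6 22)) (.seq (.clear 9 22) (.seq (.assign 21 (.var 20))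
    (.for 22 0 .cliqueStep)))

theorem Runs.decodeClique {Z : Finset ℕ} {y : ℕ} (h1 : 1 ≤ n) (hW : n * n + 3 * n + 10 ≤ W)
    (hs : Input H n s) (hZ : IsChar n (s.array 6) Z) (hZn : Z ⊆ Finset.range n)
    (hfib : ∀ j ≤ Z.card + 2, s.array 7 j = Nat.fib j) (hfW : Nat.fib (Z.card + 2) ≤ W)
    (hy : s.scalar 20 = y) (hyf : y < Nat.fib (Z.card + 2)) :
    Runs W (200 * n ^ 2) .decodeClique s fun s' =>
      IsChar n (s'.array 9) (iter (_root_.cliqueStep H) 0 n (Z, y, ∅)).2.2 := by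
  have hset : Runs W (18 * n ^ 1) (.set 8 22 (.get 6 22)) s
      fun s' => IsChar n (s'.array 8) Z := by
    refine (Runs.set (· ∈ Z) hs.size (by omega) (by omega) fun i hi s' hb hx _ hwi => ?_).mono
      ?_ fun s' hs' _ => ?_
    · exact Ind.get (by omega) hwi hi (by rwa [hb 6 (by omega)])
    · simp only [Expr.get, Expr.cost, pow_one]; omega
    · exact hs'.congr fun v hv => by simp [hv]
  refine (Runs.seq hset fun s₁ hs₁ hF₁ => ?_).le
    (cost_add_le (i := 1) (j := 2) (k := 18) (l := 182) h1 le_rfl le_rfl (by omega) (by omega))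
  have hI₁ : Input H n s₁ := hs.frame hF₁ (of_decide_eq_true rfl) (of_decide_eq_true rfl)
  refine (Runs.seq (Runs.clear h1 hI₁.size (by omega) (by omega)) fun s₂ hs₂ hF₂ => ?_).le
    (cost_add_le (i := 1) (j := 2) (k := 17) (l := 165) h1 le_rfl le_rfl (by omega) (by omega))
  have hI₂ : Input H n s₂ := hI₁.frame hF₂ (of_decide_eq_true rfl) (of_decide_eq_true rfl)
  have hy₂ : s₂.scalar 20 = y := by
    rw [hF₂.scalar 20 (of_decide_eq_true rfl), hF₁.scalar 20 (of_decide_eq_true rfl), hy]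
  refine (Runs.seq (t₁ := 2) (Q := fun s' => s'.scalar 21 = y)
    (Runs.assign (e := .var 20) (by simp only [Expr.Fits]; omega) (by simpa [Expr.eval] using hy₂))
    fun s₃ hs₃ hF₃ => ?_).le
    (cost_add_le (i := 0) (j := 2) (k := 2) (l := 163) h1 (by simp) le_rfl (by omega) (by omega))
  have hI₃ : Input H n s₃ := hI₂.frame hF₃ (of_decide_eq_true rfl) (of_decide_eq_true rfl)
  refine (Runs.for (tb := 140 * n ^ 1) (fun i s' =>
    IsChar n (s'.array 8) (iter (_root_.cliqueStep H) 0 i (Z, y, ∅)).1 ∧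
    s'.scalar 21 = (iter (_root_.cliqueStep H) 0 i (Z, y, ∅)).2.1 ∧
    IsChar n (s'.array 9) (iter (_root_.cliqueStep H) 0 i (Z, y, ∅)).2.2)
    hI₃.size (by omega) (by omega) (of_decide_eq_true rfl) (of_decide_eq_true rfl) ?_ ?_).mono
    ((cost_loop_le h1 le_rfl).trans (Nat.mul_le_mul (by omega) le_rfl)) fun s₄ hs₄ _ => hs₄.2.2
  · simp (disch := decide) only [update_of_ne]
    rw [hF₃.array 8 (of_decide_eq_true rfl), hF₂.array 8 (of_decide_eq_true rfl),
      hF₃.array 9 (of_decide_eq_true rfl)]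
    exact ⟨hs₁, hs₃, hs₂⟩
  · rintro i hi s₄ hi₄ ⟨h8, h21, h9⟩ hF₄
    have hI₄ : Input H n s₄ := hI₃.frame hF₄ (of_decide_eq_true rfl) (of_decide_eq_true rfl)
    obtain ⟨hb1, hb2, -⟩ := iter_cliqueStep_bounds (H := H) hZn y i
    have hc := Finset.card_le_card hb1
    have hle := Nat.fib_mono (show
      (iter (_root_.cliqueStep H) 0 i (Z, y, ∅)).1.card + 1 ≤ Z.card + 2 by omega)
    refine (Runs.cliqueStep h1 hW hI₄ hi₄ hi (hb1.trans hZn) h8 h21 (by omega) h9 ?_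
      (hle.trans hfW)).mono le_rfl fun s₅ hs₅ _ => ?_
    · rw [hF₄.array 7 (of_decide_eq_true rfl), hF₃.array 7 (of_decide_eq_true rfl),
        hF₂.array 7 (of_decide_eq_true rfl), hF₁.array 7 (of_decide_eq_true rfl)]
      exact hfib _ (by omega)
    · simp (disch := decide) only [update_of_ne, iter, Nat.zero_add]
      exact hs₅

/-- Disjunction of truth values. -/
def Expr.or (e f : Expr) : Expr := .not (.mul (.not e) (.not f))

/-- De Morgan's law keeps the value in `{0, 1}`, which a sum would not. -/
theorem Ind.or {e f : Expr} {P Q : Prop} (hW : 1 ≤ W) (h : Ind W s e P) (h' : Ind W s f Q) :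
    Ind W s (.or e f) (P ∨ Q) :=
  (((h.not hW).and hW (h'.not hW)).not hW).congr (by tauto)

/-- Extend the clique in the array `9` greedily within the set in the array `5`. -/
def Prog.greedy : Prog :=
  .for 22 0 (.seq (.countNonNbrs 9 22 24 23)
    (.store 9 (.var 22) (.or (.get 9 22) (.mul (.get 5 22) (.not (.var 24))))))

theorem iter_greedyStep_subset {X C : Finset ℕ} (hX : X ⊆ Finset.range n)
    (hC : C ⊆ Finset.range n) (i : ℕ) : iter (greedyStep H X) 0 i C ⊆ Finset.range n := by
  induction i with
  | zero => exact hC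
  | succ i ih =>
    rw [iter, greedyStep]
    split_ifs with h
    exacts [Finset.insert_subset (hX h.1) ih, ih]

theorem Runs.greedy {X C : Finset ℕ} (h1 : 1 ≤ n) (hW : n * n + 3 * n + 10 ≤ W)
    (hs : Input H n s) (hX : IsChar n (s.array 5) X) (hXn : X ⊆ Finset.range n)
    (hC : IsChar n (s.array 9) C) (hCn : C ⊆ Finset.range n) :
    Runs W (70 * n ^ 2) .greedy s fun s' =>
      IsChar n (s'.array 9) (iter (greedyStep H X) 0 n C) := by
  refine (Runs.for (tb := 54 * n ^ 1) (fun i s' =>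
    IsChar n (s'.array 9) (iter (greedyStep H X) 0 i C))
    hs.size (by omega) (by omega) (of_decide_eq_true rfl) (of_decide_eq_true rfl) hC ?_).le
    ((cost_loop_le h1 le_rfl).trans (Nat.mul_le_mul (by omega) le_rfl))
  intro i hi s₁ hi₁ hC₁ hF₁
  have hI₁ : Input H n s₁ := hs.frame hF₁ (of_decide_eq_true rfl) (of_decide_eq_true rfl)
  have hsub := iter_greedyStep_subset (H := H) hXn hCn i
  refine (Runs.seq (t₂ := 24) (Runs.countNonNbrs h1 hW hI₁ (by omega) (by omega) (by omega)
    (by omega) (by omega) hi₁ hi hC₁ hsub) fun s₂ h24 hF₂ => ?_).le (by simp only [pow_one]; omega)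
  have hi₂ : s₂.scalar 22 = i := by rw [hF₂.scalar 22 (of_decide_eq_true rfl), hi₁]
  have hC₂ : IsChar n (s₂.array 9) (iter (greedyStep H X) 0 i C) := by
    rw [hF₂.array 9 (of_decide_eq_true rfl)]; exact hC₁
  have hX₂ : IsChar n (s₂.array 5) X := by
    rw [hF₂.array 5 (of_decide_eq_true rfl), hF₁.array 5 (of_decide_eq_true rfl)]; exact hX
  have hle := card_nonNbrs_le (H := H) hsub i
  have hInd : Ind W s₂ (.or (.get 9 22) (.mul (.get 5 22) (.not (.var 24)))) _ :=
    (Ind.get (by omega) hi₂ hi hC₂).or (by omega) ((Ind.get (by omega) hi₂ hi hX₂).and (by omega)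
      (Ind.of_eval (e := .var 24) (by omega) (by simp only [Expr.Fits]; omega) h24))
  refine (Runs.store (i := .var 22) (by simp only [Expr.Fits]; omega) hInd.1 ?_).le
    (by simp [Expr.or, Expr.not, Expr.get, Expr.cost])
  simp only [update_self]
  rw [hInd.2, show (Expr.var 22).eval s₂ = i from hi₂, iter, Nat.zero_add, greedyStep]
  refine hC₂.update (congrArg tv (propext ?_)) fun w hw => ?_
  · rw [Finset.card_eq_zero]
    split_ifs with h
    · simp [h.1, h.2]
    · exact ⟨fun h' => h'.resolve_right h, Or.inl⟩
  · split_ifs <;> simp [hw]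

/-- Decode a clique, extend it, and report its union with the set in the array `4`. -/
def Prog.tryClique (d : ℕ) : Prog :=
  .seq .decodeClique (.seq (.store 9 (.var 10) (.or (.get 9 10) (.get 5 10)))
    (.seq .greedy (.seq (.set 10 22 (.or (.get 4 22) (.get 9 22))) (.report d))))

/-- The greedy extension within `X` of `B`, together with `k` if this belongs to `X`. -/
noncomputable def extension (H : SimpleGraph ℕ) (n : ℕ) (X : Finset ℕ) (k : ℕ) (B : Finset ℕ) :
    Finset ℕ :=
  iter (greedyStep H X) 0 n (if k ∈ X then insert k B else B)

/-- No relation between the code `y` and an actual maximal clique is needed here: any decoded set is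
a harmless candidate, since `report` tests maximality. -/
theorem Runs.tryClique {T X Z : Finset ℕ} {k y κ : ℕ} {L : List (Finset ℕ)} (h1 : 1 ≤ n)
    (hW : n * n + 3 * n + 10 ≤ W) (hdW : d + 1 ≤ W) (hκ : 2 * (n * (κ + 1)) + 2 ≤ W)
    (hs : Input H n s) (hT : IsChar n (s.array 4) T) (hTn : T ⊆ Finset.range n)
    (hX : IsChar n (s.array 5) X) (hXn : X ⊆ Finset.range n)
    (hZ : IsChar n (s.array 6) Z) (hZn : Z ⊆ Finset.range n)
    (hfib : ∀ j ≤ Z.card + 2, s.array 7 j = Nat.fib j) (hfW : Nat.fib (Z.card + 2) ≤ W)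
    (hk : s.scalar 10 = k) (hkn : k < n) (hy : s.scalar 20 = y) (hyf : y < Nat.fib (Z.card + 2))
    (hL : Collected H d n s L κ) :
    Runs W (700 * n ^ 4) (.tryClique d) s (Extends H d n L κ 1
      (· = T ∪ extension H n X k (iter (_root_.cliqueStep H) 0 n (Z, y, ∅)).2.2)) := by
  refine (Runs.seq (Runs.decodeClique h1 hW hs hZ hZn hfib hfW hy hyf) fun s₁ hs₁ hF₁ => ?_).le
    (cost_add_le (i := 2) (j := 4) (k := 200) (l := 500) h1 le_rfl le_rfl (by omega) (by omega))
  have hI₁ : Input H n s₁ := hs.frame hF₁ (of_decide_eq_true rfl) (of_decide_eq_true rfl)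
  obtain ⟨-, -, hBn⟩ := iter_cliqueStep_bounds (H := H) hZn y n
  unfold extension
  generalize (iter (_root_.cliqueStep H) 0 n (Z, y, ∅)).2.2 = B at hs₁ hBn ⊢
  have hk₁ : s₁.scalar 10 = k := by rw [hF₁.scalar 10 (of_decide_eq_true rfl), hk]
  have hX₁ : IsChar n (s₁.array 5) X := by
    rw [hF₁.array 5 (of_decide_eq_true rfl)]; exact hX
  have hT₁ : IsChar n (s₁.array 4) T := by
    rw [hF₁.array 4 (of_decide_eq_true rfl)]; exact hT
  have hInd : Ind W s₁ (.or (.get 9 10) (.get 5 10)) _ :=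
    (Ind.get (by omega) hk₁ hkn hs₁).or (by omega) (Ind.get (by omega) hk₁ hkn hX₁)
  set C := if k ∈ X then insert k B else B with hC
  have hCn : C ⊆ Finset.range n := by
    rw [hC]
    split_ifs with h
    exacts [Finset.insert_subset (hXn h) hBn, hBn]
  refine (Runs.seq (t₁ := 20) (Q := fun s' => IsChar n (s'.array 9) C)
    ((Runs.store (i := .var 10) (by simp only [Expr.Fits]; omega) hInd.1 ?_).le
      (by simp [Expr.or, Expr.not, Expr.get, Expr.cost])) fun s₂ hs₂ hF₂ => ?_).le
    (cost_add_le (i := 0) (j := 4) (k := 20) (l := 480) h1 (by simp) le_rfl (by omega) (by omega))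
  · simp only [update_self]
    rw [hInd.2, show (Expr.var 10).eval s₁ = k from hk₁]
    refine hs₁.update (congrArg tv (propext ?_)) fun w hw => ?_
    · rw [hC]; split_ifs with h <;> simp [h]
    · rw [hC]; split_ifs <;> simp [hw]
  have hI₂ : Input H n s₂ := hI₁.frame hF₂ (of_decide_eq_true rfl) (of_decide_eq_true rfl)
  have hX₂ : IsChar n (s₂.array 5) X := by
    rw [hF₂.array 5 (of_decide_eq_true rfl)]; exact hX₁
  refine (Runs.seq (Runs.greedy h1 hW hI₂ hX₂ hXn hs₂ hCn) fun s₃ hs₃ hF₃ => ?_).le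
    (cost_add_le (i := 2) (j := 4) (k := 70) (l := 410) h1 le_rfl le_rfl (by omega) (by omega))
  have hI₃ : Input H n s₃ := hI₂.frame hF₃ (of_decide_eq_true rfl) (of_decide_eq_true rfl)
  have hAn := iter_greedyStep_subset (H := H) hXn hCn n
  generalize iter (greedyStep H X) 0 n C = A at hs₃ hAn ⊢
  have hT₃ : IsChar n (s₃.array 4) T := by
    rw [hF₃.array 4 (of_decide_eq_true rfl), hF₂.array 4 (of_decide_eq_true rfl)]; exact hT₁
  have hset : Runs W (27 * n ^ 1) (.set 10 22 (.or (.get 4 22) (.get 9 22))) s₃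
      fun s' => IsChar n (s'.array 10) (T ∪ A) := by
    refine (Runs.set (fun v => v ∈ T ∨ v ∈ A) hI₃.size (by omega) (by omega)
      fun i hi s' hb hx _ hwi => ?_).mono ?_ fun s' hs' _ => ?_
    · exact (Ind.get (by omega) hwi hi (by rwa [hb 4 (by omega)])).or (by omega)
        (Ind.get (by omega) hwi hi (by rwa [hb 9 (by omega)]))
    · simp only [Expr.or, Expr.not, Expr.get, Expr.cost, pow_one]; omega
    · exact hs'.congr fun v hv => by simp [hv]
  refine (Runs.seq hset fun s₄ hs₄ hF₄ => ?_).le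
    (cost_add_le (i := 1) (j := 4) (k := 27) (l := 383) h1 le_rfl le_rfl (by omega) (by omega))
  have hI₄ : Input H n s₄ := hI₃.frame hF₄ (of_decide_eq_true rfl) (of_decide_eq_true rfl)
  have hL₄ : Collected H d n s₄ L κ :=
    (((hL.frame hF₁ (of_decide_eq_true rfl) (of_decide_eq_true rfl) rfl).frame hF₂
      (of_decide_eq_true rfl) (of_decide_eq_true rfl) rfl).frame hF₃
      (of_decide_eq_true rfl) (of_decide_eq_true rfl) rfl).frame hF₄
      (of_decide_eq_true rfl) (of_decide_eq_true rfl) rfl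
  exact (Runs.report h1 hW hdW hκ hI₄ hs₄ (Finset.union_subset hTn hAn) hL₄).le
    (Nat.mul_le_mul (by omega) le_rfl)

end TryClique

/-! ## Trying one tail -/

section TryTail
open Classical

variable {H : SimpleGraph ℕ} {d n W : ℕ} {s : Config}

/-- One step of the decoding of a subset. -/
def Prog.subsetStep : Prog :=
  .ite (.get 2 22)
    (.seq (.assign 16 (.sub (.var 16) (.lit 1)))
      (.ite (.sub (.add (.var 15) (.lit 1)) (.arr 3 (.var 16)))
        (.seq (.assign 15 (.sub (.var 15) (.arr 3 (.var 16)))) (.store 4 (.var 22) (.lit 1)))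
        .skip))
    .skip

theorem Runs.subsetStep {Z : Finset ℕ} {st : ℕ × ℕ × Finset ℕ} {v : ℕ}
    (hW : n + 1 ≤ W) (hv : s.scalar 22 = v) (hvn : v < n) (hZ : IsChar n (s.array 2) Z)
    (hr : s.scalar 16 = st.1) (hx : s.scalar 15 = st.2.1) (hrW : st.1 ≤ W) (hxW : st.2.1 + 1 ≤ W)
    (hT : IsChar n (s.array 4) st.2.2) (hpow : s.array 3 (st.1 - 1) = 2 ^ (st.1 - 1))
    (hpW : 2 ^ (st.1 - 1) ≤ W) :
    Runs W 30 .subsetStep s fun s' =>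
      s'.scalar 16 = (subsetStep Z v st).1 ∧ s'.scalar 15 = (subsetStep Z v st).2.1 ∧
        IsChar n (s'.array 4) (subsetStep Z v st).2.2 := by
  obtain ⟨r, x, T⟩ := st
  simp only at hr hx hrW hxW hT hpow hpW
  have hget : Ind W s (.get 2 22) (v ∈ Z) := Ind.get (by omega) hv hvn hZ
  refine (Runs.ite (t₁ := 26) (t₂ := 1) hget.1 (fun h => ?_) (fun h => ?_)).le
    (by simp [Expr.get, Expr.cost])
  swap
  · rw [hget.eval_eq_zero] at h
    simp only [_root_.subsetStep, if_neg h]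
    exact Runs.skip ⟨hr, hx, hT⟩
  rw [hget.eval_ne_zero] at h
  simp only [_root_.subsetStep, if_pos h]
  refine (Runs.seq (t₁ := 4) (t₂ := 20) (Q := fun s' => s'.scalar 16 = r - 1)
    (Runs.assign (e := .sub (.var 16) (.lit 1)) ?_ ?_) fun s₁ hs₁ hF₁ => ?_).le (by omega)
  · simp only [Expr.Fits]; omega
  · simp [Expr.eval, hr]
  have hx₁ : s₁.scalar 15 = x := by rw [hF₁.scalar 15 (of_decide_eq_true rfl), hx]
  have hv₁ : s₁.scalar 22 = v := by rw [hF₁.scalar 22 (of_decide_eq_true rfl), hv]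
  have hT₁ : IsChar n (s₁.array 4) T := by
    rw [hF₁.array 4 (of_decide_eq_true rfl)]; exact hT
  have hp₁ : s₁.array 3 (r - 1) = 2 ^ (r - 1) := by
    rw [hF₁.array 3 (of_decide_eq_true rfl), hpow]
  have hfit : (Expr.arr 3 (.var 16)).Fits W s₁ := by
    simp only [Expr.Fits, Expr.eval, hs₁, hp₁]; omega
  refine (Runs.ite (e := .sub (.add (.var 15) (.lit 1)) (.arr 3 (.var 16))) (t₁ := 8) (t₂ := 1)
    ⟨?_, hfit⟩ (fun hc => ?_) (fun hc => ?_)).le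
    (by simp [Expr.cost])
  · simp only [Expr.Fits, Expr.eval]; omega
  -- As for cliques, `x + 1` minus the power is nonzero exactly when the power is at most `x`.
  · simp only [Expr.eval, hs₁, hp₁, hx₁] at hc
    rw [if_pos (by omega)]
    refine Runs.seq (t₁ := 5) (t₂ := 3)
      (Q := fun s' => s'.scalar 15 = x - 2 ^ (r - 1))
      (Runs.assign (e := .sub (.var 15) (.arr 3 (.var 16))) ⟨?_, hfit⟩ ?_) fun s₂ hs₂ hF₂ => ?_
    · simp only [Expr.Fits]; omega
    · simp [Expr.eval, hs₁, hp₁, hx₁]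
    have hv₂ : s₂.scalar 22 = v := by rw [hF₂.scalar 22 (of_decide_eq_true rfl), hv₁]
    refine Runs.store (i := .var 22) (e := .lit 1) (by simp only [Expr.Fits]; omega)
      (by simp only [Expr.Fits]; omega) ⟨?_, hs₂, ?_⟩
    · rw [← hs₁]; exact hF₂.scalar 16 (of_decide_eq_true rfl)
    · simp only [update_self, Expr.eval, hv₂]
      rw [hF₂.array 4 (of_decide_eq_true rfl)]
      exact hT₁.update (tv_pos (by simp)).symm (by simp +contextual)
  · simp only [Expr.eval, hs₁, hp₁, hx₁] at hc
    rw [if_neg (by omega)]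
    exact Runs.skip ⟨hs₁, hx₁, hT₁⟩

theorem iter_subsetStep_bounds {Z E : Finset ℕ} (hZ : Z ⊆ Finset.range n)
    (hE : E ⊆ Finset.range n) (m x i : ℕ) :
    (iter (subsetStep Z) 0 i (m, x, E)).1 ≤ m ∧ (iter (subsetStep Z) 0 i (m, x, E)).2.1 ≤ x ∧
      (iter (subsetStep Z) 0 i (m, x, E)).2.2 ⊆ Finset.range n := by
  induction i with
  | zero => exact ⟨le_rfl, le_rfl, hE⟩
  | succ i ih =>
    rw [iter]
    generalize iter (subsetStep Z) 0 i (m, x, E) = st at ih ⊢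
    obtain ⟨h1, h2, h3⟩ := ih
    unfold subsetStep
    split_ifs with ha hb
    · exact ⟨(Nat.sub_le _ _).trans h1, (Nat.sub_le _ _).trans h2,
        Finset.insert_subset (hZ ha) h3⟩
    · exact ⟨(Nat.sub_le _ _).trans h1, h2, h3⟩
    · exact ⟨h1, h2, h3⟩

/-- Store in the array `4` the guessed vertices and the subset of the set in the array `2` encoded
by the scalar `14`. -/
def Prog.buildTail : Prog :=
  .seq (.clear 4 22) (.seq (.for 34 17 (.store 4 (.arr 1 (.add (.var 34) (.lit 4))) (.lit 1)))
    (.seq (.assign 15 (.var 14)) (.seq (.assign 16 (.var 12)) (.for 22 0 .subsetStep))))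

/-- The set of the guessed vertices `f 4, …, f (2 * d + 3)`, with the subset of `Z` of code `x`. -/
noncomputable def tail (d n : ℕ) (f : ℕ → ℕ) (Z : Finset ℕ) (x : ℕ) : Finset ℕ :=
  (iter (subsetStep Z) 0 n
    (Z.card, x, (Finset.range (2 * d)).image fun i => f (i + 4))).2.2

theorem guessed_subset {f : ℕ → ℕ} (hfn : ∀ j < 2 * d + 4, f j < n) (k : ℕ) (hk : k ≤ 2 * d) :
    (Finset.range k).image (fun i => f (i + 4)) ⊆ Finset.range n := by
  intro v hv
  obtain ⟨i, hi, rfl⟩ := Finset.mem_image.1 hv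
  exact Finset.mem_range.2 (hfn _ (by have := Finset.mem_range.1 hi; omega))

theorem tail_subset {f : ℕ → ℕ} (hfn : ∀ j < 2 * d + 4, f j < n) {Z : Finset ℕ}
    (hZ : Z ⊆ Finset.range n) (x : ℕ) : tail d n f Z x ⊆ Finset.range n :=
  (iter_subsetStep_bounds hZ (guessed_subset hfn _ le_rfl) _ _ _).2.2

theorem Runs.buildTail {Z : Finset ℕ} {x : ℕ} {f : ℕ → ℕ} (h1 : 1 ≤ n)
    (hW : n * n + 3 * n + 10 ≤ W) (hdW : 2 * d + 4 ≤ W) (hs : Input H n s)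
    (hZ : IsChar n (s.array 2) Z) (hZn : Z ⊆ Finset.range n) (h12 : s.scalar 12 = Z.card)
    (h17 : s.scalar 17 = 2 * d) (hf : ∀ j < 2 * d + 4, s.array 1 j = f j)
    (hfn : ∀ j < 2 * d + 4, f j < n) (hpow : ∀ j ≤ Z.card, s.array 3 j = 2 ^ j)
    (hpW : 2 ^ Z.card ≤ W) (h14 : s.scalar 14 = x) (hx : x < 2 ^ Z.card) :
    Runs W ((75 + 28 * d) * n ^ 1) .buildTail s fun s' =>
      IsChar n (s'.array 4) (tail d n f Z x) := by
  have hZc := card_le_of_subset_range hZn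
  refine (Runs.seq (Runs.clear h1 hs.size (by omega) (by omega)) fun s₁ hs₁ hF₁ => ?_).le
    (cost_add_le (i := 1) (j := 1) (m := 1) (k := 17) (l := 58 + 28 * d) h1 le_rfl le_rfl
      (by omega) (by omega) |>.trans (Nat.mul_le_mul (by omega) le_rfl))
  have hI₁ : Input H n s₁ := hs.frame hF₁ (of_decide_eq_true rfl) (of_decide_eq_true rfl)
  refine (Runs.seq (Q := fun s' => IsChar n (s'.array 4)
    ((Finset.range (2 * d)).image fun i => f (i + 4)))
    (Runs.for (N := 2 * d) (tb := 6) (fun i s' => IsChar n (s'.array 4)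
      ((Finset.range i).image fun i => f (i + 4))) ?_ (by omega) (by omega)
      (of_decide_eq_true rfl) (of_decide_eq_true rfl) (by simpa using hs₁) ?_)
    fun s₂ hs₂ hF₂ => ?_).le
    (cost_add_le (i := 1) (j := 1) (m := 1) (k := 28 * d + 6) (l := 52) h1 ?_ le_rfl
      (by omega) (by omega) |>.trans (Nat.mul_le_mul (by omega) le_rfl))
  · rw [hF₁.scalar 17 (of_decide_eq_true rfl), h17]
  · intro i hi s₂ hi₂ hs₂ hF₂
    have ha : s₂.array 1 (i + 4) = f (i + 4) := by
      rw [hF₂.array 1 (of_decide_eq_true rfl), hF₁.array 1 (of_decide_eq_true rfl),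
        hf _ (by omega)]
    have hlt := hfn (i + 4) (by omega)
    refine Runs.store (i := .arr 1 (.add (.var 34) (.lit 4))) (e := .lit 1) ?_
      (by simp only [Expr.Fits]; omega) ?_
    · simp only [Expr.Fits, Expr.eval, hi₂, ha]; omega
    · simp only [update_self, Expr.eval, hi₂, ha]
      refine hs₂.update (tv_pos ?_).symm ?_
      · rw [Finset.range_add_one, Finset.image_insert]; simp
      · intro w hw
        rw [Finset.range_add_one, Finset.image_insert, Finset.mem_insert, or_iff_right hw]
  swap
  · nlinarith
  have hI₂ : Input H n s₂ := hI₁.frame hF₂ (of_decide_eq_true rfl) (of_decide_eq_true rfl)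
  have h14' : s₂.scalar 14 = x := by
    rw [hF₂.scalar 14 (of_decide_eq_true rfl), hF₁.scalar 14 (of_decide_eq_true rfl), h14]
  have h12' : s₂.scalar 12 = Z.card := by
    rw [hF₂.scalar 12 (of_decide_eq_true rfl), hF₁.scalar 12 (of_decide_eq_true rfl), h12]
  refine (Runs.seq (t₁ := 2) (t₂ := 46 * n ^ 1) (Q := fun s' => s'.scalar 15 = x)
    (Runs.assign (e := .var 14) (by simp only [Expr.Fits]; omega) (by simp [Expr.eval, h14']))
    fun s₃ hs₃ hF₃ => ?_).le (by simp only [pow_one]; omega)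
  refine (Runs.seq (t₁ := 2) (t₂ := 44 * n ^ 1) (Q := fun s' => s'.scalar 16 = Z.card)
    (Runs.assign (e := .var 12) ?_ ?_) fun s₄ hs₄ hF₄ => ?_).le (by simp only [pow_one]; omega)
  · simp only [Expr.Fits]; rw [hF₃.scalar 12 (of_decide_eq_true rfl)]; omega
  · simp [Expr.eval, hF₃.scalar 12 (of_decide_eq_true rfl), h12']
  have hI₄ : Input H n s₄ := (hI₂.frame hF₃ (of_decide_eq_true rfl) (of_decide_eq_true rfl)).frame
    hF₄ (of_decide_eq_true rfl) (of_decide_eq_true rfl)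
  have hEn := guessed_subset hfn _ le_rfl
  unfold tail
  generalize (Finset.range (2 * d)).image (fun i => f (i + 4)) = E at hs₂ hEn ⊢
  refine (Runs.for (N := n) (tb := 30) (fun i s' =>
    s'.scalar 16 = (iter (_root_.subsetStep Z) 0 i (Z.card, x, E)).1 ∧
    s'.scalar 15 = (iter (_root_.subsetStep Z) 0 i (Z.card, x, E)).2.1 ∧
    IsChar n (s'.array 4) (iter (_root_.subsetStep Z) 0 i (Z.card, x, E)).2.2)
    hI₄.size (by omega) (by omega) (of_decide_eq_true rfl) (of_decide_eq_true rfl) ?_ ?_).mono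
    (by simp only [pow_one]; omega) fun s₅ hs₅ _ => hs₅.2.2
  · simp (disch := decide) only [update_of_ne]
    rw [hF₄.scalar 15 (of_decide_eq_true rfl), hF₄.array 4 (of_decide_eq_true rfl),
      hF₃.array 4 (of_decide_eq_true rfl)]
    exact ⟨hs₄, hs₃, hs₂⟩
  · rintro i hi s₅ hi₅ ⟨h16, h15, h4⟩ hF₅
    obtain ⟨hb1, hb2, -⟩ := iter_subsetStep_bounds hZn hEn Z.card x i
    have e2 : s₅.array 2 = s.array 2 := by
      rw [hF₅.array 2 (of_decide_eq_true rfl), hF₄.array 2 (of_decide_eq_true rfl),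
        hF₃.array 2 (of_decide_eq_true rfl), hF₂.array 2 (of_decide_eq_true rfl),
        hF₁.array 2 (of_decide_eq_true rfl)]
    have e3 : s₅.array 3 = s.array 3 := by
      rw [hF₅.array 3 (of_decide_eq_true rfl), hF₄.array 3 (of_decide_eq_true rfl),
        hF₃.array 3 (of_decide_eq_true rfl), hF₂.array 3 (of_decide_eq_true rfl),
        hF₁.array 3 (of_decide_eq_true rfl)]
    refine (Runs.subsetStep (n := n) (Z := Z) (by omega) hi₅ hi (by rwa [e2]) h16 h15 (by omega)
      (by omega) h4 (by rw [e3]; exact hpow _ (by omega)) ?_).mono le_rfl fun s₆ hs₆ _ => ?_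
    · exact (Nat.pow_le_pow_right (by omega) (by omega)).trans hpW
    · simp (disch := decide) only [update_of_ne, iter, Nat.zero_add]
      exact hs₆

/-- Store in the array `5` the vertices that can be put in front of the set in the array `4`. -/
def Prog.headSet (d : ℕ) : Prog :=
  .for 22 0 (.seq (.countNonNbrs 4 22 24 23)
    (.store 5 (.var 22) (.mul (.not (.get 4 22)) (.not (.sub (.var 24) (.lit d))))))

theorem Runs.headSet {T : Finset ℕ} (h1 : 1 ≤ n) (hW : n * n + 3 * n + 10 ≤ W) (hdW : 2 * d + 4 ≤ W)
    (hs : Input H n s) (hT : IsChar n (s.array 4) T) (hTn : T ⊆ Finset.range n) :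
    Runs W (64 * n ^ 2) (.headSet d) s fun s' => IsChar n (s'.array 5) (heads H d n T) := by
  refine (Runs.for (tb := 50 * n ^ 1) (fun i s' =>
    ∀ v < i, s'.array 5 v = tv (v ∈ heads H d n T)) hs.size (by omega) (by omega)
    (of_decide_eq_true rfl) (of_decide_eq_true rfl) (by simp) ?_).mono
    ((cost_loop_le h1 le_rfl).trans (Nat.mul_le_mul (by omega) le_rfl)) fun s' hs' _ => hs'
  intro i hi s₁ hi₁ hX₁ hF₁
  have hI₁ : Input H n s₁ := hs.frame hF₁ (of_decide_eq_true rfl) (of_decide_eq_true rfl)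
  have hT₁ : IsChar n (s₁.array 4) T := by
    rw [hF₁.array 4 (of_decide_eq_true rfl)]; exact hT
  refine (Runs.seq (t₂ := 20) (Runs.countNonNbrs h1 hW hI₁ (by omega) (by omega) (by omega)
    (by omega) (by omega) hi₁ hi hT₁ hTn) fun s₂ h24 hF₂ => ?_).le (by simp only [pow_one]; omega)
  have hi₂ : s₂.scalar 22 = i := by rw [hF₂.scalar 22 (of_decide_eq_true rfl), hi₁]
  have hT₂ : IsChar n (s₂.array 4) T := by
    rw [hF₂.array 4 (of_decide_eq_true rfl)]; exact hT₁
  have hle := card_nonNbrs_le (H := H) hTn i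
  have hInd : Ind W s₂ (.mul (.not (.get 4 22)) (.not (.sub (.var 24) (.lit d)))) _ :=
    ((Ind.get (by omega) hi₂ hi hT₂).not (by omega)).and (by omega)
      (Ind.of_eval (e := .sub (.var 24) (.lit d)) (m := (nonNbrs H T i).card - d) (by omega)
        (by simp only [Expr.Fits]; omega) (by simp only [Expr.eval, h24]))
  refine (Runs.store (i := .var 22) (by simp only [Expr.Fits]; omega) hInd.1 ?_).le
    (by simp [Expr.not, Expr.get, Expr.cost])
  simp only [update_self]
  rw [hInd.2, show (Expr.var 22).eval s₂ = i from hi₂]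
  intro v hv
  by_cases hvi : v = i
  · rw [hvi, update_self]
    refine congrArg tv (propext ?_)
    simp only [heads, Finset.mem_filter, Finset.mem_range, Nat.sub_eq_zero_iff_le]
    tauto
  · rw [update_of_ne hvi, hF₂.array 5 (of_decide_eq_true rfl)]
    exact hX₁ v (by omega)

/-- Whether the vertex in the scalar `v` is a common neighbour of the vertices in the scalars `p`
and `q`, and these are distinct and not adjacent. -/
def Expr.common (p q v : ℕ) : Expr :=
  .mul (.mul (.not (.not (.add (.sub (.var p) (.var q)) (.sub (.var q) (.var p)))))
    (.not (.adj p q))) (.mul (.adj p v) (.adj q v))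

theorem Ind.common {p q v a b c : ℕ} (hW : n * n + 3 * n + 10 ≤ W) (hs : Input H n s)
    (hp : s.scalar p = a) (hq : s.scalar q = b) (hv : s.scalar v = c) (ha : a < n) (hb : b < n)
    (hc : c < n) :
    Ind W s (.common p q v) ((a ≠ b ∧ ¬ H.Adj a b) ∧ H.Adj a c ∧ H.Adj b c) := by
  have h1 : Ind W s (.not (.not (.add (.sub (.var p) (.var q)) (.sub (.var q) (.var p)))))
      (a ≠ b) := by
    -- The sum of the two truncated differences vanishes exactly for equal numbers.
    refine ((Ind.of_eval (m := (a - b) + (b - a)) (by omega) ?_ ?_).not (by omega)).congr ?_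
    · simp only [Expr.Fits, Expr.eval, hp, hq]; omega
    · simp only [Expr.eval, hp, hq]
    · omega
  exact (h1.and (by omega) ((Ind.adj hW hs hp hq ha hb).not (by omega))).and (by omega)
    ((Ind.adj hW hs hp hv ha hc).and (by omega) (Ind.adj hW hs hq hv hb hc))

/-- Store in the array `6` the set of common neighbours from which a clique is chosen. -/
def Prog.cliqueDomain : Prog :=
  .set 6 22 (.mul (.common 10 11 22) (.mul (.get 5 22) (.not (.not (.sub (.var 10) (.var 22))))))

theorem Runs.cliqueDomain {X : Finset ℕ} {k u : ℕ} (h1 : 1 ≤ n) (hW : n * n + 3 * n + 10 ≤ W)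
    (hs : Input H n s) (hX : IsChar n (s.array 5) X) (hk : s.scalar 10 = k) (hu : s.scalar 11 = u)
    (hkn : k < n) (hun : u < n) :
    Runs W (80 * n ^ 1) .cliqueDomain s fun s' => IsChar n (s'.array 6) (commonBelow H n X k u) := by
  refine (Runs.set (fun v => ((k ≠ u ∧ ¬ H.Adj k u) ∧ H.Adj k v ∧ H.Adj u v) ∧ v ∈ X ∧ v < k)
    hs.size (by omega) (by omega) fun i hi s' hb hx ha hi' => ?_).mono ?_ fun s' hs' _ => ?_
  · have hI : Input H n s' :=
      ⟨by rw [hx 0 (by omega), hs.size], by rw [hb 0 (by omega)]; exact hs.adj⟩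
    have hk' : s'.scalar 10 = k := by rw [hx 10 (by omega), hk]
    have hu' : s'.scalar 11 = u := by rw [hx 11 (by omega), hu]
    refine (Ind.common hW hI hk' hu' hi' hkn hun hi).and (by omega)
      ((Ind.get (by omega) hi' hi (by rwa [hb 5 (by omega)])).and (by omega)
      (((Ind.of_eval (m := k - i) (by omega) ?_ ?_).not (by omega)).congr ?_))
    · simp only [Expr.Fits]; omega
    · simp only [Expr.eval, hk', hi']
    · omega
  · simp only [Expr.common, Expr.adj, Expr.not, Expr.get, Expr.cost, pow_one]; omega
  · refine hs'.congr fun v hv => ?_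
    simp only [commonBelow, _root_.common, Finset.mem_filter, Finset.mem_range]
    tauto

/-- Store in the array `7` the Fibonacci numbers up to the index in the scalar `18` plus `2`. -/
def Prog.fibTable : Prog :=
  .seq (.store 7 (.lit 0) (.lit 0)) (.seq (.store 7 (.lit 1) (.lit 1))
    (.seq (.assign 35 (.add (.var 18) (.lit 1)))
      (.for 34 35 (.store 7 (.add (.var 34) (.lit 2))
        (.add (.arr 7 (.var 34)) (.arr 7 (.add (.var 34) (.lit 1))))))))

theorem Runs.fibTable {m : ℕ} (h1 : 1 ≤ n) (hW : n + 5 ≤ W) (hm : s.scalar 18 = m) (hmn : m ≤ n)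
    (hfW : Nat.fib (m + 2) ≤ W) :
    Runs W (60 * n ^ 1) .fibTable s fun s' => ∀ j ≤ m + 2, s'.array 7 j = Nat.fib j := by
  refine (Runs.seq (t₁ := 3) (t₂ := 57 * n ^ 1) (Q := fun s' => s'.array 7 0 = 0)
    (Runs.store (i := .lit 0) (e := .lit 0) (by simp only [Expr.Fits]; omega)
      (by simp only [Expr.Fits]; omega) (by simp [Expr.eval])) fun s₁ hs₁ hF₁ => ?_).le
    (by simp only [pow_one]; omega)
  refine (Runs.seq (t₁ := 3) (t₂ := 54 * n ^ 1)
    (Q := fun s' => s'.array 7 0 = 0 ∧ s'.array 7 1 = 1)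
    (Runs.store (i := .lit 1) (e := .lit 1) (by simp only [Expr.Fits]; omega)
      (by simp only [Expr.Fits]; omega) (by simp [Expr.eval, hs₁])) fun s₂ hs₂ hF₂ => ?_).le
    (by simp only [pow_one]; omega)
  have hm₂ : s₂.scalar 18 = m := by
    rw [hF₂.scalar 18 (of_decide_eq_true rfl), hF₁.scalar 18 (of_decide_eq_true rfl), hm]
  -- Entries 0 and 1 being set, `m + 1` rounds fill the indices `2, …, m + 2`.
  refine (Runs.seq (t₁ := 4) (t₂ := 50 * n ^ 1) (Q := fun s' => s'.scalar 35 = m + 1)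
    (Runs.assign (e := .add (.var 18) (.lit 1)) (by simp only [Expr.Fits, Expr.eval]; omega)
      (by simp [Expr.eval, hm₂])) fun s₃ hs₃ hF₃ => ?_).le (by simp only [pow_one]; omega)
  refine (Runs.for (N := m + 1) (tb := 11) (fun i s' => ∀ j < i + 2, s'.array 7 j = Nat.fib j)
    hs₃ (by omega) (by omega) (of_decide_eq_true rfl) (of_decide_eq_true rfl) ?_ ?_).mono
    (by simp only [pow_one]; omega) fun s' hs' _ j hj => hs' j (by omega)
  · intro j hj
    simp only
    rw [hF₃.array 7 (of_decide_eq_true rfl)]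
    interval_cases j
    · simpa using hs₂.1
    · simpa using hs₂.2
  · intro i hi s₄ hi₄ hs₄ hF₄
    have hfib : Nat.fib (i + 2) = Nat.fib i + Nat.fib (i + 1) := Nat.fib_add_two
    have hle : Nat.fib (i + 2) ≤ Nat.fib (m + 2) := Nat.fib_mono (by omega)
    refine Runs.store (i := .add (.var 34) (.lit 2))
      (e := .add (.arr 7 (.var 34)) (.arr 7 (.add (.var 34) (.lit 1)))) ?_ ?_ ?_
    · simp only [Expr.Fits, Expr.eval]; omega
    · simp only [Expr.Fits, Expr.eval, hi₄, hs₄ i (by omega), hs₄ (i + 1) (by omega)]; omega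
    · intro j hj
      simp only [Expr.eval, hi₄, hs₄ i (by omega), hs₄ (i + 1) (by omega), update_self]
      by_cases hji : j = i + 2
      · rw [hji, update_self, hfib]
      · rw [update_of_ne hji, hs₄ j (by omega)]

/-- Report all candidates with the tail encoded by the scalar `14`. -/
def Prog.tryTail (d : ℕ) : Prog :=
  .seq .buildTail (.seq (.headSet d) (.seq .cliqueDomain (.seq (.countSet 6 18 22) (.seq .fibTable
    (.seq (.assign 19 (.arr 7 (.add (.var 18) (.lit 2)))) (.for 20 19 (.tryClique d)))))))

/-- The candidate consisting of the tail `T` and the clique determined by `k`, `u` and `y`. -/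
noncomputable def candidate (H : SimpleGraph ℕ) (d n : ℕ) (T : Finset ℕ) (k u y : ℕ) :
    Finset ℕ :=
  T ∪ extension H n (heads H d n T) k
    (iter (cliqueStep H) 0 n (commonBelow H n (heads H d n T) k u, y, ∅)).2.2

theorem common_subset (p q : ℕ) : common H n p q ⊆ Finset.range n := Finset.filter_subset _ _

theorem commonBelow_subset (X : Finset ℕ) (k u : ℕ) : commonBelow H n X k u ⊆ common H n k u :=
  Finset.filter_subset _ _

/-- The clique is chosen inside a common neighbourhood of at most `c` vertices, so at most `fib (c +
2)` codes are tried for each tail, at a cost of order `n ^ 4` each. -/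
theorem Runs.tryTail {Z : Finset ℕ} {x c κ : ℕ} {f : ℕ → ℕ} {L : List (Finset ℕ)} (h1 : 1 ≤ n)
    (hW : n * n + 3 * n + 10 ≤ W) (hdW : 2 * d + 4 ≤ W)
    (hκ : 2 * (n * (κ + Nat.fib (c + 2))) + 2 ≤ W) (hc : ∀ u v, (common H n u v).card ≤ c)
    (hs : Input H n s) (hZ : IsChar n (s.array 2) Z) (hZn : Z ⊆ Finset.range n)
    (h12 : s.scalar 12 = Z.card) (h17 : s.scalar 17 = 2 * d)
    (hf : ∀ j < 2 * d + 4, s.array 1 j = f j) (hfn : ∀ j < 2 * d + 4, f j < n)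
    (h10 : s.scalar 10 = f 2) (h11 : s.scalar 11 = f 3)
    (hpow : ∀ j ≤ Z.card, s.array 3 j = 2 ^ j) (hpW : 2 ^ Z.card ≤ W) (h14 : s.scalar 14 = x)
    (hx : x < 2 ^ Z.card) (hL : Collected H d n s L κ) :
    Runs W ((1100 + 28 * d) * (Nat.fib (c + 2) * n ^ 4)) (.tryTail d) s
      (Extends H d n L κ (Nat.fib (c + 2)) fun S =>
        ∃ y, S = candidate H d n (tail d n f Z x) (f 2) (f 3) y ∧
          y < Nat.fib ((commonBelow H n (heads H d n (tail d n f Z x)) (f 2) (f 3)).card + 2)) := by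
  have hTn := tail_subset hfn hZn x
  unfold candidate
  have hMpos : 1 ≤ Nat.fib (c + 2) := Nat.fib_pos.2 (by omega)
  have hn4 : 1 ≤ n ^ 4 := Nat.one_le_pow _ _ h1
  have hMn : n ^ 4 ≤ Nat.fib (c + 2) * n ^ 4 := Nat.le_mul_of_pos_left _ hMpos
  have hMW : Nat.fib (c + 2) + 1 ≤ W := by
    have : Nat.fib (c + 2) ≤ n * (κ + Nat.fib (c + 2)) := by nlinarith
    omega
  have hup : ∀ {i : ℕ}, i ≤ 4 → n ^ i ≤ n ^ 4 := fun h => Nat.pow_le_pow_right h1 h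
  have hp1 := hup (show 1 ≤ 4 by omega)
  have hp2 := hup (show 2 ≤ 4 by omega)
  refine (Runs.seq (t₂ := 1000 * (Nat.fib (c + 2) * n ^ 4))
    (Runs.buildTail h1 hW hdW hs hZ hZn h12 h17 hf hfn hpow hpW h14 hx)
    fun s₁ hs₁ hF₁ => ?_).le (by nlinarith [Nat.zero_le d])
  generalize tail d n f Z x = T at hs₁ hTn ⊢
  have hI₁ : Input H n s₁ := hs.frame hF₁ (of_decide_eq_true rfl) (of_decide_eq_true rfl)
  refine (Runs.seq (t₂ := 900 * (Nat.fib (c + 2) * n ^ 4))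
    (Runs.headSet h1 hW hdW hI₁ hs₁ hTn) fun s₂ hs₂ hF₂ => ?_).le (by omega)
  have hI₂ : Input H n s₂ := hI₁.frame hF₂ (of_decide_eq_true rfl) (of_decide_eq_true rfl)
  have hXn : heads H d n T ⊆ Finset.range n := Finset.filter_subset _ _
  generalize heads H d n T = X at hs₂ hXn ⊢
  have h10₂ : s₂.scalar 10 = f 2 := by
    rw [hF₂.scalar 10 (of_decide_eq_true rfl), hF₁.scalar 10 (of_decide_eq_true rfl), h10]
  have h11₂ : s₂.scalar 11 = f 3 := by
    rw [hF₂.scalar 11 (of_decide_eq_true rfl), hF₁.scalar 11 (of_decide_eq_true rfl), h11]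
  refine (Runs.seq (t₂ := 820 * (Nat.fib (c + 2) * n ^ 4))
    (Runs.cliqueDomain h1 hW hI₂ hs₂ h10₂ h11₂ (hfn _ (by omega)) (hfn _ (by omega)))
    fun s₃ hs₃ hF₃ => ?_).le (by omega)
  have hI₃ : Input H n s₃ := hI₂.frame hF₃ (of_decide_eq_true rfl) (of_decide_eq_true rfl)
  have hYc := (Finset.card_le_card (commonBelow_subset X (f 2) (f 3))).trans (hc _ _)
  have hYn := (commonBelow_subset (H := H) (n := n) X (f 2) (f 3)).trans (common_subset _ _)
  generalize commonBelow H n X (f 2) (f 3) = Y at hs₃ hYc hYn ⊢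
  have hYcn := card_le_of_subset_range hYn
  have hYM : Nat.fib (Y.card + 2) ≤ Nat.fib (c + 2) := Nat.fib_mono (by omega)
  refine (Runs.seq (t₂ := 799 * (Nat.fib (c + 2) * n ^ 4))
    (Runs.countSet h1 hI₃.size (by omega) (by omega) (by omega) (by omega) hs₃ hYn)
    fun s₄ hs₄ hF₄ => ?_).le (by omega)
  refine (Runs.seq (t₂ := 739 * (Nat.fib (c + 2) * n ^ 4))
    (Runs.fibTable h1 (by omega) hs₄ hYcn (by omega)) fun s₅ hs₅ hF₅ => ?_).le (by omega)
  have h18 : s₅.scalar 18 = Y.card := by rw [hF₅.scalar 18 (of_decide_eq_true rfl), hs₄]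
  have h7 := hs₅ (Y.card + 2) le_rfl
  refine (Runs.seq (t₁ := 5) (t₂ := 730 * (Nat.fib (c + 2) * n ^ 4))
    (Q := fun s' => s'.scalar 19 = Nat.fib (Y.card + 2))
    (Runs.assign (e := .arr 7 (.add (.var 18) (.lit 2))) ?_ ?_) fun s₆ hs₆ hF₆ => ?_).le (by omega)
  · simp only [Expr.Fits, Expr.eval, h18, h7]; omega
  · simp [Expr.eval, h18, h7]
  have hI₆ : Input H n s₆ := ((hI₃.frame hF₄ (of_decide_eq_true rfl) (of_decide_eq_true rfl)).frame
    hF₅ (of_decide_eq_true rfl) (of_decide_eq_true rfl)).frame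
    hF₆ (of_decide_eq_true rfl) (of_decide_eq_true rfl)
  have hL₆ : Collected H d n s₆ L κ :=
    (((((hL.frame hF₁ (of_decide_eq_true rfl) (of_decide_eq_true rfl) rfl).frame hF₂
      (of_decide_eq_true rfl) (of_decide_eq_true rfl) rfl).frame hF₃
      (of_decide_eq_true rfl) (of_decide_eq_true rfl) rfl).frame hF₄
      (of_decide_eq_true rfl) (of_decide_eq_true rfl) rfl).frame hF₅
      (of_decide_eq_true rfl) (of_decide_eq_true rfl) rfl).frame hF₆
      (of_decide_eq_true rfl) (of_decide_eq_true rfl) rfl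
  refine (Runs.forExtends (M := 1) (tb := 700 * n ^ 4) (F := fun y S =>
    S = T ∪ extension H n X (f 2) (iter (_root_.cliqueStep H) 0 n (Y, y, ∅)).2.2)
    hs₆ (by omega) (by omega) (of_decide_eq_true rfl) (of_decide_eq_true rfl) (by omega) hL₆
    fun y hy s₇ L' hy₇ hF₇ hL' => ?_).mono ?_ fun s' hs' _ => hs'.mono (by omega) ?_
  · have hI₇ : Input H n s₇ := hI₆.frame hF₇ (of_decide_eq_true rfl) (of_decide_eq_true rfl)
    have e4 : s₇.array 4 = s₁.array 4 := by
      rw [hF₇.array 4 (of_decide_eq_true rfl), hF₆.array 4 (of_decide_eq_true rfl),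
        hF₅.array 4 (of_decide_eq_true rfl), hF₄.array 4 (of_decide_eq_true rfl),
        hF₃.array 4 (of_decide_eq_true rfl), hF₂.array 4 (of_decide_eq_true rfl)]
    have e5 : s₇.array 5 = s₂.array 5 := by
      rw [hF₇.array 5 (of_decide_eq_true rfl), hF₆.array 5 (of_decide_eq_true rfl),
        hF₅.array 5 (of_decide_eq_true rfl), hF₄.array 5 (of_decide_eq_true rfl),
        hF₃.array 5 (of_decide_eq_true rfl)]
    have e6 : s₇.array 6 = s₃.array 6 := by
      rw [hF₇.array 6 (of_decide_eq_true rfl), hF₆.array 6 (of_decide_eq_true rfl),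
        hF₅.array 6 (of_decide_eq_true rfl), hF₄.array 6 (of_decide_eq_true rfl)]
    have e7 : s₇.array 7 = s₅.array 7 := by
      rw [hF₇.array 7 (of_decide_eq_true rfl), hF₆.array 7 (of_decide_eq_true rfl)]
    have e10 : s₇.scalar 10 = f 2 := by
      rw [hF₇.scalar 10 (of_decide_eq_true rfl), hF₆.scalar 10 (of_decide_eq_true rfl),
        hF₅.scalar 10 (of_decide_eq_true rfl), hF₄.scalar 10 (of_decide_eq_true rfl),
        hF₃.scalar 10 (of_decide_eq_true rfl), h10₂]
    refine Runs.tryClique h1 hW (by omega) (le_trans ?_ hκ) hI₇ (by rwa [e4]) hTn (by rwa [e5]) hXn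
      (by rwa [e6]) hYn (by rwa [e7]) (by omega) e10 (hfn _ (by omega)) hy₇ hy hL'
    gcongr ?_ + 2
    gcongr 2 * (n * ?_)
    omega
  · calc Nat.fib (Y.card + 2) * (700 * n ^ 4 + 8) + 6
        ≤ Nat.fib (c + 2) * (700 * n ^ 4 + 8 * n ^ 4) + 6 * (Nat.fib (c + 2) * n ^ 4) := by
          gcongr <;> omega
      _ ≤ _ := by nlinarith
  · rintro S ⟨y, rfl, hy⟩ -
    exact ⟨y, hy, rfl⟩

end TryTail

/-! ## The whole program -/

section Enumerate
open Classical

variable {H : SimpleGraph ℕ} {d n W : ℕ} {s : Config}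

theorem Input.of_eq {s' : Config} (h : Input H n s) (h0 : s'.scalar 0 = s.scalar 0)
    (h0' : s'.array 0 = s.array 0) : Input H n s' :=
  ⟨by rw [h0, h.size], by rw [h0']; exact h.adj⟩

/-- Divide the scalar `5` by `n`, with quotient in the scalar `6`, given a bound in the scalar
`3`. -/
def Prog.divide : Prog :=
  .for 7 3 (.ite (.sub (.add (.var 5) (.lit 1)) (.var 0))
    (.seq (.assign 5 (.sub (.var 5) (.var 0))) (.assign 6 (.add (.var 6) (.lit 1)))) .skip)

/-- Division by repeated subtraction, always run for `g` rounds. After `j` rounds either all of them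
subtracted or the remainder is already below `n`, and `g ≥ a` rounds are enough. -/
theorem Runs.divide {a g : ℕ} (h1 : 1 ≤ n) (hnW : n ≤ W) (hn : s.scalar 0 = n)
    (h5 : s.scalar 5 = a) (h6 : s.scalar 6 = 0) (h3 : s.scalar 3 = g) (hag : a ≤ g)
    (hgW : g + 1 ≤ W) :
    Runs W (g * 30 + 6) .divide s fun s' => s'.scalar 5 = a % n ∧ s'.scalar 6 = a / n := by
  refine (Runs.for (N := g) (tb := 16) (fun j s' => s'.scalar 5 + n * s'.scalar 6 = a ∧
    s'.scalar 6 ≤ j ∧ (s'.scalar 6 = j ∨ s'.scalar 5 < n)) h3 hgW (by omega)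
    (of_decide_eq_true rfl) (of_decide_eq_true rfl) ?_ ?_).mono (by omega) ?_
  · simp (disch := decide) only [update_of_ne]
    rw [h5, h6]
    simp
  · rintro j hj s₁ hj₁ ⟨he, hle, hor⟩ hF₁
    have hn₁ : s₁.scalar 0 = n := by rw [hF₁.scalar 0 (of_decide_eq_true rfl), hn]
    refine (Runs.ite (e := .sub (.add (.var 5) (.lit 1)) (.var 0)) (t₁ := 8) (t₂ := 1) ?_
      (fun h => ?_) (fun h => ?_)).le (by simp [Expr.cost])
    · simp only [Expr.Fits, Expr.eval]; omega
    · simp only [Expr.eval, hn₁] at h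
      refine Runs.seq (t₁ := 4) (t₂ := 4) (Q := fun s' => s'.scalar 5 = s₁.scalar 5 - n)
        (Runs.assign (e := .sub (.var 5) (.var 0)) ?_ ?_) fun s₂ hs₂ hF₂ => ?_
      · simp only [Expr.Fits]; omega
      · simp [Expr.eval, hn₁]
      have h6₂ : s₂.scalar 6 = s₁.scalar 6 := hF₂.scalar 6 (of_decide_eq_true rfl)
      refine Runs.assign (e := .add (.var 6) (.lit 1)) ?_ ?_
      · simp only [Expr.Fits, Expr.eval]; omega
      · simp (disch := decide) only [update_of_ne, update_self, Expr.eval]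
        rw [h6₂, hs₂, Nat.mul_add, Nat.mul_one]
        omega
    · simp only [Expr.eval, hn₁] at h
      refine Runs.skip ?_
      simp (disch := decide) only [update_of_ne]
      omega
  · rintro s' ⟨he, hle, hor⟩ -
    have hlt : s'.scalar 5 < n := by
      rcases hor with h | h
      · rw [h] at he
        -- If all `g` rounds subtracted, then `n * g` was removed from `a ≤ g ≤ n * g`, leaving
        -- remainder zero.
        by_contra hcon
        have : g ≤ n * g := Nat.le_mul_of_pos_left _ h1
        omega
      · exact h
    rw [← he]
    constructor
    · rw [Nat.add_mul_mod_self_left, Nat.mod_eq_of_lt hlt]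
    · rw [Nat.add_mul_div_left _ _ h1, Nat.div_eq_of_lt hlt, Nat.zero_add]

/-- Store in the array `1` the digits of the scalar `3` in base `n`. -/
def Prog.digits : Prog :=
  .seq (.assign 6 (.var 3)) (.for 4 1 (.seq (.assign 5 (.var 6)) (.seq (.assign 6 (.lit 0))
    (.seq .divide (.store 1 (.var 4) (.var 5))))))

theorem Runs.digits {g k : ℕ} (h1 : 1 ≤ n) (hnW : n ≤ W) (hn : s.scalar 0 = n)
    (h3 : s.scalar 3 = g) (hgW : g + 1 ≤ W) (hk : s.scalar 1 = k) (hkW : k + 1 ≤ W) :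
    Runs W (k * (g * 30 + 30) + 10) .digits s fun s' => ∀ j < k, s'.array 1 j = g / n ^ j % n := by
  refine (Runs.seq (t₁ := 2) (t₂ := k * (g * 30 + 21 + 8) + 6) (Q := fun s' => s'.scalar 6 = g)
    (Runs.assign (e := .var 3) (by simp only [Expr.Fits]; omega) (by simpa [Expr.eval] using h3))
    fun s₁ hs₁ hF₁ => ?_).le (by nlinarith [Nat.zero_le k])
  refine (Runs.for (N := k) (tb := g * 30 + 21) (fun i s' => s'.scalar 6 = g / n ^ i ∧
    ∀ j < i, s'.array 1 j = g / n ^ j % n) ?_ hkW (by omega) (of_decide_eq_true rfl)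
    (of_decide_eq_true rfl) ?_ ?_).mono le_rfl fun s' hs' _ => hs'.2
  · rw [hF₁.scalar 1 (of_decide_eq_true rfl), hk]
  · simp [hs₁]
  · rintro i hi s₂ hi₂ ⟨h6, hdig⟩ hF₂
    have hle : g / n ^ i ≤ g := Nat.div_le_self _ _
    refine (Runs.seq (t₁ := 2) (t₂ := g * 30 + 15) (Q := fun s' => s'.scalar 5 = g / n ^ i)
      (Runs.assign (e := .var 6) (by simp only [Expr.Fits]; omega)
        (by simpa [Expr.eval] using h6)) fun s₃ hs₃ hF₃ => ?_).le (by omega)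
    refine (Runs.seq (t₁ := 2) (t₂ := g * 30 + 10) (Q := fun s' => s'.scalar 6 = 0)
      (Runs.assign (e := .lit 0) (Nat.zero_le _) (by simp [Expr.eval]))
      fun s₄ hs₄ hF₄ => ?_).le (by omega)
    refine (Runs.seq (t₂ := 3) (Runs.divide (a := g / n ^ i) (g := g) h1 hnW ?_ ?_ hs₄ ?_ hle hgW)
      fun s₅ hs₅ hF₅ => ?_).le (by omega)
    · rw [hF₄.scalar 0 (of_decide_eq_true rfl), hF₃.scalar 0 (of_decide_eq_true rfl),
        hF₂.scalar 0 (of_decide_eq_true rfl), hF₁.scalar 0 (of_decide_eq_true rfl), hn]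
    · rw [hF₄.scalar 5 (of_decide_eq_true rfl), hs₃]
    · rw [hF₄.scalar 3 (of_decide_eq_true rfl), hF₃.scalar 3 (of_decide_eq_true rfl),
        hF₂.scalar 3 (of_decide_eq_true rfl), hF₁.scalar 3 (of_decide_eq_true rfl), h3]
    have h4₅ : s₅.scalar 4 = i := by
      rw [hF₅.scalar 4 (of_decide_eq_true rfl), hF₄.scalar 4 (of_decide_eq_true rfl),
        hF₃.scalar 4 (of_decide_eq_true rfl), hi₂]
    have ha₅ : s₅.array 1 = s₂.array 1 := by
      rw [hF₅.array 1 (of_decide_eq_true rfl), hF₄.array 1 (of_decide_eq_true rfl),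
        hF₃.array 1 (of_decide_eq_true rfl)]
    have hmod : g / n ^ i % n ≤ g / n ^ i := Nat.mod_le _ _
    refine Runs.store (i := .var 4) (e := .var 5) ?_ ?_ ⟨?_, ?_⟩
    · simp only [Expr.Fits]; omega
    · simp only [Expr.Fits]; omega
    · simp (disch := decide) only [update_of_ne]
      rw [hs₅.2, Nat.div_div_eq_div_mul, pow_succ]
    · intro j hj
      simp only [update_self, Expr.eval, h4₅, hs₅.1]
      by_cases hji : j = i
      · rw [hji, update_self]
      · rw [update_of_ne hji, ha₅, hdig j (by omega)]

/-- Store in the array `3` the powers of `2` up to the exponent in the scalar `12`. -/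
def Prog.powTable : Prog :=
  .seq (.store 3 (.lit 0) (.lit 1)) (.for 34 12 (.store 3 (.add (.var 34) (.lit 1))
    (.add (.arr 3 (.var 34)) (.arr 3 (.var 34)))))

theorem Runs.powTable {m : ℕ} (h1 : 1 ≤ n) (hW : n + 1 ≤ W) (hm : s.scalar 12 = m) (hmn : m ≤ n)
    (hpW : 2 ^ m ≤ W) :
    Runs W (30 * n ^ 1) .powTable s fun s' => ∀ j ≤ m, s'.array 3 j = 2 ^ j := by
  refine (Runs.seq (t₁ := 3) (t₂ := 27 * n ^ 1) (Q := fun s' => s'.array 3 0 = 1)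
    (Runs.store (i := .lit 0) (e := .lit 1) (by simp only [Expr.Fits]; omega)
      (by simp only [Expr.Fits]; omega) (by simp [Expr.eval])) fun s₁ hs₁ hF₁ => ?_).le
    (by simp only [pow_one]; omega)
  refine (Runs.for (N := m) (tb := 9) (fun i s' => ∀ j ≤ i, s'.array 3 j = 2 ^ j) ?_ (by omega)
    (by omega) (of_decide_eq_true rfl) (of_decide_eq_true rfl) (by simpa using hs₁) ?_).le
    (by simp only [pow_one]; omega)
  · rw [hF₁.scalar 12 (of_decide_eq_true rfl), hm]
  · intro i hi s₂ hi₂ hs₂ hF₂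
    have hpow : 2 ^ (i + 1) = 2 ^ i + 2 ^ i := by ring
    have hle : 2 ^ (i + 1) ≤ 2 ^ m := Nat.pow_le_pow_right (by omega) hi
    refine Runs.store (i := .add (.var 34) (.lit 1))
      (e := .add (.arr 3 (.var 34)) (.arr 3 (.var 34))) ?_ ?_ ?_
    · simp only [Expr.Fits, Expr.eval]; omega
    · simp only [Expr.Fits, Expr.eval, hi₂, hs₂ i le_rfl]; omega
    · intro j hj
      simp only [Expr.eval, hi₂, hs₂ i le_rfl, update_self]
      by_cases hji : j = i + 1
      · rw [hji, update_self, hpow]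
      · rw [update_of_ne hji, hs₂ j (by omega)]

/-- Store in the scalars `8`, …, `11` the first four entries of the array `1`. -/
def Prog.loadGuess : Prog :=
  .seq (.assign 8 (.arr 1 (.lit 0))) (.seq (.assign 9 (.arr 1 (.lit 1)))
    (.seq (.assign 10 (.arr 1 (.lit 2))) (.assign 11 (.arr 1 (.lit 3)))))

theorem Runs.loadGuess {f : ℕ → ℕ} (hW : n + 3 ≤ W) (hf : ∀ j < 4, s.array 1 j = f j)
    (hfn : ∀ j < 4, f j < n) :
    Runs W 12 .loadGuess s fun s' => s'.scalar 8 = f 0 ∧ s'.scalar 9 = f 1 ∧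
      s'.scalar 10 = f 2 ∧ s'.scalar 11 = f 3 := by
  have hfit : ∀ j < 4, ∀ s' : Config, s'.array 1 = s.array 1 →
      (Expr.arr 1 (.lit j)).Fits W s' := by
    intro j hj s' hs'
    simp only [Expr.Fits, Expr.eval, hs', hf j hj]
    have := hfn j hj
    omega
  have hev : ∀ j < 4, ∀ s' : Config, s'.array 1 = s.array 1 →
      (Expr.arr 1 (.lit j)).eval s' = f j := by
    intro j hj s' hs'
    simp only [Expr.eval, hs', hf j hj]
  refine (Runs.seq (t₁ := 3) (t₂ := 9) (Q := fun s' => s'.scalar 8 = f 0)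
    (Runs.assign (hfit 0 (by omega) s rfl) (by simpa using hev 0 (by omega) s rfl))
    fun s₁ hs₁ hF₁ => ?_)
  have e₁ : s₁.array 1 = s.array 1 := hF₁.array 1 (of_decide_eq_true rfl)
  refine (Runs.seq (t₁ := 3) (t₂ := 6) (Q := fun s' => s'.scalar 9 = f 1)
    (Runs.assign (hfit 1 (by omega) s₁ e₁) (by simpa using hev 1 (by omega) s₁ e₁))
    fun s₂ hs₂ hF₂ => ?_)
  have e₂ : s₂.array 1 = s.array 1 := (hF₂.array 1 (of_decide_eq_true rfl)).trans e₁
  refine (Runs.seq (t₁ := 3) (t₂ := 3) (Q := fun s' => s'.scalar 10 = f 2)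
    (Runs.assign (hfit 2 (by omega) s₂ e₂) (by simpa using hev 2 (by omega) s₂ e₂))
    fun s₃ hs₃ hF₃ => ?_)
  have e₃ : s₃.array 1 = s.array 1 := (hF₃.array 1 (of_decide_eq_true rfl)).trans e₂
  refine Runs.assign (hfit 3 (by omega) s₃ e₃) ?_
  simp (disch := decide) only [update_of_ne, update_self]
  refine ⟨?_, ?_, hs₃, hev 3 (by omega) s₃ e₃⟩
  · rw [hF₃.scalar 8 (of_decide_eq_true rfl), hF₂.scalar 8 (of_decide_eq_true rfl), hs₁]
  · rw [hF₃.scalar 9 (of_decide_eq_true rfl), hs₂]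

/-- Report all candidates with the guess in the array `1`. -/
def Prog.search (d : ℕ) : Prog :=
  .seq .loadGuess (.seq (.set 2 22 (.common 8 9 22)) (.seq (.countSet 2 12 22)
    (.seq .powTable (.seq (.assign 13 (.arr 3 (.var 12))) (.for 14 13 (.tryTail d))))))

/-- The set `S` is a candidate for the guess `f`. -/
def IsCandidate (H : SimpleGraph ℕ) (d n : ℕ) (f : ℕ → ℕ) (S : Finset ℕ) : Prop :=
  ∃ x < 2 ^ (common H n (f 0) (f 1)).card,
    ∃ y, S = candidate H d n (tail d n f (common H n (f 0) (f 1)) x) (f 2) (f 3) y ∧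
      y < Nat.fib ((commonBelow H n (heads H d n
        (tail d n f (common H n (f 0) (f 1)) x)) (f 2) (f 3)).card + 2)

theorem Frame.tryTail {s s' : Config} (h : Frame (Prog.for 14 13 (Prog.tryTail d)) s s') :
    (∀ x ∈ [0, 10, 11, 12, 17], s'.scalar x = s.scalar x) ∧
      ∀ a ∈ [0, 1, 2, 3], s'.array a = s.array a := by
  -- The number `d` occurs only in literals, so the written registers can be computed for the closed
  -- program with `d = 0`.
  have h₁ : (Prog.for 14 13 (Prog.tryTail d)).scalars =
    (Prog.for 14 13 (Prog.tryTail 0)).scalars := rfl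
  have h₂ : (Prog.for 14 13 (Prog.tryTail d)).arrays =
    (Prog.for 14 13 (Prog.tryTail 0)).arrays := rfl
  refine ⟨fun x hx => h.scalar x ?_, fun a ha => h.array a ?_⟩
  · rw [h₁]
    revert x
    decide +kernel
  · rw [h₂]
    revert a
    decide +kernel

/-- The first two guessed vertices fix the set whose subsets are tried, at most `2 ^ c` of them; the
next two fix the domain of the cliques. -/
theorem Runs.search {c κ : ℕ} {L : List (Finset ℕ)} {f : ℕ → ℕ} (h1 : 1 ≤ n)
    (hW : n * n + 3 * n + 10 ≤ W) (hdW : 2 * d + 5 ≤ W)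
    (hκ : 2 * (n * (κ + 2 ^ c * Nat.fib (c + 2))) + 2 ≤ W)
    (hc : ∀ u v, (common H n u v).card ≤ c) (hs : Input H n s) (h17 : s.scalar 17 = 2 * d)
    (hf : ∀ j < 2 * d + 4, s.array 1 j = f j) (hfn : ∀ j < 2 * d + 4, f j < n)
    (hL : Collected H d n s L κ) :
    Runs W ((1300 + 28 * d) * (2 ^ c * (Nat.fib (c + 2) * n ^ 4))) (.search d) s
      (Extends H d n L κ (2 ^ c * Nat.fib (c + 2)) (IsCandidate H d n f)) := by
  have hMpos : 1 ≤ Nat.fib (c + 2) := Nat.fib_pos.2 (by omega)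
  have hApos : 1 ≤ 2 ^ c := Nat.one_le_two_pow
  have hn4 : 1 ≤ n ^ 4 := Nat.one_le_pow _ _ h1
  have hn1 : n ^ 1 ≤ n ^ 4 := Nat.pow_le_pow_right h1 (by omega)
  have hMn : n ^ 4 ≤ Nat.fib (c + 2) * n ^ 4 := Nat.le_mul_of_pos_left _ hMpos
  have hAMn : Nat.fib (c + 2) * n ^ 4 ≤ 2 ^ c * (Nat.fib (c + 2) * n ^ 4) :=
    Nat.le_mul_of_pos_left _ hApos
  set M := Nat.fib (c + 2) with hM
  have hAW : 2 ^ c + 1 ≤ W := by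
    have h2 : 2 ^ c ≤ 2 ^ c * M := Nat.le_mul_of_pos_right _ hMpos
    have h3 : κ + 2 ^ c * M ≤ n * (κ + 2 ^ c * M) := Nat.le_mul_of_pos_left _ h1
    omega
  rw [show (1300 + 28 * d) * (2 ^ c * (M * n ^ 4)) =
    1300 * (2 ^ c * (M * n ^ 4)) + 28 * (d * (2 ^ c * (M * n ^ 4))) by ring]
  refine (Runs.seq (t₂ := 1280 * (2 ^ c * (M * n ^ 4)) + 28 * (d * (2 ^ c * (M * n ^ 4))))
    (Runs.loadGuess (by omega) (fun j hj => hf j (by omega)) fun j hj => hfn j (by omega))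
    fun s₁ hs₁ hF₁ => ?_).le (by omega)
  obtain ⟨h8, h9, h10, h11⟩ := hs₁
  have hI₁ : Input H n s₁ := hs.frame hF₁ (of_decide_eq_true rfl) (of_decide_eq_true rfl)
  unfold IsCandidate
  have hZn := common_subset (H := H) (n := n) (f 0) (f 1)
  have hZc := hc (f 0) (f 1)
  have hset : Runs W (60 * n ^ 1) (.set 2 22 (.common 8 9 22)) s₁
      fun s' => IsChar n (s'.array 2) (common H n (f 0) (f 1)) := by
    refine (Runs.set (fun v => (f 0 ≠ f 1 ∧ ¬ H.Adj (f 0) (f 1)) ∧ H.Adj (f 0) v ∧ H.Adj (f 1) v)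
      hI₁.size (by omega) (by omega) fun i hi s' hb hx ha hi' => ?_).mono ?_ fun s' hs' _ => ?_
    · have hI : Input H n s' :=
        ⟨by rw [hx 0 (by omega), hI₁.size], by rw [hb 0 (by omega)]; exact hI₁.adj⟩
      exact Ind.common hW hI (by rw [hx 8 (by omega), h8]) (by rw [hx 9 (by omega), h9]) hi'
        (hfn _ (by omega)) (hfn _ (by omega)) hi
    · simp only [Expr.common, Expr.adj, Expr.not, Expr.cost, pow_one]; omega
    · refine hs'.congr fun v hv => ?_
      simp only [_root_.common, Finset.mem_filter]
  refine (Runs.seq (t₂ := 1220 * (2 ^ c * (M * n ^ 4)) + 28 * (d * (2 ^ c * (M * n ^ 4)))) hset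
    fun s₂ hs₂ hF₂ => ?_).le (by omega)
  generalize common H n (f 0) (f 1) = Z at hs₂ hZn hZc ⊢
  have hI₂ : Input H n s₂ := hI₁.frame hF₂ (of_decide_eq_true rfl) (of_decide_eq_true rfl)
  have hZcn := card_le_of_subset_range hZn
  have hZA : 2 ^ Z.card ≤ 2 ^ c := Nat.pow_le_pow_right (by omega) hZc
  refine (Runs.seq (t₂ := 1190 * (2 ^ c * (M * n ^ 4)) + 28 * (d * (2 ^ c * (M * n ^ 4))))
    (Runs.countSet h1 hI₂.size (by omega) (by omega) (by omega) (by omega) hs₂ hZn)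
    fun s₃ hs₃ hF₃ => ?_).le (by omega)
  refine (Runs.seq (t₂ := 1150 * (2 ^ c * (M * n ^ 4)) + 28 * (d * (2 ^ c * (M * n ^ 4))))
    (Runs.powTable h1 (by omega) hs₃ hZcn (by omega)) fun s₄ hs₄ hF₄ => ?_).le
    (by omega)
  have h12 : s₄.scalar 12 = Z.card := by rw [hF₄.scalar 12 (of_decide_eq_true rfl), hs₃]
  have h3 := hs₄ Z.card le_rfl
  refine (Runs.seq (t₁ := 3) (t₂ := 1140 * (2 ^ c * (M * n ^ 4)) + 28 * (d * (2 ^ c * (M * n ^ 4))))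
    (Q := fun s' => s'.scalar 13 = 2 ^ Z.card)
    (Runs.assign (e := .arr 3 (.var 12)) ?_ ?_) fun s₅ hs₅ hF₅ => ?_).le
    (by omega)
  · simp only [Expr.Fits, Expr.eval, h12, h3]; omega
  · simp [Expr.eval, h12, h3]
  have hI₅ : Input H n s₅ := ((hI₂.frame hF₃ (of_decide_eq_true rfl) (of_decide_eq_true rfl)).frame
    hF₄ (of_decide_eq_true rfl) (of_decide_eq_true rfl)).frame
    hF₅ (of_decide_eq_true rfl) (of_decide_eq_true rfl)
  have hL₅ : Collected H d n s₅ L κ :=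
    ((((hL.frame hF₁ (of_decide_eq_true rfl) (of_decide_eq_true rfl) rfl).frame hF₂
      (of_decide_eq_true rfl) (of_decide_eq_true rfl) rfl).frame hF₃
      (of_decide_eq_true rfl) (of_decide_eq_true rfl) rfl).frame hF₄
      (of_decide_eq_true rfl) (of_decide_eq_true rfl) rfl).frame hF₅
      (of_decide_eq_true rfl) (of_decide_eq_true rfl) rfl
  refine (Runs.forExtends (M := M) hs₅ (by omega) (by omega) (of_decide_eq_true rfl)
    (of_decide_eq_true rfl) (by omega) hL₅ fun x hx s₆ L' hx₆ hF₆ hL' =>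
      Runs.tryTail (f := f) (Z := Z) (c := c) h1 hW (by omega) (le_trans ?_ hκ) hc
        (hI₅.of_eq (hF₆.tryTail.1 0 (by simp)) (hF₆.tryTail.2 0 (by simp))) ?_ hZn ?_ ?_ ?_ hfn ?_ ?_ ?_
        (by omega) hx₆ hx hL').mono ?_
    fun s' hs' _ => hs'.mono (Nat.mul_le_mul hZA le_rfl) fun S hS _ => hS
  -- At most `x * M` insertions precede this round and `M` belong to it; as `x < 2 ^ c`, the total
  -- stays below the reserved word size.
  · have hxA : x * M + M ≤ 2 ^ c * M := by
      rw [← Nat.succ_mul]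
      exact Nat.mul_le_mul (by omega) le_rfl
    gcongr ?_ + 2
    gcongr 2 * (n * ?_)
    omega
  · rw [hF₆.tryTail.2 2 (by simp), hF₅.array 2 (of_decide_eq_true rfl),
      hF₄.array 2 (of_decide_eq_true rfl), hF₃.array 2 (of_decide_eq_true rfl)]
    exact hs₂
  · rw [hF₆.tryTail.1 12 (by simp), hF₅.scalar 12 (of_decide_eq_true rfl), h12]
  · rw [hF₆.tryTail.1 17 (by simp), hF₅.scalar 17 (of_decide_eq_true rfl),
      hF₄.scalar 17 (of_decide_eq_true rfl), hF₃.scalar 17 (of_decide_eq_true rfl),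
      hF₂.scalar 17 (of_decide_eq_true rfl), hF₁.scalar 17 (of_decide_eq_true rfl), h17]
  · rw [hF₆.tryTail.2 1 (by simp), hF₅.array 1 (of_decide_eq_true rfl),
      hF₄.array 1 (of_decide_eq_true rfl), hF₃.array 1 (of_decide_eq_true rfl),
      hF₂.array 1 (of_decide_eq_true rfl), hF₁.array 1 (of_decide_eq_true rfl)]
    exact hf
  · rw [hF₆.tryTail.1 10 (by simp), hF₅.scalar 10 (of_decide_eq_true rfl),
      hF₄.scalar 10 (of_decide_eq_true rfl), hF₃.scalar 10 (of_decide_eq_true rfl),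
      hF₂.scalar 10 (of_decide_eq_true rfl), h10]
  · rw [hF₆.tryTail.1 11 (by simp), hF₅.scalar 11 (of_decide_eq_true rfl),
      hF₄.scalar 11 (of_decide_eq_true rfl), hF₃.scalar 11 (of_decide_eq_true rfl),
      hF₂.scalar 11 (of_decide_eq_true rfl), h11]
  · rw [hF₆.tryTail.2 3 (by simp), hF₅.array 3 (of_decide_eq_true rfl)]
    exact hs₄
  · calc 2 ^ Z.card * ((1100 + 28 * d) * (M * n ^ 4) + 8) + 6
        ≤ 2 ^ c * ((1100 + 28 * d) * (M * n ^ 4) + 8 * (M * n ^ 4)) +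
            6 * (2 ^ c * (M * n ^ 4)) := by
          gcongr <;> omega
      _ = 1114 * (2 ^ c * (M * n ^ 4)) + 28 * (d * (2 ^ c * (M * n ^ 4))) := by ring
      _ ≤ _ := by omega

/-- Enumerate the maximal sets of co-degeneracy at most `d`. -/
def Prog.enumerate (d : ℕ) : Prog :=
  .seq (.assign 1 (.lit (2 * d + 4))) (.seq (.assign 17 (.lit (2 * d))) (.seq (.assign 2 (.lit 1))
    (.seq (.for 34 1 (.assign 2 (.mul (.var 2) (.var 0))))
      (.for 3 2 (.seq .digits (.search d))))))

theorem Frame.search {s s' : Config}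
    (h : Frame (Prog.for 3 2 (.seq .digits (Prog.search d))) s s') :
    (∀ x ∈ [0, 1, 17], s'.scalar x = s.scalar x) ∧ s'.array 0 = s.array 0 := by
  -- Again `d` enters only through literals, and the lists agree with those for `d = 0`.
  have h₁ : (Prog.for 3 2 (.seq .digits (Prog.search d))).scalars =
    (Prog.for 3 2 (.seq .digits (Prog.search 0))).scalars := rfl
  have h₂ : (Prog.for 3 2 (.seq .digits (Prog.search d))).arrays =
    (Prog.for 3 2 (.seq .digits (Prog.search 0))).arrays := rfl
  refine ⟨fun x hx => h.scalar x ?_, h.array 0 ?_⟩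
  · rw [h₁]
    revert x
    decide +kernel
  · rw [h₂]
    decide +kernel

/-- The `N = n ^ (2 * d + 4)` guesses are numbered in base `n`. The search costs about `N * (M * n ^
4)` and the extraction of digits about `d * (N * N)`; both fit into the exponent `9 * d + 4` because
`d ≥ 1`. One number serves as time bound and as word bound. -/
theorem Runs.enumerate {c B : ℕ} (h1 : 1 ≤ n) (hd : 1 ≤ d)
    (hB : B = 2 ^ c * Nat.fib (c + 2) * n ^ (9 * d + 4)) (hW : W = (2000 + 200 * d) * B)
    (hc : ∀ u v, (common H n u v).card ≤ c) (hs : Input H n s) (hL : Collected H d n s [] 0) :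
    Runs W ((2000 + 200 * d) * B) (.enumerate d) s
      (Extends H d n [] 0 (n ^ (2 * d + 4) * (2 ^ c * Nat.fib (c + 2)))
        fun S => ∃ g < n ^ (2 * d + 4), IsCandidate H d n (fun j => g / n ^ j % n) S) := by
  set M := 2 ^ c * Nat.fib (c + 2) with hM
  have hMpos : 1 ≤ M := Nat.mul_pos (by positivity) (Nat.fib_pos.2 (by omega))
  have hpow : ∀ k ≤ 9 * d + 4, M * n ^ k ≤ B := fun k hk => by
    rw [hB]; exact Nat.mul_le_mul le_rfl (Nat.pow_le_pow_right h1 hk)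
  have hpow' : ∀ k ≤ 9 * d + 4, n ^ k ≤ B := fun k hk =>
    (Nat.le_mul_of_pos_left _ hMpos).trans (hpow k hk)
  have hBpos : 1 ≤ B := by simpa using hpow' 0 (by omega)
  have hnB : n ≤ B := by simpa using hpow' 1 (by omega)
  have hnnB : n * n ≤ B := by simpa [sq] using hpow' 2 (by omega)
  set N := n ^ (2 * d + 4) with hN
  have hNpos : 1 ≤ N := Nat.one_le_pow _ _ h1
  have hNB : N ≤ B := hpow' _ (by omega)
  -- This uses `4 * d + 8 ≤ 9 * d + 4` and pays for the divisions by repeated subtraction.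
  have hNNB : N * N ≤ B := by
    rw [hN, ← pow_add]; exact hpow' _ (by omega)
  -- At most `N * M` candidates are inserted with at most `n` nodes each, which bounds the trie.
  have hMNB : n * (N * M) ≤ B := by
    have := hpow (2 * d + 5) (by omega)
    calc n * (N * M) = M * n ^ (2 * d + 5) := by rw [hN]; ring
      _ ≤ B := this
  have hMN4 : N * (M * n ^ 4) ≤ B := by
    have := hpow (2 * d + 8) (by omega)
    calc N * (M * n ^ 4) = M * n ^ (2 * d + 8) := by rw [hN]; ring
      _ ≤ B := this
  have hdB : d ≤ d * B := Nat.le_mul_of_pos_right _ hBpos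
  have hWB : W = 2000 * B + 200 * (d * B) := by rw [hW]; ring
  rw [show (2000 + 200 * d) * B = 2000 * B + 200 * (d * B) by ring]
  refine (Runs.seq (t₁ := 2) (t₂ := 1990 * B + 200 * (d * B))
    (Q := fun s' => s'.scalar 1 = 2 * d + 4)
    (Runs.assign (e := .lit (2 * d + 4)) (by simp only [Expr.Fits]; omega) (by simp [Expr.eval]))
    fun s₁ hs₁ hF₁ => ?_).le (by omega)
  refine (Runs.seq (t₁ := 2) (t₂ := 1980 * B + 200 * (d * B))
    (Q := fun s' => s'.scalar 17 = 2 * d)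
    (Runs.assign (e := .lit (2 * d)) (by simp only [Expr.Fits]; omega) (by simp [Expr.eval]))
    fun s₂ hs₂ hF₂ => ?_).le (by omega)
  refine (Runs.seq (t₁ := 2) (t₂ := 1970 * B + 200 * (d * B)) (Q := fun s' => s'.scalar 2 = 1)
    (Runs.assign (e := .lit 1) (by simp only [Expr.Fits]; omega) (by simp [Expr.eval]))
    fun s₃ hs₃ hF₃ => ?_).le (by omega)
  have hI₃ : Input H n s₃ := ((hs.frame hF₁ (of_decide_eq_true rfl) (of_decide_eq_true rfl)).frame
    hF₂ (of_decide_eq_true rfl) (of_decide_eq_true rfl)).frame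
    hF₃ (of_decide_eq_true rfl) (of_decide_eq_true rfl)
  have h1₃ : s₃.scalar 1 = 2 * d + 4 := by
    rw [hF₃.scalar 1 (of_decide_eq_true rfl), hF₂.scalar 1 (of_decide_eq_true rfl), hs₁]
  refine (Runs.seq (t₁ := (2 * d + 4) * (4 + 8) + 6) (t₂ := 1800 * B + 170 * (d * B))
    (Q := fun s' => s'.scalar 2 = N)
    (Runs.for (N := 2 * d + 4) (tb := 4) (fun i s' => s'.scalar 2 = n ^ i) h1₃ (by omega)
      (by omega) (of_decide_eq_true rfl) (of_decide_eq_true rfl) ?_ ?_)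
    fun s₄ hs₄ hF₄ => ?_).le (by omega)
  · simpa (disch := decide) only [update_of_ne, pow_zero] using hs₃
  · intro i hi s₄ hi₄ hs₄ hF₄
    have h0 : s₄.scalar 0 = n := by rw [hF₄.scalar 0 (of_decide_eq_true rfl), hI₃.size]
    have hle := hpow' i (by omega)
    have hle' := hpow' (i + 1) (by omega)
    rw [pow_succ] at hle'
    refine Runs.assign (e := .mul (.var 2) (.var 0)) ?_ ?_
    · simp only [Expr.Fits, Expr.eval, h0, hs₄]; omega
    · simp (disch := decide) only [update_of_ne, update_self, Expr.eval]
      rw [h0, hs₄, pow_succ]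
  have hI₄ : Input H n s₄ := hI₃.frame hF₄ (of_decide_eq_true rfl) (of_decide_eq_true rfl)
  have hL₄ : Collected H d n s₄ [] 0 :=
    (((hL.frame hF₁ (of_decide_eq_true rfl) (of_decide_eq_true rfl) rfl).frame hF₂
      (of_decide_eq_true rfl) (of_decide_eq_true rfl) rfl).frame hF₃
      (of_decide_eq_true rfl) (of_decide_eq_true rfl) rfl).frame hF₄
      (of_decide_eq_true rfl) (of_decide_eq_true rfl) rfl
  refine (Runs.forExtends (M := M) (tb := (2 * d + 4) * (N * 30 + 30) + 10 +
      (1300 + 28 * d) * (M * n ^ 4)) hs₄ (by omega) (by omega) (of_decide_eq_true rfl)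
    (of_decide_eq_true rfl) (by omega) hL₄ fun g hg s₅ L' hg₅ hF₅ hL' => ?_).le ?_
  · have hI₅ : Input H n s₅ := hI₄.of_eq (hF₅.search.1 0 (by simp)) hF₅.search.2
    have h1₅ : s₅.scalar 1 = 2 * d + 4 := by
      rw [hF₅.search.1 1 (by simp), hF₄.scalar 1 (of_decide_eq_true rfl), h1₃]
    have h17 : s₅.scalar 17 = 2 * d := by
      rw [hF₅.search.1 17 (by simp), hF₄.scalar 17 (of_decide_eq_true rfl),
        hF₃.scalar 17 (of_decide_eq_true rfl), hs₂]
    refine (Runs.seq (Runs.digits h1 (by omega) hI₅.size hg₅ (by omega) h1₅ (by omega))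
      fun s₆ hs₆ hF₆ => Runs.search (c := c) h1 (by omega) (by omega) ?_ hc
        (hI₅.frame hF₆ (of_decide_eq_true rfl) (of_decide_eq_true rfl))
        (by rw [hF₆.scalar 17 (of_decide_eq_true rfl), h17]) hs₆
        (fun j _ => Nat.mod_lt _ (by omega))
        (hL'.frame hF₆ (of_decide_eq_true rfl) (of_decide_eq_true rfl) rfl)).le ?_
    · have hle : 0 + g * M + M ≤ N * M := by
        rw [Nat.zero_add, ← Nat.succ_mul]
        exact Nat.mul_le_mul (by omega) le_rfl
      have := Nat.mul_le_mul (le_refl n) hle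
      change 2 * (n * (0 + g * M + M)) + 2 ≤ W
      omega
    · rw [← Nat.mul_assoc (2 ^ c)]
      gcongr
  · have e : N * ((2 * d + 4) * (N * 30 + 30) + 10 + (1300 + 28 * d) * (M * n ^ 4) + 8) + 6 =
        60 * (d * (N * N)) + 60 * (d * N) + 120 * (N * N) + 138 * N +
          1300 * (N * (M * n ^ 4)) + 28 * (d * (N * (M * n ^ 4))) + 6 := by ring
    rw [e]
    have := Nat.mul_le_mul (le_refl d) hNNB
    have := Nat.mul_le_mul (le_refl d) hNB
    have := Nat.mul_le_mul (le_refl d) hMN4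
    omega

end Enumerate

/-! ## Every maximal set is a candidate -/

section Cover
open Classical

variable {H : SimpleGraph ℕ} {d n : ℕ}

theorem exists_digits (n k : ℕ) : ∀ f : ℕ → ℕ, (∀ j < k, f j < n) →
    ∃ g < n ^ k, ∀ j < k, g / n ^ j % n = f j := by
  induction k with
  | zero => exact fun f _ => ⟨0, by simp, by simp⟩
  | succ k ih =>
    intro f hf
    obtain ⟨g, hg, hgf⟩ := ih (fun j => f (j + 1)) fun j hj => hf _ (by omega)
    have h0 := hf 0 (by omega)
    have hn : 0 < n := by omega
    refine ⟨f 0 + n * g, ?_, fun j hj => ?_⟩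
    · have : n * (g + 1) ≤ n * n ^ k := Nat.mul_le_mul le_rfl hg
      rw [pow_succ, Nat.mul_comm (n ^ k)]
      rw [Nat.mul_add] at this
      omega
    · rcases j with _ | j
      · rw [pow_zero, Nat.div_one, Nat.add_mul_mod_self_left, Nat.mod_eq_of_lt h0]
      · rw [pow_succ, Nat.mul_comm (n ^ j), ← Nat.div_div_eq_div_mul, Nat.add_mul_div_left _ _ hn,
          Nat.div_eq_of_lt h0, Nat.zero_add, hgf j (by omega)]

/-- The guess has a fixed number of slots; surplus slots repeat a member of `E`, which is why `E`
must be nonempty. -/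
theorem exists_image_range {E : Finset ℕ} {k : ℕ} (hE : E.Nonempty) (hk : E.card ≤ k) :
    ∃ e : ℕ → ℕ, (Finset.range k).image e = E ∧ ∀ i, e i ∈ E := by
  obtain ⟨v, hv⟩ := hE
  have hmem : ∀ i, E.toList.getD i v ∈ E := by
    intro i
    by_cases hi : i < E.toList.length
    · rw [List.getD_eq_getElem _ _ hi]
      exact Finset.mem_toList.1 (List.getElem_mem hi)
    · rwa [List.getD_eq_default _ _ (by omega)]
  refine ⟨fun i => E.toList.getD i v, ?_, hmem⟩
  ext x
  rw [Finset.mem_image]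
  constructor
  · rintro ⟨i, -, rfl⟩
    exact hmem i
  · intro hx
    obtain ⟨i, hi, rfl⟩ := List.getElem_of_mem (Finset.mem_toList.2 hx)
    refine ⟨i, Finset.mem_range.2 ?_, List.getD_eq_getElem _ _ hi⟩
    rw [Finset.length_toList] at hi
    omega

theorem IsCandidate.congr {f f' : ℕ → ℕ} {S : Finset ℕ} (h : IsCandidate H d n f S)
    (hf : ∀ j < 2 * d + 4, f j = f' j) : IsCandidate H d n f' S := by
  have ht : ∀ Z x, tail d n f Z x = tail d n f' Z x := by
    intro Z x
    unfold tail
    rw [Finset.image_congr (g := fun i => f' (i + 4))]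
    intro i hi
    exact hf _ (by have := Finset.mem_range.1 hi; omega)
  unfold IsCandidate at h ⊢
  simp only [hf 0 (by omega), hf 1 (by omega), hf 2 (by omega), hf 3 (by omega), ht] at h
  exact h

theorem exists_tail_code {Z E U : Finset ℕ} (hZ : Z ⊆ Finset.range n) (hU : U ⊆ Z) :
    ∃ x < 2 ^ Z.card, (iter (subsetStep Z) 0 n (Z.card, x, E)).2.2 = E ∪ U := by
  have hIco : ∀ v ∈ Z, v ∈ Finset.Ico 0 (0 + n) := fun v hv => by
    have := Finset.mem_range.1 (hZ hv)
    simpa using this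
  have := exists_subset_code Z n 0 E U hU fun v hv => hIco v (hU hv)
  rwa [Finset.filter_true_of_mem hIco, Finset.union_comm] at this

/-- Combines the two descriptions of a maximal clique: a seed completed greedily, with the small
clique inside the seed given by a code. -/
theorem MaxClique.exists_extension {T A : Finset ℕ} (hTn : T ⊆ Finset.range n) (hT : T.Nonempty)
    (hA : MaxClique H (heads H d n T) A) :
    ∃ k < n, ∃ u < n, ∃ y < Nat.fib ((commonBelow H n (heads H d n T) k u).card + 2),
      candidate H d n T k u y = T ∪ A := by
  have hXn : heads H d n T ⊆ Finset.range n := Finset.filter_subset _ _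
  have hcode : ∀ k u B, MaxClique H (commonBelow H n (heads H d n T) k u) B →
      extension H n (heads H d n T) k B = A →
      ∃ y < Nat.fib ((commonBelow H n (heads H d n T) k u).card + 2),
        candidate H d n T k u y = T ∪ A := by
    intro k u B hB hext
    have hsub : commonBelow H n (heads H d n T) k u ⊆ Finset.Ico 0 (0 + n) := by
      intro v hv
      have := Finset.mem_range.1 (common_subset k u (commonBelow_subset _ k u hv))
      simpa using this
    obtain ⟨y, hy, hit⟩ := MaxClique.exists_code n 0 _ ∅ B hsub hB
    refine ⟨y, hy, ?_⟩
    rw [candidate, hit, Finset.union_empty, hext]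
  have hfil : (heads H d n T).filter (· < n) = heads H d n T :=
    Finset.filter_true_of_mem fun v hv => Finset.mem_range.1 (hXn hv)
  obtain ⟨C, hC, hit⟩ := MaxClique.exists_seed hXn n A (by rwa [hfil])
  rcases hC with rfl | ⟨k, hk, u, hu, hkX, B, hB, rfl⟩
  · obtain ⟨t, ht⟩ := hT
    have htn := Finset.mem_range.1 (hTn ht)
    -- The empty seed is encoded by `k = u = t` with `t ∈ T`: such `k` is not a head and is not
    -- inserted, and the clique domain is empty because `k = u`.
    refine ⟨t, htn, t, htn, hcode t t ∅ ?_ ?_⟩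
    · have : commonBelow H n (heads H d n T) t t = ∅ := by simp [commonBelow, common]
      rw [this]
      exact ⟨subset_rfl, by simp, by simp⟩
    · rw [extension, if_neg, hit]
      simp [heads, ht]
  · exact ⟨k, hk, u, hu, hcode k u B hB (by rw [extension, if_pos hkX, hit])⟩

/-- The guess lists the pair for the tail, the pair for the clique seed and the exceptional
vertices, `2 * d + 4` base-`n` digits in all. -/
theorem MaxCoDeg.exists_isCandidate {S : Finset ℕ} (hS : MaxCoDeg H d n S) (hn : 1 ≤ n)
    (hd : 1 ≤ d) :
    ∃ g < n ^ (2 * d + 4), IsCandidate H d n (fun j => g / n ^ j % n) S := by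
  obtain ⟨T, hT, hTS, hA, p, hp, q, hq, E, U, hTEU, hE, hEd, hU⟩ := hS.exists_tail hn hd
  have hTn : T ⊆ Finset.range n := hTS.trans hS.1
  have hEn : ∀ v ∈ E, v < n := fun v hv =>
    Finset.mem_range.1 (hTn (by rw [hTEU]; exact Finset.mem_union_left _ hv))
  obtain ⟨k, hk, u, hu, y, hy, hcand⟩ := hA.exists_extension hTn hT
  obtain ⟨e, heE, he⟩ := exists_image_range hE hEd
  obtain ⟨x, hx, htail⟩ := exists_tail_code (E := E) (common_subset (H := H) (n := n) p q) hU
  obtain ⟨f, h0, h1, h2, h3, h4⟩ : ∃ f : ℕ → ℕ, f 0 = p ∧ f 1 = q ∧ f 2 = k ∧ f 3 = u ∧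
      ∀ i, f (i + 4) = e i :=
    ⟨fun j => match j with
      | 0 => p | 1 => q | 2 => k | 3 => u | i + 4 => e i, rfl, rfl, rfl, rfl, fun _ => rfl⟩
  have hfn : ∀ j, f j < n := by
    intro j
    rcases j with _ | _ | _ | _ | i
    exacts [h0 ▸ hp, h1 ▸ hq, h2 ▸ hk, h3 ▸ hu, h4 i ▸ hEn _ (he i)]
  obtain ⟨g, hg, hgf⟩ := exists_digits n (2 * d + 4) f fun j _ => hfn j
  refine ⟨g, hg, IsCandidate.congr (f := f) ?_ fun j hj => (hgf j hj).symm⟩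
  have ht : tail d n f (common H n p q) x = T := by
    rw [tail]
    simp only [h4]
    rw [heE, htail, hTEU]
  unfold IsCandidate
  rw [h0, h1, h2, h3]
  refine ⟨x, hx, y, ?_, ?_⟩
  · rw [ht, hcand, Finset.union_sdiff_of_subset hTS]
  · rwa [ht]

end Cover

/-! ## Transfer to graphs on `Fin n` -/

section Transfer
open Classical

variable {n d c : ℕ} {G : SimpleGraph (Fin n)}

/-- A graph on `Fin n` as a graph on the natural numbers. -/
def natGraph (G : SimpleGraph (Fin n)) : SimpleGraph ℕ := G.map Fin.valEmbedding

theorem natGraph_adj (u v : Fin n) : (natGraph G).Adj u v ↔ G.Adj u v :=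
  SimpleGraph.map_adj_apply (f := Fin.valEmbedding)

theorem lt_of_natGraph_adj {u v : ℕ} (h : (natGraph G).Adj u v) : u < n := by
  obtain ⟨a, b, -, rfl, -⟩ := (SimpleGraph.map_adj _ _ _ _).1 h
  exact a.2

theorem input_inputConfig (G : SimpleGraph (Fin n)) : Input (natGraph G) n (inputConfig G) := by
  refine ⟨by simp [inputConfig], fun u hu v hv => ?_⟩
  have : (∃ a b : Fin n, G.Adj a b ∧ u * n + v = (a : ℕ) * n + (b : ℕ)) ↔
      (natGraph G).Adj u v := by
    constructor
    · rintro ⟨a, b, hab, he⟩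
      have hn : 0 < n := by omega
      have hua : u = a := by
        have := congrArg (· / n) he
        simpa [Nat.mul_comm _ n, Nat.mul_add_div hn, Nat.div_eq_of_lt hv,
          Nat.div_eq_of_lt b.2] using this
      have hvb : v = b := by
        rw [hua] at he
        omega
      rw [hua, hvb]
      exact (natGraph_adj a b).2 hab
    · intro h
      exact ⟨⟨u, hu⟩, ⟨v, hv⟩, (natGraph_adj ⟨u, hu⟩ ⟨v, hv⟩).1 h, rfl⟩
  simp only [inputConfig, tv, true_and, this]

/-- Zeroed memory is the trie with only the root. Its empty label is not a word of length `n` as `n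
≥ 1`. -/
theorem collected_inputConfig (hn : 1 ≤ n) :
    Collected (natGraph G) d n (inputConfig G) [] 0 := by
  refine ⟨rfl, List.nodup_nil, by simp, by simp [inputConfig], fun _ => [], ?_, fun w hw => ?_⟩
  · have h30 : (inputConfig G).scalar 30 = 0 := by simp [inputConfig]
    have h12 : ∀ i, (inputConfig G).array 12 i = 0 := by simp [inputConfig]
    rw [h30]
    refine ⟨rfl, fun a ha b hb _ => by omega, fun m _ b _ h => absurd (h12 _) h,
      fun m _ b _ _ a _ => by simp, fun i _ => h12 i, fun a ha h => by omega⟩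
  · have : w ≠ [] := by
      rintro rfl
      simp at hw
      omega
    simp [this.symm]

/-- The bound holds for all pairs, since `common` is empty unless the two vertices are distinct and
non-adjacent; wrong guesses therefore cost no more than right ones. -/
theorem CClosed.card_common_le (h : CClosed G c) (u v : ℕ) :
    (common (natGraph G) n u v).card ≤ c := by
  by_cases hne : (common (natGraph G) n u v).Nonempty
  · obtain ⟨w, hw⟩ := hne
    simp only [common, Finset.mem_filter] at hw
    obtain ⟨-, ⟨huv, hadj⟩, huw, hvw⟩ := hw
    obtain ⟨a, rfl⟩ : ∃ a : Fin n, (a : ℕ) = u := ⟨⟨u, lt_of_natGraph_adj huw⟩, rfl⟩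
    obtain ⟨b, rfl⟩ : ∃ b : Fin n, (b : ℕ) = v := ⟨⟨v, lt_of_natGraph_adj hvw⟩, rfl⟩
    have hlt := h a b (fun h => huv (congrArg _ h)) fun h => hadj ((natGraph_adj a b).2 h)
    rw [Set.encard_eq_coe_toFinset_card, Nat.cast_lt] at hlt
    refine le_trans ?_ hlt.le
    rw [← Finset.card_map Fin.valEmbedding]
    refine Finset.card_le_card fun x hx => ?_
    simp only [common, Finset.mem_filter, Finset.mem_range] at hx
    obtain ⟨hxn, -, hax, hbx⟩ := hx
    rw [Finset.mem_map]
    refine ⟨⟨x, hxn⟩, ?_, rfl⟩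
    rw [Set.mem_toFinset, SimpleGraph.mem_commonNeighbors]
    exact ⟨(natGraph_adj a ⟨x, hxn⟩).1 hax, (natGraph_adj b ⟨x, hxn⟩).1 hbx⟩
  · rw [Finset.not_nonempty_iff_eq_empty] at hne
    rw [hne]
    simp

/-- The bounds `d` and `d + 1` differ because `nonNbrs` counts the vertex itself, whereas the
complement graph has no loops. -/
theorem encard_neighborSet_le_iff {T : Finset (Fin n)} {S : Set (T : Set (Fin n))} {Q : Finset ℕ}
    (hQ : ∀ m, m ∈ Q ↔ ∃ x ∈ S, ((x : Fin n) : ℕ) = m) (v : S) :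
    (((G.induce (T : Set (Fin n)))ᶜ.induce S).neighborSet v).encard ≤ d ↔
      (nonNbrs (natGraph G) Q ((v : (T : Set (Fin n))) : Fin n)).card ≤ d + 1 := by
  set val : S → ℕ := fun x => (((x : (T : Set (Fin n))) : Fin n) : ℕ) with hval
  have hinj : Injective val := fun x y h => Subtype.ext (Subtype.ext (Fin.ext h))
  have hv : val v ∈ nonNbrs (natGraph G) Q (val v) := by
    rw [nonNbrs, Finset.mem_filter, hQ]
    exact ⟨⟨v, v.2, rfl⟩, (natGraph G).irrefl⟩
  have himg : val '' (((G.induce (T : Set (Fin n)))ᶜ.induce S).neighborSet v) =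
      ((nonNbrs (natGraph G) Q (val v)).erase (val v) : Finset ℕ) := by
    ext m
    simp only [Set.mem_image, SimpleGraph.mem_neighborSet, SimpleGraph.comap_adj,
      SimpleGraph.compl_adj, Embedding.subtype_apply, Finset.coe_erase, Set.mem_sdiff,
      Finset.mem_coe, Set.mem_singleton_iff, nonNbrs, Finset.mem_filter, hQ]
    constructor
    · rintro ⟨x, ⟨hne, hna⟩, rfl⟩
      refine ⟨⟨⟨x, x.2, rfl⟩, fun h => hna ((natGraph_adj _ _).1 h)⟩, fun h => hne ?_⟩
      rw [hinj h]
    · rintro ⟨⟨⟨x, hx, rfl⟩, hna⟩, hne⟩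
      refine ⟨⟨x, hx⟩, ⟨fun h => hne ?_, fun h => hna ((natGraph_adj _ _).2 h)⟩, rfl⟩
      rw [hval]
      simp only [h]
  rw [← hinj.encard_image, himg, Set.encard_coe_eq_coe_finsetCard, Nat.cast_le,
    Finset.card_erase_of_mem hv]
  change _ ↔ (nonNbrs (natGraph G) Q (val v)).card ≤ d + 1
  omega

theorem codegeneracyLE_induce_iff (T : Finset (Fin n)) :
    CodegeneracyLE (G.induce (T : Set (Fin n))) d ↔
      CoDeg (natGraph G) d (T.map Fin.valEmbedding) := by
  constructor
  · intro h Q hQT hQ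
    have hmem : ∀ m, m ∈ Q ↔ ∃ x ∈ {x : (T : Set (Fin n)) | ((x : Fin n) : ℕ) ∈ Q},
        ((x : Fin n) : ℕ) = m := by
      intro m
      constructor
      · intro hm
        obtain ⟨a, ha, rfl⟩ := Finset.mem_map.1 (hQT hm)
        exact ⟨⟨a, ha⟩, hm, rfl⟩
      · rintro ⟨x, hx, rfl⟩
        exact hx
    obtain ⟨m, hm⟩ := hQ
    obtain ⟨x, hx, -⟩ := (hmem m).1 hm
    obtain ⟨v, hv⟩ := h _ ⟨x, hx⟩
    exact ⟨_, v.2, (encard_neighborSet_le_iff hmem v).1 hv⟩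
  · intro h S hS
    set Q := (Finset.range n).filter fun m => ∃ x ∈ S, ((x : Fin n) : ℕ) = m with hQ
    have hmem : ∀ m, m ∈ Q ↔ ∃ x ∈ S, ((x : Fin n) : ℕ) = m := by
      intro m
      rw [hQ, Finset.mem_filter, Finset.mem_range]
      refine ⟨fun h => h.2, fun h => ⟨?_, h⟩⟩
      obtain ⟨x, -, rfl⟩ := h
      exact (x : Fin n).2
    obtain ⟨x, hx⟩ := hS
    have hQT : Q ⊆ T.map Fin.valEmbedding := fun m hm => by
      obtain ⟨v, hv, rfl⟩ := (hmem m).1 hm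
      exact Finset.mem_map.2 ⟨v, v.2, rfl⟩
    obtain ⟨m, hm, hdeg⟩ := h Q hQT ⟨_, (hmem _).2 ⟨x, hx, rfl⟩⟩
    obtain ⟨v, hv, rfl⟩ := (hmem m).1 hm
    exact ⟨⟨v, hv⟩, (encard_neighborSet_le_iff hmem ⟨v, hv⟩).2 hdeg⟩

/-- By heredity, a proper superset of small co-degeneracy exists only if already a single vertex can
be added. -/
theorem isMaximalCodegenerate_iff (S : Finset (Fin n)) :
    IsMaximalCodegenerate G d S ↔ MaxCoDeg (natGraph G) d n (S.map Fin.valEmbedding) := by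
  unfold IsMaximalCodegenerate Maximal
  simp only [codegeneracyLE_induce_iff]
  constructor
  · rintro ⟨h, hmax⟩
    refine ⟨fun m hm => ?_, h, fun v hv hvS hins => hvS ?_⟩
    · obtain ⟨a, -, rfl⟩ := Finset.mem_map.1 hm
      exact Finset.mem_range.2 a.2
    · have := hmax (y := insert ⟨v, hv⟩ S) (by rwa [Finset.map_insert])
        (Finset.subset_insert _ _) (Finset.mem_insert_self _ _)
      exact Finset.mem_map.2 ⟨_, this, rfl⟩
  · rintro ⟨-, h, hmax⟩
    refine ⟨h, fun T hT hST x hx => ?_⟩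
    by_contra hxS
    refine hmax x x.2 ?_ (hT.mono ?_)
    · intro hmem
      obtain ⟨a, ha, hax⟩ := Finset.mem_map.1 hmem
      exact hxS (by rwa [← Fin.ext hax])
    · exact Finset.insert_subset (Finset.mem_map.2 ⟨x, hx, rfl⟩) (Finset.map_subset_map.2 hST)

/-- A set of natural numbers as a set of elements of `Fin n`. -/
noncomputable def toFin (n : ℕ) (S : Finset ℕ) : Finset (Fin n) :=
  Finset.univ.filter fun i => (i : ℕ) ∈ S

theorem map_toFin {S : Finset ℕ} (hS : S ⊆ Finset.range n) :
    (toFin n S).map Fin.valEmbedding = S := by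
  ext m
  simp only [toFin, Finset.mem_map, Finset.mem_filter, Finset.mem_univ, true_and]
  constructor
  · rintro ⟨a, ha, rfl⟩
    exact ha
  · intro hm
    exact ⟨⟨m, Finset.mem_range.1 (hS hm)⟩, hm, rfl⟩

theorem toFin_map (S : Finset (Fin n)) : toFin n (S.map Fin.valEmbedding) = S := by
  ext a
  simp [toFin, Fin.val_inj]

theorem charVector_toFin (S : Finset ℕ) : charVector (toFin n S) = word n S := by
  apply List.ext_getElem
  · simp [charVector, word]
  · intro i h1 h2
    simp [charVector, word, toFin, tv]

theorem enumerates_of_collected {s : Config} {L : List (Finset ℕ)} {k : ℕ}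
    (h : Collected (natGraph G) d n s L k) (hL : ∀ S, MaxCoDeg (natGraph G) d n S → S ∈ L) :
    Enumerates (IsMaximalCodegenerate G d) s.output := by
  obtain ⟨hout, hnd, hmax, -⟩ := h
  refine ⟨L.map (toFin n), ?_, fun S => ?_, ?_⟩
  · refine hnd.map_on fun S hS S' hS' he => ?_
    rw [← map_toFin (hmax S hS).1, he, map_toFin (hmax S' hS').1]
  · rw [isMaximalCodegenerate_iff, List.mem_map]
    constructor
    · rintro ⟨S', hS', rfl⟩
      rw [map_toFin (hmax S' hS').1]
      exact hmax S' hS'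
    · intro h
      exact ⟨_, hL _ h, toFin_map S⟩
  · rw [hout, List.flatMap_map]
    simp only [charVector_toFin]

end Transfer

/-! ### Numerical estimates and the main theorem. -/

theorem fib_le_pow (c : ℕ) : (Nat.fib (c + 2) : ℝ) ≤ 2 * (7 / 4) ^ c := by
  induction c using Nat.strong_induction_on with
  | _ c ih =>
    rcases c with _ | _ | c
    · norm_num
    · norm_num [Nat.fib]
    · have h1 := ih c (by omega)
      have h2 := ih (c + 1) (by omega)
      rw [Nat.fib_add_two, Nat.cast_add]
      rw [show c + 2 + 1 = c + 1 + 2 by ring]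
      have hpos : (0 : ℝ) ≤ (7 / 4) ^ c := by positivity
      calc (Nat.fib (c + 2) : ℝ) + Nat.fib (c + 1 + 2)
          ≤ 2 * (7 / 4) ^ c + 2 * (7 / 4) ^ (c + 1) := add_le_add h1 h2
        -- The induction closes because `1 + 7/4 ≤ (7/4) ^ 2`.
        _ ≤ 2 * (7 / 4) ^ (c + 2) := by
          rw [pow_succ, pow_add]
          nlinarith

theorem two_pow_mul_fib_le {c d : ℕ} (hd : 1 ≤ d) :
    (2 : ℝ) ^ c * Nat.fib (c + 2) ≤ 2 * (19 / 10) ^ (2 * d * c) := by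
  calc (2 : ℝ) ^ c * Nat.fib (c + 2) ≤ 2 ^ c * (2 * (7 / 4) ^ c) := by
        gcongr
        exact fib_le_pow c
    _ = 2 * (7 / 2) ^ c := by
        rw [show (7 / 2 : ℝ) = 2 * (7 / 4) by norm_num, mul_pow]
        ring
    -- Here `7/2 ≤ 361/100`; this margin below `4` is what permits a base smaller than 2.
    _ ≤ 2 * ((19 / 10) ^ 2) ^ c := by
        gcongr
        norm_num
    _ = 2 * (19 / 10) ^ (2 * c) := by rw [pow_mul]
    _ ≤ 2 * (19 / 10) ^ (2 * d * c) := by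
        gcongr
        · norm_num
        · omega

theorem mainTheorem8 (d : ℕ) (hd : 1 ≤ d) :
    ∃ (γ : ℝ) (P : Prog) (K : ℝ), 0 < γ ∧ γ < 2 ∧
      ∀ (n : ℕ) (G : SimpleGraph (Fin n)) (c : ℕ), 1 ≤ n → CClosed G c →
        ∃ (W t : ℕ) (s : Config),
          Exec W P (inputConfig G) t s ∧
          Enumerates (IsMaximalCodegenerate G d) s.output ∧
          (t : ℝ) ≤ K * (n : ℝ) ^ (9 * d + 4) * γ ^ (2 * d * c) ∧
          (W : ℝ) ≤ K * (n : ℝ) ^ (9 * d + 4) * γ ^ (2 * d * c) := by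
  -- The factor 2 in the constant is the one in `two_pow_mul_fib_le`.
  refine ⟨19 / 10, .enumerate d, 2 * (2000 + 200 * d), by norm_num, by norm_num,
    fun n G c hn hG => ?_⟩
  set B := 2 ^ c * Nat.fib (c + 2) * n ^ (9 * d + 4) with hB
  obtain ⟨t, s, ht, hex, L, hL, -, hcov⟩ := Runs.enumerate hn hd hB rfl hG.card_common_le
    (input_inputConfig G) (collected_inputConfig hn)
  have hbound : (((2000 + 200 * d) * B : ℕ) : ℝ) ≤
      2 * (2000 + 200 * d) * (n : ℝ) ^ (9 * d + 4) * (19 / 10) ^ (2 * d * c) := by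
    rw [hB]
    push_cast
    calc (2000 + 200 * (d : ℝ)) * (2 ^ c * (Nat.fib (c + 2) : ℝ) * (n : ℝ) ^ (9 * d + 4))
        ≤ (2000 + 200 * (d : ℝ)) * (2 * (19 / 10) ^ (2 * d * c) * (n : ℝ) ^ (9 * d + 4)) := by
          exact mul_le_mul_of_nonneg_left
            (mul_le_mul_of_nonneg_right (two_pow_mul_fib_le hd) (by positivity)) (by positivity)
      _ = _ := by ring
  exact ⟨_, t, s, hex, enumerates_of_collected hL fun S hS =>
    hcov S (hS.exists_isCandidate hn hd) hS, le_trans (by exact_mod_cast ht) hbound, hbound⟩
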